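/- **Conventions.** Graphs are finite and simplicial, not necessarily connected. For a graph $\Lambda$ let $A(\Lambda)=\langle V(\Lambda)\mid [a,b]=1 \text{ for adjacent } a,b\rangle$ be its right-angled Artin group, $S(\Lambda)$ its Salvetti complex (one vertex, and one $n$-torus for every complete subgraph with $n$ vertices), and $p:X(\Lambda)\to S(\Lambda)$ the universal cover, on which $A(\Lambda)$ acts by deck transformations. Assume that $S(\Lambda)$ is 2-dimensional. *Product subcomplexes.* A standard product subcomplex of $S(\Lambda)$ is the image of a local isometry $P_1\times P_2\to S(\Lambda)$, where $P_1,P_2$ are finite connected graphs that are not simply connected and have no vertices of valency $1$. A standard product subcomplex of $X(\Lambda)$ is a subcomplex that is maximal among the embedded products of two infinite trees contained in $p^{-1}(L)$, for some standard product subcomplex $L$ of $S(\Lambda)$. A maximal product subcomplex is a standard product subcomplex of $X(\Lambda)$ that is maximal under inclusion. *Intersection complex.* The vertices of $I(X(\Lambda))$ are the maximal product subcomplexes of $X(\Lambda)$; $k+1$ of them span a $k$-simplex if and only if their intersection $W$ contains a flat. To a simplex $\triangle$ is assigned the stabilizer $G_\triangle\le A(\Lambda)$ of the standard product subcomplex $K_\triangle\subseteq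 W$ at finite Hausdorff distance from $W$. The product structure of $K_\triangle$ gives $G_\triangle=A_\triangle\times B_\triangle$ with free coordinates $A_\triangle,B_\triangle$ (each consists of the elements preserving every slice of $K_\triangle$ in one of the two directions), up to interchanging the two coordinates. For a chain of simplices $\triangle^n\supset\dots\supset\triangle^0$ (with $\dim\triangle^i=i$) the coordinates are chosen so that $A_{\triangle^{i+1}}$ and $B_{\triangle^{i+1}}$ are free factors of $A_{\triangle^{i}}$ and $B_{\triangle^{i}}$, respectively. *Semi-isomorphism.* A semi-morphism $\Phi:I(X(\Lambda))\to I(X(\Lambda'))$ is a simplicial map, injective on every simplex, such that for every chain $\triangle^n\supset\dots\supset\triangle^0$, with suitable such choices of coordinates for the chain and for its image, $A_{\Phi(\triangle^{i+1})}=A_{\Phi(\triangle^{i})}$ implies $A_{\triangle^{i+1}}=A_{\triangle^{i}}$, and $B_{\Phi(\triangle^{i+1})}=B_{\Phi(\triangle^{i})}$ implies $B_{\triangle^{i+1}}=B_{\triangle^{i}}$, for all $0\le i<n$. A semi-isomorphism is a bijective semi-morphism whose inverse is a semi-morphism and which preserves the quasi-isometric type of the assigned groups: for every simplex $\triangle$,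 the groups $G_\triangle$ and $G_{\Phi(\triangle)}$ have the same type among $\mathbb Z\times\mathbb Z$, $\mathbb Z\times\mathbb F$, $\mathbb F\times\mathbb F$ ($\mathbb F$ a non-abelian finitely generated free group), i.e. the same number of infinite cyclic coordinates. **Theorem.** Let $T$ be a finite tree of diameter $\ge 3$, and let $\Lambda$ be a finite simplicial graph whose Salvetti complex $S(\Lambda)$ is 2-dimensional. Then $I(X(\Lambda))$ is semi-isomorphic to $I(X(T))$ if and only if $\Lambda$ is a tree of diameter $\ge 3$. -/

import Mathlib

universe u v

/-! ## Combinatorial graphs and square complexes -/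

/-- A 1-dimensional complex (loops and multiple edges allowed), given by its vertices and its
oriented edges; every geometric edge is a pair `{e, rev e}`. -/
structure OGraph where
  V : Type u
  E : Type u
  src : E → V
  rev : E → E
  rev_rev : ∀ e, rev (rev e) = e
  rev_ne : ∀ e, rev e ≠ e

namespace OGraph

/-- Terminal vertex of an oriented edge. -/
def tgt (P : OGraph.{u}) (e : P.E) : P.V := P.src (P.rev e)

/-- There is an edge path of length at most `n` from the first vertex to the second. -/
inductive Within (P : OGraph.{u}) : ℕ → P.V → P.V → Prop
  | refl (n : ℕ) (x : P.V) : Within P n x x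
  | step {n : ℕ} {x : P.V} (e : P.E) (h : Within P n x (P.src e)) : Within P (n + 1) x (P.tgt e)

def Connected (P : OGraph.{u}) : Prop :=
  Nonempty P.V ∧ ∀ x y : P.V, ∃ n, P.Within n x y

/-- No vertex has valency one. -/
def Leafless (P : OGraph.{u}) : Prop :=
  ∀ e : P.E, ∃ f : P.E, f ≠ e ∧ P.src f = P.src e

/-- There is a closed edge path of positive length without backtracking; for a connected graph
this says that the graph is not simply connected. -/
def HasReducedLoop (P : OGraph.{u}) : Prop :=
  ∃ (e : P.E) (l : List P.E),
    List.IsChain (fun a b => P.tgt a = P.src b ∧ b ≠ P.rev a) (e :: l) ∧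
      P.tgt ((e :: l).getLast (List.cons_ne_nil e l)) = P.src e

/-- A simplicial graph as a graph with oriented edges. -/
def ofSimpleGraph {α : Type u} (T : SimpleGraph α) : OGraph.{u} where
  V := α
  E := T.Dart
  src d := d.fst
  rev d := d.symm
  rev_rev d := d.symm_symm
  rev_ne d := d.symm_ne

/-- The real line, subdivided at the integers. -/
noncomputable def line : OGraph.{0} := ofSimpleGraph (SimpleGraph.hasse ℤ)

end OGraph

/-- A square complex. The squares are recorded by their boundary paths (all four starting points
and both directions); distinct squares have distinct boundary paths, which is the case for products
of graphs, for Salvetti complexes and for their universal covers. -/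
structure SquareComplex extends OGraph.{u} where
  IsSquare : E → E → E → E → Prop
  path : ∀ {a b c d}, IsSquare a b c d →
    src (rev a) = src b ∧ src (rev b) = src c ∧ src (rev c) = src d ∧ src (rev d) = src a
  rotate : ∀ {a b c d}, IsSquare a b c d → IsSquare b c d a
  flip : ∀ {a b c d}, IsSquare a b c d → IsSquare (rev d) (rev c) (rev b) (rev a)

/-- Names for cells: a vertex, an oriented edge, or a square with its boundary path. -/
inductive SquareComplex.Cell (Y : SquareComplex.{u}) : Type u
  | vert (x : Y.V) : Cell Y
  | edge (e : Y.E) : Cell Y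
  | square (a b c d : Y.E) : Cell Y

/-- The cells of a square complex. Subcomplexes are sets of cells, ordered by inclusion. -/
def SquareComplex.cells (Y : SquareComplex.{u}) : Set Y.Cell :=
  {s | match s with
    | .vert _ => True
    | .edge _ => True
    | .square a b c d => Y.IsSquare a b c d}

/-- The oriented edges `e` and `f` starting at the same vertex span an edge of the link of that
vertex: they are the two sides of a corner of a square. -/
def SquareComplex.Corner (Y : SquareComplex.{u}) (e f : Y.E) : Prop :=
  ∃ b c, Y.IsSquare e b c (Y.rev f)

/-- Combinatorial maps of square complexes: vertices, edges and squares are taken to vertices,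
edges and squares, respectively. -/
structure SquareMap (X : SquareComplex.{u}) (Y : SquareComplex.{v}) where
  onV : X.V → Y.V
  onE : X.E → Y.E
  map_src : ∀ e, onV (X.src e) = Y.src (onE e)
  map_rev : ∀ e, onE (X.rev e) = Y.rev (onE e)
  map_square : ∀ {a b c d}, X.IsSquare a b c d → Y.IsSquare (onE a) (onE b) (onE c) (onE d)

namespace SquareMap

variable {X : SquareComplex.{u}} {Y : SquareComplex.{v}}

def onCell (f : SquareMap X Y) : X.Cell → Y.Cell
  | .vert x => .vert (f.onV x)
  | .edge e => .edge (f.onE e)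
  | .square a b c d => .square (f.onE a) (f.onE b) (f.onE c) (f.onE d)

/-- The image of a combinatorial map, a subcomplex of the target. -/
def image (f : SquareMap X Y) : Set Y.Cell := f.onCell '' X.cells

/-- The preimage of a subcomplex. -/
def preimage (f : SquareMap X Y) (K : Set Y.Cell) : Set X.Cell := X.cells ∩ f.onCell ⁻¹' K

def IsEmbedding (f : SquareMap X Y) : Prop :=
  Function.Injective f.onV ∧ Function.Injective f.onE

/-- At every vertex the induced map of links is injective and has full image. -/
def IsLocalIsometry (f : SquareMap X Y) : Prop :=
  ∀ e e' : X.E, X.src e = X.src e' →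
    (f.onE e = f.onE e' → e = e') ∧ (Y.Corner (f.onE e) (f.onE e') → X.Corner e e')

end SquareMap

/-- The boundary paths of the squares `e × f` in a product of two graphs. -/
inductive OGraph.ProdSquare (P Q : OGraph.{u}) :
    (P.E × Q.V) ⊕ (P.V × Q.E) → (P.E × Q.V) ⊕ (P.V × Q.E) →
    (P.E × Q.V) ⊕ (P.V × Q.E) → (P.E × Q.V) ⊕ (P.V × Q.E) → Prop
  | hor (e : P.E) (f : Q.E) : ProdSquare P Q (.inl (e, Q.src f)) (.inr (P.tgt e, f))
      (.inl (P.rev e, Q.tgt f)) (.inr (P.src e, Q.rev f))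
  | ver (e : P.E) (f : Q.E) : ProdSquare P Q (.inr (P.src e, f)) (.inl (e, Q.tgt f))
      (.inr (P.tgt e, Q.rev f)) (.inl (P.rev e, Q.src f))

/-- The product of two graphs. -/
def OGraph.prod (P Q : OGraph.{u}) : SquareComplex.{u} where
  V := P.V × Q.V
  E := (P.E × Q.V) ⊕ (P.V × Q.E)
  src
    | .inl (e, y) => (P.src e, y)
    | .inr (x, f) => (x, Q.src f)
  rev
    | .inl (e, y) => .inl (P.rev e, y)
    | .inr (x, f) => .inr (x, Q.rev f)
  rev_rev := by rintro (⟨e, y⟩ | ⟨x, f⟩) <;> simp [P.rev_rev, Q.rev_rev]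
  rev_ne := by rintro (⟨e, y⟩ | ⟨x, f⟩) <;> simp [P.rev_ne, Q.rev_ne]
  IsSquare := OGraph.ProdSquare P Q
  path := by
    rintro a b c d (⟨e, f⟩ | ⟨e, f⟩) <;> simp [OGraph.tgt, P.rev_rev, Q.rev_rev]
  rotate := by
    rintro a b c d (⟨e, f⟩ | ⟨e, f⟩)
    · simpa [OGraph.tgt, P.rev_rev, Q.rev_rev] using OGraph.ProdSquare.ver (P.rev e) f
    · simpa [OGraph.tgt, P.rev_rev, Q.rev_rev] using OGraph.ProdSquare.hor e (Q.rev f)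
  flip := by
    rintro a b c d (⟨e, f⟩ | ⟨e, f⟩)
    · simpa [OGraph.tgt, P.rev_rev, Q.rev_rev] using OGraph.ProdSquare.ver e f
    · simpa [OGraph.tgt, P.rev_rev, Q.rev_rev] using OGraph.ProdSquare.hor e f

/-! ## Standard product subcomplexes -/

/-- A standard product subcomplex of `Y`: the image of a local isometry from the product of two
finite connected graphs which are not simply connected and have no leaves. -/
def IsStandardProduct {Y : SquareComplex.{u}} (K : Set Y.Cell) : Prop :=
  ∃ (P Q : OGraph.{u}) (f : SquareMap (P.prod Q) Y),
    (Finite P.V ∧ Finite P.E ∧ P.Connected ∧ P.Leafless ∧ P.HasReducedLoop) ∧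
    (Finite Q.V ∧ Finite Q.E ∧ Q.Connected ∧ Q.Leafless ∧ Q.HasReducedLoop) ∧
    f.IsLocalIsometry ∧ f.image = K

/-- The embedded subcomplexes that are products of two infinite trees. -/
def IsTreeProduct {X : SquareComplex.{u}} (K : Set X.Cell) : Prop :=
  ∃ (α β : Type u) (S : SimpleGraph α) (T : SimpleGraph β)
    (f : SquareMap ((OGraph.ofSimpleGraph S).prod (OGraph.ofSimpleGraph T)) X),
    Infinite α ∧ Infinite β ∧ S.IsTree ∧ T.IsTree ∧ f.IsEmbedding ∧ f.image = K

/-- A standard product subcomplex of the universal cover `p : X → Y`: a p-lift of a standard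
product subcomplex `L` of `Y`, i.e. a product of two infinite trees in the preimage of `L` that is
maximal with these properties. -/
def IsStandardProductLift {X Y : SquareComplex.{u}} (p : SquareMap X Y) (K : Set X.Cell) : Prop :=
  ∃ L : Set Y.Cell, IsStandardProduct L ∧
    Maximal (fun K' : Set X.Cell => IsTreeProduct K' ∧ K' ⊆ p.preimage L) K

/-- A maximal product subcomplex of the universal cover `p : X → Y`. -/
def IsMaximalProduct {X Y : SquareComplex.{u}} (p : SquareMap X Y) (M : Set X.Cell) : Prop :=
  Maximal (IsStandardProductLift p) M

/-- A flat: an embedded copy of the plane, subdivided into unit squares. -/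
def IsFlat {X : SquareComplex.{u}} (F : Set X.Cell) : Prop :=
  ∃ f : SquareMap (OGraph.line.prod OGraph.line) X, f.IsEmbedding ∧ f.image = F

/-- For a subcomplex `K` of `W`: the Hausdorff distance between `K` and `W` is finite. -/
def FiniteHausdorff {X : SquareComplex.{u}} (K W : Set X.Cell) : Prop :=
  ∃ n : ℕ, ∀ x : X.V, .vert x ∈ W → ∃ y : X.V, .vert y ∈ K ∧ X.toOGraph.Within n y x

open scoped Pointwise in
/-- `A × B` is the stabilizer of the product subcomplex `K`, with its coordinates: `K` is a product
of two infinite trees `S × T`, `A` is the group of all elements of the stabilizer of `K` that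
preserve every slice `S × {y}` and `B` is the group of all those that preserve every slice
`{x} × T`. -/
def IsProductStabilizer {X : SquareComplex.{u}} {G : Type u} [Group G] [MulAction G X.Cell]
    (K : Set X.Cell) (A B : Subgroup G) : Prop :=
  ∃ (α β : Type u) (S : SimpleGraph α) (T : SimpleGraph β)
    (f : SquareMap ((OGraph.ofSimpleGraph S).prod (OGraph.ofSimpleGraph T)) X),
    Infinite α ∧ Infinite β ∧ S.IsTree ∧ T.IsTree ∧ f.IsEmbedding ∧ f.image = K ∧
    A = MulAction.stabilizer G K ⊓
      ⨅ y : β, MulAction.stabilizer G (Set.range fun x : α => SquareComplex.Cell.vert (f.onV (x, y))) ∧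
    B = MulAction.stabilizer G K ⊓
      ⨅ x : α, MulAction.stabilizer G (Set.range fun y : β => SquareComplex.Cell.vert (f.onV (x, y)))

/-! ## Complexes of join groups and semi-isomorphisms -/

/-- A simplicial complex with a product `A × B` of two subgroups of `G` assigned to every simplex.
The order of the two coordinates is not part of the data: `assigned s A B` says that `A × B`, with
coordinates taken in this order, is the group assigned to `s`. -/
structure GroupedComplex (G : Type u) [Group G] where
  V : Type u
  faces : Set (Finset V)
  nonempty : ∀ s ∈ faces, s.Nonempty
  down_closed : ∀ s ∈ faces, ∀ t ⊆ s, t.Nonempty → t ∈ faces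
  assigned : Finset V → Subgroup G → Subgroup G → Prop

/-- The intersection complex of the universal cover `p : X → Y`, where `G` is the group of deck
transformations: vertices are the maximal product subcomplexes; finitely many of them span a simplex
when their intersection `W` contains a flat; the group assigned to this simplex is the stabilizer
of the standard product subcomplex `K ⊆ W` at finite Hausdorff distance from `W`. -/
def intersectionComplex {X Y : SquareComplex.{u}} (p : SquareMap X Y) (G : Type u) [Group G]
    [MulAction G X.Cell] : GroupedComplex G where
  V := {M : Set X.Cell // IsMaximalProduct p M}
  faces := {s | s.Nonempty ∧ ∃ F, IsFlat F ∧ ∀ M ∈ s, F ⊆ M.1}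
  nonempty _ hs := hs.1
  down_closed := by
    rintro s ⟨-, F, hF, h⟩ t hts ht
    exact ⟨ht, F, hF, fun M hM => h M (hts hM)⟩
  assigned s A B := ∃ K : Set X.Cell, IsStandardProductLift p K ∧
    (∀ M ∈ s, K ⊆ M.1) ∧ FiniteHausdorff K {c | ∀ M ∈ s, c ∈ M.1} ∧ IsProductStabilizer K A B

/-- `A₂` is a free factor of `A₁`: `A₁` is the free product of `A₂` and a further subgroup. -/
def IsFreeFactor {G : Type u} [Group G] (A₂ A₁ : Subgroup G) : Prop :=
  ∃ C : Subgroup G, A₂ ⊔ C = A₁ ∧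
    Function.Injective (Monoid.Coprod.lift A₂.subtype C.subtype)

namespace GroupedComplex

variable {G : Type u} [Group G] {H : Type v} [Group H]

/-- A chain `c n ⊃ … ⊃ c 0` of an `n`-simplex: `c i` is an `i`-simplex and a face of `c (i+1)`. -/
def IsSimplexChain (X : GroupedComplex G) {n : ℕ} (c : Fin (n + 1) → Finset X.V) : Prop :=
  Monotone c ∧ ∀ i, c i ∈ X.faces ∧ (c i).card = i + 1

/-- `A i × B i` are the groups assigned to the simplices of the chain `c`, with coordinates chosen
such that there are pairwise free factor inclusions along the chain. -/
def IsAssignedSequence (X : GroupedComplex G) {n : ℕ} (c : Fin (n + 1) → Finset X.V)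
    (A B : Fin (n + 1) → Subgroup G) : Prop :=
  (∀ i, X.assigned (c i) (A i) (B i)) ∧
    ∀ i : Fin n, IsFreeFactor (A i.succ) (A i.castSucc) ∧ IsFreeFactor (B i.succ) (B i.castSucc)

open Classical in
/-- A semi-morphism: a combinatorial map (simplicial, and injective on every simplex) such that
for every chain, and with suitable coordinates, equality of consecutive coordinates in the target
implies equality of the corresponding coordinates in the source. -/
structure IsSemiMorphism (X : GroupedComplex G) (Y : GroupedComplex H) (φ : X.V → Y.V) : Prop where
  map_face : ∀ s ∈ X.faces, s.image φ ∈ Y.faces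
  injOn : ∀ s ∈ X.faces, Set.InjOn φ s
  chain : ∀ (n : ℕ) (c : Fin (n + 1) → Finset X.V), X.IsSimplexChain c →
    ∃ (A B : Fin (n + 1) → Subgroup G) (A' B' : Fin (n + 1) → Subgroup H),
      X.IsAssignedSequence c A B ∧ Y.IsAssignedSequence (fun i => (c i).image φ) A' B' ∧
      ∀ i : Fin n, (A' i.succ = A' i.castSucc → A i.succ = A i.castSucc) ∧
        (B' i.succ = B' i.castSucc → B i.succ = B i.castSucc)

open Classical in
/-- The map preserves the quasi-isometric type (`ℤ × ℤ`, `ℤ × 𝔽` or `𝔽 × 𝔽`, with `𝔽` free and not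
abelian) of the assigned groups: corresponding assigned groups have, in suitable coordinates,
infinite cyclic factors in the same places. -/
def PreservesType (X : GroupedComplex G) (Y : GroupedComplex H) (φ : X.V → Y.V) : Prop :=
  ∀ s ∈ X.faces, ∃ (A B : Subgroup G) (A' B' : Subgroup H),
    X.assigned s A B ∧ Y.assigned (s.image φ) A' B' ∧
      (IsCyclic A ↔ IsCyclic A') ∧ (IsCyclic B ↔ IsCyclic B')

/-- There is a bijection of the underlying complexes which is, together with its inverse, a
semi-morphism, and which preserves the quasi-isometric type of assigned groups. -/
def SemiIsomorphic (X : GroupedComplex G) (Y : GroupedComplex H) : Prop :=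
  ∃ φ : X.V ≃ Y.V, IsSemiMorphism X Y φ ∧ IsSemiMorphism Y X φ.symm ∧ PreservesType X Y φ

end GroupedComplex

/-! ## Right-angled Artin groups and Salvetti complexes -/

section RAAG

variable {V : Type u} (Λ : SimpleGraph V)

/-- The right-angled Artin group with defining graph `Λ`. -/
abbrev RAAG : Type u :=
  PresentedGroup {r : FreeGroup V | ∃ a b, Λ.Adj a b ∧
    r = FreeGroup.of a * FreeGroup.of b * (FreeGroup.of a)⁻¹ * (FreeGroup.of b)⁻¹}

/-- The element `a` or `a⁻¹` of the right-angled Artin group. -/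
def RAAG.letter (l : V × Bool) : RAAG Λ :=
  if l.2 then PresentedGroup.of l.1 else (PresentedGroup.of l.1)⁻¹

theorem RAAG.letter_rev (a : V) (s : Bool) :
    RAAG.letter Λ (a, !s) = (RAAG.letter Λ (a, s))⁻¹ := by
  cases s <;> simp [RAAG.letter]

/-- The dimension of the Salvetti complex of `Λ`: its `n`-cubes correspond to the complete
subgraphs of `Λ` with `n` vertices. -/
noncomputable def salvettiDim : ℕ := Λ.cliqueNum

/-- The 2-skeleton of the Salvetti complex of `Λ` (the whole complex if its dimension is at most
two): one vertex, a loop for every vertex of `Λ`, and a torus for every edge of `Λ`. -/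
def salvetti : SquareComplex.{u} where
  V := PUnit
  E := V × Bool
  src _ := PUnit.unit
  rev l := (l.1, !l.2)
  rev_rev := by rintro ⟨a, s⟩; simp
  rev_ne := by rintro ⟨a, s⟩; simp
  IsSquare a b c d := Λ.Adj a.1 b.1 ∧ c = (a.1, !a.2) ∧ d = (b.1, !b.2)
  path _ := ⟨rfl, rfl, rfl, rfl⟩
  rotate := by
    rintro a b c d ⟨h, rfl, rfl⟩
    exact ⟨h.symm, rfl, by simp⟩
  flip := by
    rintro a b c d ⟨h, rfl, rfl⟩
    exact ⟨by simpa using h.symm, by simp, by simp⟩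

/-- The universal cover of the Salvetti complex: the vertices are the elements of the
right-angled Artin group, an oriented edge `(g, l)` goes from `g` to `g * l`, and the squares
are the lifts of the squares of the Salvetti complex. -/
def salvettiCover : SquareComplex.{u} where
  V := RAAG Λ
  E := RAAG Λ × (V × Bool)
  src e := e.1
  rev e := (e.1 * RAAG.letter Λ e.2, (e.2.1, !e.2.2))
  rev_rev := by rintro ⟨g, a, s⟩; simp [RAAG.letter_rev]
  rev_ne := by rintro ⟨g, a, s⟩; simp
  IsSquare a b c d := (salvetti Λ).IsSquare a.2 b.2 c.2 d.2 ∧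
    a.1 * RAAG.letter Λ a.2 = b.1 ∧ b.1 * RAAG.letter Λ b.2 = c.1 ∧
    c.1 * RAAG.letter Λ c.2 = d.1 ∧ d.1 * RAAG.letter Λ d.2 = a.1
  path h := h.2
  rotate h := ⟨(salvetti Λ).rotate h.1, h.2.2.1, h.2.2.2.1, h.2.2.2.2, h.2.1⟩
  flip := by
    rintro a b c d ⟨h, h₁, h₂, h₃, h₄⟩
    refine ⟨(salvetti Λ).flip h, ?_, ?_, ?_, ?_⟩ <;>
      simp only [RAAG.letter_rev, mul_inv_eq_iff_eq_mul, h₁, h₂, h₃, h₄]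

/-- The universal covering map, which forgets the starting points of edges. -/
def salvettiCovering : SquareMap (salvettiCover Λ) (salvetti Λ) where
  onV _ := PUnit.unit
  onE e := (e.2 : V × Bool)
  map_src _ := rfl
  map_rev _ := rfl
  map_square h := h.1

/-- The deck transformation given by `g`, i.e. left multiplication by `g`. -/
def salvettiDeck (g : RAAG Λ) : SquareMap (salvettiCover Λ) (salvettiCover Λ) where
  onV (x : RAAG Λ) := (g * x : RAAG Λ)
  onE e := (g * e.1, e.2)
  map_src _ := rfl
  map_rev e := by simp [salvettiCover, mul_assoc]
  map_square := by
    rintro a b c d ⟨h, h₁, h₂, h₃, h₄⟩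
    exact ⟨h, by rw [← h₁, mul_assoc], by rw [← h₂, mul_assoc], by rw [← h₃, mul_assoc],
      by rw [← h₄, mul_assoc]⟩

/-- The action of the right-angled Artin group on the universal cover by deck transformations. -/
instance salvettiAction : MulAction (RAAG Λ) (salvettiCover Λ).Cell where
  smul g := (salvettiDeck Λ g).onCell
  one_smul s := by
    change (salvettiDeck Λ 1).onCell s = s
    cases s <;> simp [SquareMap.onCell, salvettiDeck] <;> rfl
  mul_smul g h s := by
    change (salvettiDeck Λ (g * h)).onCell s =
      (salvettiDeck Λ g).onCell ((salvettiDeck Λ h).onCell s)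
    cases s <;> simp [SquareMap.onCell, salvettiDeck, mul_assoc]

/-- The intersection complex of the universal cover of the Salvetti complex of `Λ`. -/
def raagIntersectionComplex : GroupedComplex (RAAG Λ) :=
  intersectionComplex (salvettiCovering Λ) (RAAG Λ)

end RAAG

/-!
Both implications rest on a description of the intersection complex in terms of the group `RAAG Λ`
when `Λ` has no triangles. The parabolic subgroup `par Λ S` is generated by the vertices in `S`;
its cosets span subcomplexes `coset Λ g S` of the universal cover. A local isometry from a product
of two leafless graphs to the Salvetti complex labels the edges of the two factors by the sides of
a join `A ∪ B` in `Λ`, so the standard product subcomplexes of the Salvetti complex are those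
spanned by joins (`isStandardProduct_iff`). Their lifts are the cosets of parabolic subgroups of
joins, and the maximal product subcomplexes are the cosets of maximal joins
(`isMaximalProduct_iff`). Finitely many of them contain a common flat exactly if they contain a
common coset of the parabolic subgroup of an edge (`mem_faces_iff`), and the group assigned to a
simplex whose members meet in a coset `g * par Λ (A ∪ B)` is the product of the conjugates by `g`
of `par Λ A` and `par Λ B` (`assigned_of_inter`, `assigned_singleton`).

In a tree every join is contained in a star, so for a tree of diameter at least three the maximal
product subcomplexes are the cosets of the stars of the interior vertices. Two of them span an edge
if and only if they are of the form `coset T g (star T v)` and `coset T g (star T w)` with `v` and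
`w` adjacent, and there are no simplices of larger dimension (`IsLongTree.mem_faces_iff`). The
intersection complex is therefore a graph. It is connected because `T` is connected and every
generator of the group lies in an interior star. It has no cycles because each of its edges is a
bridge: cutting `T` along an edge writes the group as an amalgamated product over the corresponding
copy of `ℤ × ℤ`, and instead of the Bass–Serre tree of this splitting a function on the cosets of
stars is used whose values differ at the two ends of the chosen edge and agree at the two ends of
every other edge. Such functions come from closed cochains on the universal cover
(`exists_potential`, `exists_separating_function`). Finally every vertex has infinitely many
neighbours, and there are countably many vertices. Two trees all of whose vertices have countably
infinite valency are isomorphic (`nonempty_iso_of_isTree`).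

Every isomorphism between the intersection complexes of two such trees is a semi-isomorphism
(`IsLongTree.semiIsomorphic`). Indeed a vertex `g * star v` is assigned the product of the cyclic
group of `v` and the free group on the neighbours of `v`, and an edge with a further vertex
`g * star w` is assigned the product of the cyclic groups of `v` and `w`. Along every chain the first
coordinate stays the same and the second one drops, for all trees alike.

For the converse, let `I(X(Λ))` be semi-isomorphic to `I(X(T))`. Since types are preserved, every
vertex of `I(X(Λ))` has a cyclic coordinate, hence all joins in `Λ` are contained in stars
(`subsingleton_of_assigned`). Edges of `I(X(Λ))` never leave the cosets of a connected component of
`Λ`, so that `Λ` is connected (`connected_of_skeleton_connected`); a cycle in `Λ` would give a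
cycle of stars in `I(X(Λ))` (`isAcyclic_of_skeleton_isAcyclic`); and an edge of `I(X(Λ))` gives two
different maximal joins with a common edge, hence a path with three edges in `Λ`
(`three_le_ediam_of_skeleton_adj`).
-/

universe w

namespace RAAG

/-! ### Right-angled Artin groups -/

section Group

variable {V : Type u} {Λ : SimpleGraph V}

variable (Λ) in
/-- The standard generator of the right-angled Artin group at a vertex of the defining graph. -/
def gen (a : V) : RAAG Λ := PresentedGroup.of a

/-- The universal property: generators may be mapped arbitrarily, as long as the images of adjacent
vertices commute. -/
def lift {H : Type*} [Group H] (f : V → H) (hf : ∀ a b, Λ.Adj a b → Commute (f a) (f b)) :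
    RAAG Λ →* H :=
  PresentedGroup.toGroup (f := f) (by
    rintro r ⟨a, b, hab, rfl⟩
    have := (hf a b hab).eq
    simp [this])

@[simp]
theorem lift_gen {H : Type*} [Group H] (f : V → H)
    (hf : ∀ a b, Λ.Adj a b → Commute (f a) (f b)) (a : V) : lift f hf (gen Λ a) = f a :=
  PresentedGroup.toGroup.of _

theorem hom_ext {H : Type*} [Group H] {f g : RAAG Λ →* H} (h : ∀ a, f (gen Λ a) = g (gen Λ a)) :
    f = g :=
  PresentedGroup.ext h

theorem gen_commute {a b : V} (hab : Λ.Adj a b) : Commute (gen Λ a) (gen Λ b) := by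
  have : (PresentedGroup.mk {r : FreeGroup V | ∃ a b, Λ.Adj a b ∧
      r = FreeGroup.of a * FreeGroup.of b * (FreeGroup.of a)⁻¹ * (FreeGroup.of b)⁻¹})
      (FreeGroup.of a * FreeGroup.of b * (FreeGroup.of a)⁻¹ * (FreeGroup.of b)⁻¹) = 1 :=
    PresentedGroup.one_of_mem ⟨a, b, hab, rfl⟩
  simp only [map_mul, map_inv] at this
  exact mul_inv_eq_iff_eq_mul.mp (mul_inv_eq_one.mp this)

variable (Λ) in
/-- The parabolic subgroup generated by a set of vertices of the defining graph. -/
def par (S : Set V) : Subgroup (RAAG Λ) := Subgroup.closure (gen Λ '' S)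

theorem gen_mem_par {S : Set V} {a : V} (ha : a ∈ S) : gen Λ a ∈ par Λ S :=
  Subgroup.subset_closure ⟨a, ha, rfl⟩

theorem par_mono {S S' : Set V} (h : S ⊆ S') : par Λ S ≤ par Λ S' :=
  Subgroup.closure_mono (Set.image_mono h)

theorem par_univ : par Λ Set.univ = ⊤ := by
  rw [par, Set.image_univ]
  exact PresentedGroup.closure_range_of _

theorem par_singleton (a : V) : par Λ {a} = Subgroup.zpowers (gen Λ a) := by
  simp [par, Subgroup.zpowers_eq_closure]

theorem letter_mem_par {S : Set V} {l : V × Bool} (h : l.1 ∈ S) : letter Λ l ∈ par Λ S := by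
  unfold letter
  split_ifs
  · exact gen_mem_par h
  · exact inv_mem (gen_mem_par h)

/-- A property of the elements of a parabolic subgroup may be proved by multiplying with letters on
the right. -/
theorem par_induction_right {S : Set V} {P : RAAG Λ → Prop} (h1 : P 1)
    (hmul : ∀ x ∈ par Λ S, ∀ l : V × Bool, l.1 ∈ S → P x → P (x * letter Λ l)) {x : RAAG Λ}
    (hx : x ∈ par Λ S) : P x := by
  induction hx using Subgroup.closure_induction_right with
  | one => exact h1
  | mul_right x hx y hy ih =>
    obtain ⟨a, ha, rfl⟩ := hy
    simpa [letter, gen] using hmul x hx (a, true) ha ih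
  | mul_inv_cancel x hx y hy ih =>
    obtain ⟨a, ha, rfl⟩ := hy
    simpa [letter, gen] using hmul x hx (a, false) ha ih

/-- Elements of parabolic subgroups of completely joined sets of vertices commute. -/
theorem commute_of_mem_par {A B : Set V} (hAB : ∀ a ∈ A, ∀ b ∈ B, Λ.Adj a b) {x y : RAAG Λ}
    (hx : x ∈ par Λ A) (hy : y ∈ par Λ B) : Commute x y := by
  have h : par Λ A ≤ Subgroup.centralizer (par Λ B : Set (RAAG Λ)) := by
    rw [par, par, Subgroup.centralizer_closure, Subgroup.closure_le]
    rintro _ ⟨a, ha, rfl⟩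
    rw [SetLike.mem_coe, Subgroup.mem_centralizer_iff]
    rintro _ ⟨b, hb, rfl⟩
    exact (gen_commute (hAB a ha b hb)).symm.eq
  exact (Subgroup.mem_centralizer_iff.mp (h hx) y hy).symm

open Classical in
/-- The homomorphism to another group that is prescribed on the generators in a set `S` and
trivial on the other ones. Relations are only to be checked inside `S`. -/
noncomputable def liftOn {H : Type*} [Group H] (S : Set V) (f : V → H)
    (hf : ∀ a ∈ S, ∀ b ∈ S, Λ.Adj a b → Commute (f a) (f b)) : RAAG Λ →* H :=
  lift (fun a => if a ∈ S then f a else 1) (by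
    intro a b hab
    by_cases ha : a ∈ S <;> by_cases hb : b ∈ S <;> simp [ha, hb]
    exact hf a ha b hb hab)

theorem liftOn_gen_of_mem {H : Type*} [Group H] {S : Set V} {f : V → H}
    {hf : ∀ a ∈ S, ∀ b ∈ S, Λ.Adj a b → Commute (f a) (f b)} {a : V} (ha : a ∈ S) :
    liftOn S f hf (gen Λ a) = f a := by
  simp [liftOn, ha]

theorem liftOn_gen_of_notMem {H : Type*} [Group H] {S : Set V} {f : V → H}
    {hf : ∀ a ∈ S, ∀ b ∈ S, Λ.Adj a b → Commute (f a) (f b)} {a : V} (ha : a ∉ S) :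
    liftOn S f hf (gen Λ a) = 1 := by
  simp [liftOn, ha]

variable (Λ) in
/-- The retraction of a right-angled Artin group to a parabolic subgroup: it fixes the generators
in `S` and kills the other ones. -/
noncomputable def retract (S : Set V) : RAAG Λ →* RAAG Λ :=
  liftOn S (gen Λ) fun _ _ _ _ => gen_commute

theorem retract_gen_of_mem {S : Set V} {a : V} (ha : a ∈ S) : retract Λ S (gen Λ a) = gen Λ a :=
  liftOn_gen_of_mem ha

theorem retract_gen_of_notMem {S : Set V} {a : V} (ha : a ∉ S) : retract Λ S (gen Λ a) = 1 :=
  liftOn_gen_of_notMem ha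

theorem retract_of_mem {S : Set V} {x : RAAG Λ} (hx : x ∈ par Λ S) : retract Λ S x = x := by
  have : Set.EqOn (retract Λ S) (MonoidHom.id _) (gen Λ '' S) := by
    rintro _ ⟨a, ha, rfl⟩
    exact retract_gen_of_mem ha
  exact MonoidHom.eqOn_closure this hx

theorem retract_mem (S : Set V) (x : RAAG Λ) : retract Λ S x ∈ par Λ S := by
  have h : par Λ Set.univ ≤ (par Λ S).comap (retract Λ S) := by
    rw [par, Subgroup.closure_le]
    rintro _ ⟨a, -, rfl⟩
    by_cases ha : a ∈ S
    · simpa [retract_gen_of_mem ha] using gen_mem_par ha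
    · simp [retract_gen_of_notMem ha]
  exact h (by simp [par_univ])

theorem retract_eq_one {S S' : Set V} (hd : Disjoint S S') {x : RAAG Λ} (hx : x ∈ par Λ S') :
    retract Λ S x = 1 := by
  have : Set.EqOn (retract Λ S) (1 : RAAG Λ →* RAAG Λ) (gen Λ '' S') := by
    rintro _ ⟨a, ha, rfl⟩
    exact retract_gen_of_notMem fun h => Set.disjoint_left.mp hd h ha
  exact MonoidHom.eqOn_closure this hx

theorem retract_retract (S S' : Set V) (x : RAAG Λ) :
    retract Λ S (retract Λ S' x) = retract Λ (S ∩ S') x := by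
  have : (retract Λ S).comp (retract Λ S') = retract Λ (S ∩ S') := by
    refine hom_ext fun a => ?_
    by_cases h : a ∈ S <;> by_cases h' : a ∈ S' <;>
      simp [h, h', retract_gen_of_mem, retract_gen_of_notMem]
  exact DFunLike.congr_fun this x

/-- Since retractions compose to retractions, the intersection of two parabolic subgroups is the
parabolic subgroup of the intersection. -/
theorem mem_par_inter {S S' : Set V} {x : RAAG Λ} (h : x ∈ par Λ S) (h' : x ∈ par Λ S') :
    x ∈ par Λ (S ∩ S') := by
  have := retract_mem (S ∩ S') x
  rwa [← retract_retract, retract_of_mem h', retract_of_mem h] at this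

variable (Λ) in
/-- The exponent sum of a generator. -/
noncomputable def expo (c : V) : RAAG Λ →* Multiplicative ℤ :=
  liftOn {c} (fun _ => Multiplicative.ofAdd 1) fun _ _ _ _ _ => Commute.refl _

theorem expo_gen_self (c : V) : expo Λ c (gen Λ c) = Multiplicative.ofAdd 1 :=
  liftOn_gen_of_mem rfl

theorem expo_gen_of_ne {a c : V} (h : a ≠ c) : expo Λ c (gen Λ a) = 1 :=
  liftOn_gen_of_notMem h

theorem expo_gen_zpow (c : V) (n : ℤ) : expo Λ c (gen Λ c ^ n) = Multiplicative.ofAdd n := by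
  rw [map_zpow, expo_gen_self, ← ofAdd_zsmul]
  simp

theorem gen_zpow_injective (c : V) : Function.Injective fun n : ℤ => gen Λ c ^ n := fun m n h => by
  have := congrArg (expo Λ c) h
  simpa [expo_gen_zpow] using this

theorem expo_eq_one {S : Set V} {c : V} (hc : c ∉ S) {x : RAAG Λ} (hx : x ∈ par Λ S) :
    expo Λ c x = 1 := by
  have : Set.EqOn (expo Λ c) (1 : RAAG Λ →* Multiplicative ℤ) (gen Λ '' S) := by
    rintro _ ⟨a, ha, rfl⟩
    exact expo_gen_of_ne (by rintro rfl; exact hc ha)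
  exact MonoidHom.eqOn_closure this hx

/-- The exponent sum of `c` vanishes on the parabolic subgroups without `c`. -/
theorem gen_zpow_mem_par {S : Set V} {c : V} {n : ℤ} (h : gen Λ c ^ n ∈ par Λ S) (hn : n ≠ 0) :
    c ∈ S := by
  by_contra hc
  have := expo_eq_one hc h
  rw [expo_gen_zpow] at this
  exact hn (Multiplicative.ofAdd.injective this)

theorem gen_mem_par_iff {S : Set V} {c : V} : gen Λ c ∈ par Λ S ↔ c ∈ S :=
  ⟨fun h => gen_zpow_mem_par (n := 1) (by simpa using h) one_ne_zero, gen_mem_par⟩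

theorem letter_mem_par_iff {S : Set V} {l : V × Bool} : letter Λ l ∈ par Λ S ↔ l.1 ∈ S := by
  refine ⟨fun h => ?_, letter_mem_par⟩
  unfold letter at h
  split_ifs at h
  · exact gen_mem_par_iff.mp h
  · exact gen_mem_par_iff.mp (inv_mem_iff.mp h)

theorem par_le_iff {S S' : Set V} : par Λ S ≤ par Λ S' ↔ S ⊆ S' :=
  ⟨fun h _ ha => gen_mem_par_iff.mp (h (gen_mem_par ha)), par_mono⟩

variable (Λ) in
theorem letter_injective : Function.Injective (letter Λ) := by
  rintro ⟨a, s⟩ ⟨b, t⟩ h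
  have hab : a = b := by
    have h1 : letter Λ (a, s) ∈ par Λ {b} := h ▸ letter_mem_par rfl
    exact letter_mem_par_iff.mp h1
  subst hab
  have h2 := congrArg (expo Λ a) h
  have hg : expo Λ a (PresentedGroup.of a) = Multiplicative.ofAdd 1 := expo_gen_self a
  have hne : (Multiplicative.ofAdd (1 : ℤ)) ≠ (Multiplicative.ofAdd (1 : ℤ))⁻¹ := by decide
  cases s <;> cases t <;> simp [letter, hg] at h2 ⊢
  · exact hne h2.symm
  · exact hne h2

/-- A function `d` on the oriented edges of the universal cover whose sum over the boundary of every
square vanishes is the coboundary of a function on the vertices. The proof turns `d` into an action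
on `RAAG Λ × M` by twisting the right translations; closedness of `d` says that the generators act
by permutations which satisfy the defining relations. -/
theorem exists_potential {M : Type*} [AddCommGroup M] (d : V → RAAG Λ → M)
    (hd : ∀ a b, Λ.Adj a b → ∀ x, d a x + d b (x * gen Λ a) = d b x + d a (x * gen Λ b)) :
    ∃ χ : RAAG Λ → M, ∀ x a, χ (x * gen Λ a) = χ x + d a x := by
  let π : V → Equiv.Perm (RAAG Λ × M) := fun a =>
    { toFun := fun p => (p.1 * gen Λ a, p.2 + d a p.1)
      invFun := fun p => (p.1 * (gen Λ a)⁻¹, p.2 - d a (p.1 * (gen Λ a)⁻¹))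
      left_inv := fun p => by simp
      right_inv := fun p => by simp }
  have hπ : ∀ a b, Λ.Adj a b → Commute (π a)⁻¹ (π b)⁻¹ := fun a b hab => by
    refine Commute.inv_inv (Equiv.ext fun p => ?_)
    simp only [Equiv.Perm.mul_apply, π, Equiv.coe_fn_mk, mul_assoc, (gen_commute hab).eq]
    congr 1
    rw [add_assoc, add_assoc, hd a b hab p.1]
  let Ψ : RAAG Λ →* Equiv.Perm (RAAG Λ × M) := lift (fun a => (π a)⁻¹) hπ
  have hΨ : ∀ a, Ψ (gen Λ a)⁻¹ = π a := fun a => by simp [Ψ]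
  have hfst : ∀ x p, (Ψ x⁻¹ p).1 = p.1 * x := by
    intro x
    have hx : x ∈ par Λ Set.univ := by simp [par_univ]
    induction hx using Subgroup.closure_induction_right with
    | one => simp
    | mul_right x hx y hy ih =>
      obtain ⟨a, -, rfl⟩ := hy
      intro p
      rw [mul_inv_rev, map_mul, hΨ, Equiv.Perm.mul_apply]
      simp only [π, Equiv.coe_fn_mk, ih, mul_assoc]
    | mul_inv_cancel x hx y hy ih =>
      obtain ⟨a, -, rfl⟩ := hy
      intro p
      rw [mul_inv_rev, map_mul, map_inv, hΨ, Equiv.Perm.mul_apply, Equiv.Perm.inv_def]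
      simp only [π, Equiv.coe_fn_symm_mk, ih, mul_assoc]
  refine ⟨fun x => (Ψ x⁻¹ (1, 0)).2, fun x a => ?_⟩
  have h1 := hfst x (1, 0)
  simp only [one_mul] at h1
  beta_reduce
  rw [mul_inv_rev, map_mul, hΨ, Equiv.Perm.mul_apply]
  simp only [π, Equiv.coe_fn_mk, h1]

/-- A function which does not change under right multiplication by generators in `S` is constant
on the cosets of the parabolic subgroup. -/
theorem eq_of_forall_gen {M : Type*} {S : Set V} {χ : RAAG Λ → M}
    (h : ∀ a ∈ S, ∀ x, χ (x * gen Λ a) = χ x) (x : RAAG Λ) {y : RAAG Λ} (hy : y ∈ par Λ S) :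
    χ (x * y) = χ x := by
  induction hy using Subgroup.closure_induction_right with
  | one => simp
  | mul_right y hy z hz ih =>
    obtain ⟨a, ha, rfl⟩ := hz
    rw [← mul_assoc, h a ha, ih]
  | mul_inv_cancel y hy z hz ih =>
    obtain ⟨a, ha, rfl⟩ := hz
    rw [← mul_assoc, ← h a ha, inv_mul_cancel_right, ih]

/-- Distinct vertices which are not adjacent give generators that do not commute. -/
theorem not_commute_gen {a b : V} (hne : a ≠ b) (hab : ¬ Λ.Adj a b) :
    ¬ Commute (gen Λ a) (gen Λ b) := by
  classical
  intro h
  -- Two transpositions in the symmetric group on three letters detect this.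
  let f : V → Equiv.Perm (Fin 3) := fun c => if c = a then Equiv.swap 0 1 else Equiv.swap 1 2
  let Ψ : RAAG Λ →* Equiv.Perm (Fin 3) := liftOn {a, b} f (by
    rintro c (rfl | rfl) e (rfl | rfl) hce
    · exact Commute.refl _
    · exact absurd hce hab
    · exact absurd hce.symm hab
    · exact Commute.refl _)
  have h1 := h.map Ψ
  rw [liftOn_gen_of_mem (by simp), liftOn_gen_of_mem (by simp)] at h1
  simp only [f, if_true, if_neg hne.symm] at h1
  exact absurd h1.eq (by decide)

instance [Countable V] : Countable (RAAG Λ) := by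
  have : Countable (FreeGroup V) := Quot.mk_surjective.countable
  exact (PresentedGroup.mk_surjective _).countable

end Group

/-! ### Parabolic cosets as subcomplexes of the universal cover -/

section Cosets

variable {V : Type u} {Λ : SimpleGraph V}

/-- The sets `A` and `B` are nonempty and every vertex of `A` is adjacent to every vertex of `B`. -/
def IsJoin (Λ : SimpleGraph V) (A B : Set V) : Prop :=
  A.Nonempty ∧ B.Nonempty ∧ ∀ a ∈ A, ∀ b ∈ B, Λ.Adj a b

theorem IsJoin.symm {A B : Set V} (h : IsJoin Λ A B) : IsJoin Λ B A :=
  ⟨h.2.1, h.1, fun b hb a ha => (h.2.2 a ha b hb).symm⟩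

theorem not_adj_of_adj (h3 : Λ.CliqueFree 3) {a b c : V} (hab : Λ.Adj a b) (hbc : Λ.Adj b c) :
    ¬ Λ.Adj a c := by
  classical
  intro hac
  exact h3 {a, b, c} (SimpleGraph.is3Clique_triple_iff.mpr ⟨hab, hac, hbc⟩)

theorem IsJoin.not_adj_left (h3 : Λ.CliqueFree 3) {A B : Set V} (h : IsJoin Λ A B) {a a' : V}
    (ha : a ∈ A) (ha' : a' ∈ A) : ¬ Λ.Adj a a' := by
  obtain ⟨b, hb⟩ := h.2.1
  exact not_adj_of_adj h3 (h.2.2 a ha b hb) (h.2.2 a' ha' b hb).symm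

theorem IsJoin.not_adj_right (h3 : Λ.CliqueFree 3) {A B : Set V} (h : IsJoin Λ A B) {b b' : V}
    (hb : b ∈ B) (hb' : b' ∈ B) : ¬ Λ.Adj b b' :=
  h.symm.not_adj_left h3 hb hb'

theorem IsJoin.disjoint {A B : Set V} (h : IsJoin Λ A B) : Disjoint A B :=
  Set.disjoint_left.mpr fun a ha hb => (h.2.2 a ha a hb).ne rfl

/-- Adjacent vertices of a join lie on different sides. -/
theorem IsJoin.mem_of_adj (h3 : Λ.CliqueFree 3) {A B : Set V} (h : IsJoin Λ A B) {a b : V}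
    (ha : a ∈ A ∪ B) (hb : b ∈ A ∪ B) (hab : Λ.Adj a b) : a ∈ A ∧ b ∈ B ∨ a ∈ B ∧ b ∈ A := by
  rcases ha with ha | ha <;> rcases hb with hb | hb
  · exact absurd hab (h.not_adj_left h3 ha hb)
  · exact Or.inl ⟨ha, hb⟩
  · exact Or.inr ⟨ha, hb⟩
  · exact absurd hab (h.not_adj_right h3 ha hb)

variable (Λ) in
/-- Membership of a group element in a coset of a parabolic subgroup. -/
def InCoset (g : RAAG Λ) (S : Set V) (x : RAAG Λ) : Prop := g⁻¹ * x ∈ par Λ S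

theorem inCoset_self (g : RAAG Λ) (S : Set V) : InCoset Λ g S g := by simp [InCoset]

theorem InCoset.mul_right {g x y : RAAG Λ} {S : Set V} (h : InCoset Λ g S x) (hy : y ∈ par Λ S) :
    InCoset Λ g S (x * y) := by
  have := mul_mem (show g⁻¹ * x ∈ par Λ S from h) hy
  rwa [mul_assoc] at this

theorem InCoset.inv_mul_mem {g x y : RAAG Λ} {S : Set V} (h : InCoset Λ g S x)
    (h' : InCoset Λ g S y) : x⁻¹ * y ∈ par Λ S := by
  have := mul_mem (inv_mem (show g⁻¹ * x ∈ par Λ S from h)) (show g⁻¹ * y ∈ par Λ S from h')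
  simpa [mul_assoc] using this

theorem inCoset_iff_of_inCoset {g x : RAAG Λ} {S : Set V} (h : InCoset Λ g S x) (y : RAAG Λ) :
    InCoset Λ g S y ↔ InCoset Λ x S y :=
  ⟨fun h' => h.inv_mul_mem h', fun h' => by simpa using h.mul_right h'⟩

variable (Λ) in
/-- The subcomplex of the universal cover that is spanned by a coset of a parabolic subgroup:
its vertices are the elements of `g * par S`, and all its edges are labelled by elements of `S`. -/
def coset (g : RAAG Λ) (S : Set V) : Set (salvettiCover Λ).Cell :=
  {c | match c with
    | .vert x => InCoset Λ g S x
    | .edge e => InCoset Λ g S e.1 ∧ e.2.1 ∈ S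
    | .square a b c d => (salvettiCover Λ).IsSquare a b c d ∧
        InCoset Λ g S a.1 ∧ a.2.1 ∈ S ∧ b.2.1 ∈ S}

theorem coset_eq_of_inCoset {g x : RAAG Λ} {S : Set V} (h : InCoset Λ g S x) :
    coset Λ g S = coset Λ x S := by
  ext (y | e | ⟨a, b, c, d⟩)
  · exact inCoset_iff_of_inCoset h y
  · exact and_congr_left fun _ => inCoset_iff_of_inCoset h e.1
  · exact and_congr_right fun _ => and_congr_left fun _ => inCoset_iff_of_inCoset h a.1

theorem coset_mono {g : RAAG Λ} {S S' : Set V} (h : S ⊆ S') : coset Λ g S ⊆ coset Λ g S' := by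
  rintro (y | e | ⟨a, b, c, d⟩) hc
  · exact par_mono h hc
  · exact ⟨par_mono h hc.1, h hc.2⟩
  · exact ⟨hc.1, par_mono h hc.2.1, h hc.2.2.1, h hc.2.2.2⟩

theorem subset_of_coset_subset {g g' : RAAG Λ} {S S' : Set V} (h : coset Λ g S ⊆ coset Λ g' S') :
    S ⊆ S' := fun a ha =>
  (h (show .edge ((g, (a, true)) : RAAG Λ × (V × Bool)) ∈ coset Λ g S from
    ⟨inCoset_self g S, ha⟩)).2

theorem inCoset_of_coset_subset {g g' : RAAG Λ} {S S' : Set V}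
    (h : coset Λ g S ⊆ coset Λ g' S') : InCoset Λ g' S' g :=
  h (show .vert (g : RAAG Λ) ∈ coset Λ g S from inCoset_self g S)

theorem eq_of_coset_eq {g g' : RAAG Λ} {S S' : Set V} (h : coset Λ g S = coset Λ g' S') :
    S = S' :=
  (subset_of_coset_subset h.subset).antisymm (subset_of_coset_subset h.superset)

/-- The intersection of two cosets which are known to share a vertex. -/
theorem mem_coset_inter {g : RAAG Λ} {S S' : Set V} (c : (salvettiCover Λ).Cell) :
    c ∈ coset Λ g (S ∩ S') ↔ c ∈ coset Λ g S ∧ c ∈ coset Λ g S' := by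
  refine ⟨fun h => ⟨coset_mono Set.inter_subset_left h, coset_mono Set.inter_subset_right h⟩, ?_⟩
  rintro ⟨h, h'⟩
  rcases c with y | e | ⟨a, b, c, d⟩
  · exact mem_par_inter h h'
  · exact ⟨mem_par_inter h.1 h'.1, h.2, h'.2⟩
  · exact ⟨h.1, mem_par_inter h.2.1 h'.2.1, ⟨h.2.2.1, h'.2.2.1⟩, h.2.2.2, h'.2.2.2⟩

/-- A square of the universal cover is determined by a corner of its boundary path. -/
theorem cover_square_ext {a b c d c' d' : (salvettiCover Λ).E}
    (h : (salvettiCover Λ).IsSquare a b c d) (h' : (salvettiCover Λ).IsSquare a b c' d') :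
    c = c' ∧ d = d' := by
  obtain ⟨⟨-, h1, h2⟩, -, h3, h4, -⟩ := h
  obtain ⟨⟨-, h1', h2'⟩, -, h3', h4', -⟩ := h'
  have hc : c = c' := Prod.ext (h3.symm.trans h3') (h1.trans h1'.symm)
  subst hc
  exact ⟨rfl, Prod.ext (h4.symm.trans h4') (h2.trans h2'.symm)⟩

end Cosets

/-! ### Products of graphs in the universal cover -/

section ProductMaps

variable {V : Type u} {Λ : SimpleGraph V} {α β : Type w} {S : SimpleGraph α} {T : SimpleGraph β}

/-- The group element to which a map from a product of graphs takes a vertex. -/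
def vtx (f : SquareMap ((OGraph.ofSimpleGraph S).prod (OGraph.ofSimpleGraph T)) (salvettiCover Λ))
    (x : α) (y : β) : RAAG Λ :=
  f.onV (x, y)

/-- The label of the image of a horizontal edge. -/
def labL (f : SquareMap ((OGraph.ofSimpleGraph S).prod (OGraph.ofSimpleGraph T)) (salvettiCover Λ))
    (d : S.Dart) (y : β) : V × Bool :=
  (f.onE (.inl (d, y))).2

/-- The label of the image of a vertical edge. -/
def labR (f : SquareMap ((OGraph.ofSimpleGraph S).prod (OGraph.ofSimpleGraph T)) (salvettiCover Λ))
    (x : α) (d : T.Dart) : V × Bool :=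
  (f.onE (.inr (x, d))).2

section

variable (f : SquareMap ((OGraph.ofSimpleGraph S).prod (OGraph.ofSimpleGraph T)) (salvettiCover Λ))

theorem onE_inl (d : S.Dart) (y : β) :
    f.onE (.inl (d, y)) = ((vtx f d.fst y : RAAG Λ), labL f d y) :=
  Prod.ext (f.map_src (.inl (d, y))).symm rfl

theorem onE_inr (x : α) (d : T.Dart) :
    f.onE (.inr (x, d)) = ((vtx f x d.fst : RAAG Λ), labR f x d) :=
  Prod.ext (f.map_src (.inr (x, d))).symm rfl

theorem vtx_mul_labL (d : S.Dart) (y : β) :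
    vtx f d.fst y * letter Λ (labL f d y) = vtx f d.snd y := by
  have h : f.onE (.inl (d.symm, y)) = (salvettiCover Λ).rev (f.onE (.inl (d, y))) :=
    f.map_rev (.inl (d, y))
  rw [onE_inl, onE_inl] at h
  exact (congrArg Prod.fst h).symm

theorem vtx_mul_labR (x : α) (d : T.Dart) :
    vtx f x d.fst * letter Λ (labR f x d) = vtx f x d.snd := by
  have h : f.onE (.inr (x, d.symm)) = (salvettiCover Λ).rev (f.onE (.inr (x, d))) :=
    f.map_rev (.inr (x, d))
  rw [onE_inr, onE_inr] at h
  exact (congrArg Prod.fst h).symm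

end

/-- Maps `p` and `q` of graphs to Cayley graphs of commuting parabolic subgroups (the first one
possibly translated) give a combinatorial map of the product of the graphs. -/
theorem exists_squareMap {A B : Set V} (hAB : IsJoin Λ A B) (p : α → RAAG Λ) (q : β → RAAG Λ)
    (hp : ∀ x x', S.Adj x x' → ∃ l : V × Bool, l.1 ∈ A ∧ p x * letter Λ l = p x')
    (hq : ∀ y y', T.Adj y y' → ∃ l : V × Bool, l.1 ∈ B ∧ q y * letter Λ l = q y')
    (hqB : ∀ y, q y ∈ par Λ B) :
    ∃ f : SquareMap ((OGraph.ofSimpleGraph S).prod (OGraph.ofSimpleGraph T)) (salvettiCover Λ),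
      ∀ x y, vtx f x y = p x * q y := by
  have hp' : ∀ d : S.Dart, ∃ l : V × Bool, l.1 ∈ A ∧ p d.fst * letter Λ l = p d.snd :=
    fun d => hp _ _ d.adj
  have hq' : ∀ d : T.Dart, ∃ l : V × Bool, l.1 ∈ B ∧ q d.fst * letter Λ l = q d.snd :=
    fun d => hq _ _ d.adj
  choose lp hlp hpl using hp'
  choose lq hlq hql using hq'
  have hps : ∀ d : S.Dart, lp d.symm = ((lp d).1, !(lp d).2) := fun d => by
    apply letter_injective Λ
    have h1 := hpl d.symm
    rw [letter_rev, Prod.mk.eta, eq_inv_iff_mul_eq_one]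
    have h2 : p d.snd * letter Λ (lp d.symm) = p d.fst := h1
    rw [← hpl d, mul_assoc, mul_eq_left] at h2
    exact mul_eq_one_comm.mp h2
  have hqs : ∀ d : T.Dart, lq d.symm = ((lq d).1, !(lq d).2) := fun d => by
    apply letter_injective Λ
    have h1 := hql d.symm
    rw [letter_rev, Prod.mk.eta, eq_inv_iff_mul_eq_one]
    have h2 : q d.snd * letter Λ (lq d.symm) = q d.fst := h1
    rw [← hql d, mul_assoc, mul_eq_left] at h2
    exact mul_eq_one_comm.mp h2
  have hcomm : ∀ (d : S.Dart) (y : β), p d.fst * q y * letter Λ (lp d) = p d.snd * q y :=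
    fun d y => by
      rw [← hpl d, mul_assoc, mul_assoc,
        (commute_of_mem_par hAB.2.2 (letter_mem_par (hlp d)) (hqB y)).eq]
  have hcomm' : ∀ (x : α) (d : T.Dart), p x * q d.fst * letter Λ (lq d) = p x * q d.snd :=
    fun x d => by rw [← hql d, mul_assoc]
  refine ⟨{
    onV := fun xy => (p xy.1 * q xy.2 : RAAG Λ)
    onE := fun e => match e with
      | .inl (d, y) => ((p (d : S.Dart).fst * q y : RAAG Λ), lp d)
      | .inr (x, d) => ((p x * q (d : T.Dart).fst : RAAG Λ), lq d)
    map_src := by rintro (⟨d, y⟩ | ⟨x, d⟩) <;> rfl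
    map_rev := by
      rintro (⟨d, y⟩ | ⟨x, d⟩)
      · exact Prod.ext (hcomm d y).symm (hps d)
      · exact Prod.ext (hcomm' x d).symm (hqs d)
    map_square := by
      rintro a b c d (⟨d, e⟩ | ⟨d, e⟩)
      · refine ⟨⟨hAB.2.2 _ (hlp d) _ (hlq e), hps d, hqs e⟩, ?_, ?_, ?_, ?_⟩
        · exact hcomm d _
        · exact hcomm' _ e
        · exact hcomm d.symm _
        · exact hcomm' _ e.symm
      · refine ⟨⟨(hAB.2.2 _ (hlp d) _ (hlq e)).symm, hqs e, hps d⟩, ?_, ?_, ?_, ?_⟩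
        · exact hcomm' _ e
        · exact hcomm d _
        · exact hcomm' _ e.symm
        · exact hcomm d.symm _ }, fun x y => rfl⟩

/-- Since products of simplicial graphs have no double edges, a map that is injective on vertices
is an embedding. -/
theorem isEmbedding_of_injective {X : SquareComplex.{v}}
    {f : SquareMap ((OGraph.ofSimpleGraph S).prod (OGraph.ofSimpleGraph T)) X}
    (hf : Function.Injective f.onV) : f.IsEmbedding := by
  refine ⟨hf, fun e e' h => ?_⟩
  have hs := f.map_src e
  rw [h, ← f.map_src e'] at hs
  have hr := f.map_rev e
  rw [h, ← f.map_rev e'] at hr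
  have ht := f.map_src (((OGraph.ofSimpleGraph S).prod (OGraph.ofSimpleGraph T)).rev e)
  rw [hr, ← f.map_src] at ht
  have hs := hf hs
  have ht := hf ht
  rcases e with ⟨d, y⟩ | ⟨x, d⟩ <;> rcases e' with ⟨d', y'⟩ | ⟨x', d'⟩
  · obtain ⟨h1, rfl⟩ := Prod.mk.inj (show (d.fst, y) = (d'.fst, y') from hs)
    obtain ⟨h2, -⟩ := Prod.mk.inj (show (d.snd, y) = (d'.snd, y) from ht)
    obtain rfl : d = d' := SimpleGraph.Dart.ext _ _ (Prod.ext h1 h2)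
    rfl
  · obtain ⟨h1, -⟩ := Prod.mk.inj (show (d.fst, y) = (x', d'.fst) from hs)
    obtain ⟨h2, -⟩ := Prod.mk.inj (show (d.snd, y) = (x', d'.snd) from ht)
    exact absurd (h1.trans h2.symm) d.adj.ne
  · obtain ⟨-, h1⟩ := Prod.mk.inj (show (x, d.fst) = (d'.fst, y') from hs)
    obtain ⟨-, h2⟩ := Prod.mk.inj (show (x, d.snd) = (d'.snd, y') from ht)
    exact absurd (h1.trans h2.symm) d.adj.ne
  · obtain ⟨rfl, h1⟩ := Prod.mk.inj (show (x, d.fst) = (x', d'.fst) from hs)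
    obtain ⟨-, h2⟩ := Prod.mk.inj (show (x, d.snd) = (x, d'.snd) from ht)
    obtain rfl : d = d' := SimpleGraph.Dart.ext _ _ (Prod.ext h1 h2)
    rfl

/-- Parabolic cosets are full subcomplexes. -/
theorem image_subset_coset {g : RAAG Λ} {L : Set V}
    {f : SquareMap ((OGraph.ofSimpleGraph S).prod (OGraph.ofSimpleGraph T)) (salvettiCover Λ)}
    (h : ∀ x y, InCoset Λ g L (vtx f x y)) : f.image ⊆ coset Λ g L := by
  have hE : ∀ e, InCoset Λ g L (f.onE e).1 ∧ (f.onE e).2.1 ∈ L := by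
    have key : ∀ (z : RAAG Λ) (l : V × Bool), InCoset Λ g L z →
        InCoset Λ g L (z * letter Λ l) → InCoset Λ g L z ∧ l.1 ∈ L := fun z l h₁ h₂ =>
      ⟨h₁, letter_mem_par_iff.mp (by simpa using h₁.inv_mul_mem h₂)⟩
    have hL : ∀ (d : S.Dart) (y : β), InCoset Λ g L (vtx f d.fst y) ∧ (labL f d y).1 ∈ L :=
      fun d y => key _ _ (h _ _) (by rw [vtx_mul_labL]; exact h _ _)
    have hR : ∀ (x : α) (d : T.Dart), InCoset Λ g L (vtx f x d.fst) ∧ (labR f x d).1 ∈ L :=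
      fun x d => key _ _ (h _ _) (by rw [vtx_mul_labR]; exact h _ _)
    rintro (⟨d, y⟩ | ⟨x, d⟩)
    · exact (onE_inl f d y) ▸ hL d y
    · exact (onE_inr f x d) ▸ hR x d
  rintro _ ⟨⟨x, y⟩ | e | ⟨a, b, c, d⟩, hc, rfl⟩
  · exact h x y
  · exact hE e
  · exact ⟨f.map_square hc, (hE a).1, (hE a).2, (hE b).2⟩

/-- A product map covers a parabolic coset if it hits one of its vertices and if its edges realize
all labels at all vertices. -/
theorem coset_subset_image (h3 : Λ.CliqueFree 3) {g : RAAG Λ} {A B : Set V} (hAB : IsJoin Λ A B)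
    {f : SquareMap ((OGraph.ofSimpleGraph S).prod (OGraph.ofSimpleGraph T)) (salvettiCover Λ)}
    (hg : ∃ x y, vtx f x y = g)
    (hA : ∀ x y (l : V × Bool), l.1 ∈ A → ∃ x', S.Adj x x' ∧ vtx f x' y = vtx f x y * letter Λ l)
    (hB : ∀ x y (l : V × Bool), l.1 ∈ B → ∃ y', T.Adj y y' ∧ vtx f x y' = vtx f x y * letter Λ l) :
    coset Λ g (A ∪ B) ⊆ f.image := by
  have hV : ∀ x : RAAG Λ, InCoset Λ g (A ∪ B) x → ∃ s t, vtx f s t = x := by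
    intro x hx
    have key : ∀ y ∈ par Λ (A ∪ B), ∃ s t, vtx f s t = g * y := fun y hy => by
      refine par_induction_right (P := fun y => ∃ s t, vtx f s t = g * y) (by simpa using hg) ?_ hy
      rintro y - l hl ⟨s, t, hv⟩
      rcases hl with hl | hl
      · obtain ⟨x', -, h⟩ := hA s t l hl
        exact ⟨_, _, h.trans (by rw [hv, mul_assoc])⟩
      · obtain ⟨y', -, h⟩ := hB s t l hl
        exact ⟨_, _, h.trans (by rw [hv, mul_assoc])⟩
    simpa using key _ hx
  have hEA : ∀ x y (l : V × Bool), l.1 ∈ A → ∃ d : S.Dart, d.fst = x ∧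
      vtx f d.snd y = vtx f x y * letter Λ l ∧ labL f d y = l := by
    intro x y l hl
    obtain ⟨x', hx, h⟩ := hA x y l hl
    refine ⟨⟨(x, x'), hx⟩, rfl, h, letter_injective Λ ?_⟩
    exact mul_left_cancel ((vtx_mul_labL f ⟨(x, x'), hx⟩ y).trans h)
  have hEB : ∀ x y (l : V × Bool), l.1 ∈ B → ∃ d : T.Dart, d.fst = y ∧
      vtx f x d.snd = vtx f x y * letter Λ l ∧ labR f x d = l := by
    intro x y l hl
    obtain ⟨y', hy, h⟩ := hB x y l hl
    refine ⟨⟨(y, y'), hy⟩, rfl, h, letter_injective Λ ?_⟩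
    exact mul_left_cancel ((vtx_mul_labR f x ⟨(y, y'), hy⟩).trans h)
  rintro (x | ⟨x, l⟩ | ⟨⟨xa, la⟩, ⟨xb, lb⟩, c, d⟩) hc
  · obtain ⟨s, t, rfl⟩ := hV x hc
    exact ⟨.vert (s, t), trivial, rfl⟩
  · obtain ⟨s, t, rfl⟩ := hV x hc.1
    rcases hc.2 with hl | hl
    · obtain ⟨d, rfl, -, rfl⟩ := hEA s t l hl
      exact ⟨.edge (.inl (d, t)), trivial, congrArg _ (onE_inl f d t)⟩
    · obtain ⟨d, rfl, -, rfl⟩ := hEB s t l hl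
      exact ⟨.edge (.inr (s, d)), trivial, congrArg _ (onE_inr f s d)⟩
  · obtain ⟨hsq, hx, ha, hb⟩ := hc
    obtain ⟨s, t, rfl⟩ := hV xa hx
    have hxb : vtx f s t * letter Λ la = xb := hsq.2.1
    rcases hAB.mem_of_adj h3 ha hb hsq.1.1 with ⟨ha, hb⟩ | ⟨ha, hb⟩
    · obtain ⟨d₁, rfl, h₁, rfl⟩ := hEA s t la ha
      obtain ⟨d₂, rfl, -, rfl⟩ := hEB d₁.snd t lb hb
      obtain rfl : xb = vtx f d₁.snd d₂.fst := hxb.symm.trans h₁.symm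
      have hsq' := OGraph.ProdSquare.hor (P := OGraph.ofSimpleGraph S)
        (Q := OGraph.ofSimpleGraph T) d₁ d₂
      have hsq'' := f.map_square (X := (OGraph.ofSimpleGraph S).prod (OGraph.ofSimpleGraph T)) hsq'
      have e₁ := onE_inl f d₁ d₂.fst
      have e₂ := onE_inr f d₁.snd d₂
      have h4 := cover_square_ext (e₁ ▸ e₂ ▸ hsq'') hsq
      exact ⟨.square _ _ _ _, hsq',
        congr (congr (congr (congrArg SquareComplex.Cell.square e₁) e₂) h4.1) h4.2⟩
    · obtain ⟨d₁, rfl, h₁, rfl⟩ := hEB s t la ha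
      obtain ⟨d₂, rfl, -, rfl⟩ := hEA s d₁.snd lb hb
      obtain rfl : xb = vtx f d₂.fst d₁.snd := hxb.symm.trans h₁.symm
      have hsq' := OGraph.ProdSquare.ver (P := OGraph.ofSimpleGraph S)
        (Q := OGraph.ofSimpleGraph T) d₂ d₁
      have hsq'' := f.map_square (X := (OGraph.ofSimpleGraph S).prod (OGraph.ofSimpleGraph T)) hsq'
      have e₁ := onE_inr f d₂.fst d₁
      have e₂ := onE_inl f d₂ d₁.snd
      have h4 := cover_square_ext (e₁ ▸ e₂ ▸ hsq'') hsq
      exact ⟨.square _ _ _ _, hsq',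
        congr (congr (congr (congrArg SquareComplex.Cell.square e₁) e₂) h4.1) h4.2⟩

end ProductMaps

/-! ### Cayley trees of parabolic subgroups -/

/-- An edge is a bridge if some function takes different values at its ends and equal values at the
ends of all other edges. -/
theorem isBridge_of_function {α : Type*} {M : Type*} {G : SimpleGraph α} {u v : α} (χ : α → M)
    (h : ∀ x y, G.Adj x y → s(x, y) ≠ s(u, v) → χ x = χ y) (huv : χ u ≠ χ v) :
    G.IsBridge s(u, v) := by
  rw [SimpleGraph.isBridge_iff]
  rintro ⟨p⟩
  refine huv ?_
  clear huv
  suffices key : ∀ {x y : α}, (G.deleteEdges {s(u, v)}).Walk x y → χ x = χ y from key p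
  intro x y p
  induction p with
  | nil => rfl
  | cons hadj _ ih =>
    rw [SimpleGraph.deleteEdges_adj] at hadj
    exact (h _ _ hadj.1 hadj.2).trans ih

section Trees

variable {V : Type u} {Λ : SimpleGraph V}

theorem letter_ne_one (l : V × Bool) : letter Λ l ≠ 1 := fun h => by
  have : letter Λ l ∈ par Λ ∅ := h ▸ one_mem _
  exact (letter_mem_par_iff.mp this).elim

variable (Λ) in
/-- The Cayley graph of a parabolic subgroup with respect to its standard generators. -/
def cayley (A : Set V) : SimpleGraph (par Λ A) where
  Adj x y := ∃ l : V × Bool, l.1 ∈ A ∧ (x : RAAG Λ) * letter Λ l = y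
  symm := ⟨by
    rintro x y ⟨l, hl, h⟩
    refine ⟨(l.1, !l.2), hl, ?_⟩
    rw [letter_rev, ← h, mul_inv_cancel_right]⟩
  loopless := ⟨by
    rintro x ⟨l, -, h⟩
    exact letter_ne_one l (mul_eq_left.mp h)⟩

theorem cayley_connected (A : Set V) : (cayley Λ A).Connected := by
  have h : ∀ x (hx : x ∈ par Λ A), (cayley Λ A).Reachable 1 ⟨x, hx⟩ := fun x hx => by
    refine par_induction_right
      (P := fun x => ∀ hx : x ∈ par Λ A, (cayley Λ A).Reachable 1 ⟨x, hx⟩) ?_ ?_ hx hx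
    · exact fun _ => SimpleGraph.Reachable.rfl
    · intro x hx l hl ih hy
      exact (ih hx).trans (SimpleGraph.Adj.reachable ⟨l, hl, rfl⟩)
  exact ⟨fun x y => (h x x.2).symm.trans (h y y.2)⟩

/-- The Cayley graph of a free parabolic subgroup is a tree. An edge from `x` to `x * a` is a bridge
since there is a potential which changes along this edge only: it is the potential of the cochain
that is supported on the `a`-edges that the retraction maps to this edge. -/
theorem cayley_isTree {A : Set V} (hA : ∀ a ∈ A, ∀ b ∈ A, ¬ Λ.Adj a b) :
    (cayley Λ A).IsTree := by
  classical
  refine ⟨cayley_connected A, SimpleGraph.isAcyclic_iff_forall_adj_isBridge.mpr ?_⟩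
  have key : ∀ (x y : par Λ A) (a : V), a ∈ A → (x : RAAG Λ) * gen Λ a = y →
      (cayley Λ A).IsBridge s(x, y) := by
    intro x y a ha hxy
    obtain ⟨χ, hχ⟩ := exists_potential (Λ := Λ) (M := ZMod 2)
      (fun c z => if c = a ∧ retract Λ A z = x then 1 else 0) (by
        intro b c hbc z
        by_cases hb : b = a <;> by_cases hc : c = a
        · subst hb; subst hc; exact absurd hbc (Λ.loopless.irrefl _)
        · have : c ∉ A := fun h => hA b (hb ▸ ha) c h hbc
          simp [hb, hc, retract_gen_of_notMem this]
        · have : b ∉ A := fun h => hA c (hc ▸ ha) b h hbc.symm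
          simp [hb, hc, retract_gen_of_notMem this]
        · simp [hb, hc])
    have hstep : ∀ (z z' : par Λ A) (c : V), (z : RAAG Λ) * gen Λ c = z' →
        s(z, z') ≠ s(x, y) → χ z = χ z' := by
      intro z z' c hz hne
      rw [← hz, hχ, if_neg, add_zero]
      rintro ⟨rfl, h⟩
      rw [retract_of_mem z.2] at h
      obtain rfl : z = x := Subtype.ext h
      exact hne (by rw [Subtype.ext (hz.symm.trans hxy)])
    refine isBridge_of_function (fun z : par Λ A => χ z) ?_ ?_
    · rintro z z' ⟨⟨c, s⟩, -, h⟩ hne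
      cases s
      · refine (hstep z' z c ?_ (by rwa [Sym2.eq_swap])).symm
        rw [← h]
        simp [letter, gen]
      · exact hstep z z' c (by simpa [letter, gen] using h) hne
    · rw [← hxy, hχ, if_pos ⟨rfl, retract_of_mem x.2⟩]
      simp
  rintro x y ⟨⟨a, s⟩, ha, h⟩
  cases s
  · rw [Sym2.eq_swap]
    refine key y x a ha ?_
    rw [← h]
    simp [letter, gen]
  · exact key x y a ha (by simpa [letter, gen] using h)

theorem infinite_par {A : Set V} (hA : A.Nonempty) : Infinite (par Λ A) := by
  obtain ⟨a, ha⟩ := hA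
  refine Infinite.of_injective
    (fun n : ℤ => (⟨gen Λ a ^ n, zpow_mem (gen_mem_par ha) n⟩ : par Λ A)) fun m n h => ?_
  exact gen_zpow_injective a (congrArg Subtype.val h)

/-- In the product of two joined parabolic subgroups both factors are determined. -/
theorem eq_of_mul_eq_mul {A B : Set V} (hAB : IsJoin Λ A B) {x x' y y' : RAAG Λ}
    (hx : x ∈ par Λ A) (hx' : x' ∈ par Λ A) (hy : y ∈ par Λ B) (hy' : y' ∈ par Λ B)
    (h : x * y = x' * y') : x = x' ∧ y = y' := by
  have h1 := congrArg (retract Λ A) h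
  simp only [map_mul, retract_of_mem hx, retract_of_mem hx', retract_eq_one hAB.disjoint hy,
    retract_eq_one hAB.disjoint hy', mul_one] at h1
  subst h1
  exact ⟨rfl, mul_left_cancel h⟩

/-- The coset of a join is the product of the Cayley trees of the two sides. -/
theorem exists_embedding_cayley (h3 : Λ.CliqueFree 3) {A B : Set V} (hAB : IsJoin Λ A B)
    (g : RAAG Λ) :
    ∃ f : SquareMap ((OGraph.ofSimpleGraph (cayley Λ A)).prod (OGraph.ofSimpleGraph (cayley Λ B)))
      (salvettiCover Λ), f.IsEmbedding ∧ f.image = coset Λ g (A ∪ B) ∧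
        ∀ x y, vtx f x y = g * x * y := by
  obtain ⟨f, hf⟩ := exists_squareMap (S := cayley Λ A) (T := cayley Λ B) hAB
    (fun x => g * x) (fun y => y)
    (fun x x' ⟨l, hl, h⟩ => ⟨l, hl, by rw [mul_assoc, h]⟩) (fun y y' h => h) (fun y => y.2)
  refine ⟨f, isEmbedding_of_injective ?_, Set.Subset.antisymm ?_ ?_, hf⟩
  · rintro ⟨x, y⟩ ⟨x', y'⟩ h
    have h' := (hf x y).symm.trans (Eq.trans h (hf x' y'))
    rw [mul_assoc, mul_assoc] at h'
    obtain ⟨h1, h2⟩ := eq_of_mul_eq_mul hAB x.2 x'.2 y.2 y'.2 (mul_left_cancel h')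
    exact Prod.ext (Subtype.ext h1) (Subtype.ext h2)
  · refine image_subset_coset fun x y => ?_
    rw [hf]
    exact ((inCoset_self g _).mul_right (par_mono Set.subset_union_left x.2)).mul_right
      (par_mono Set.subset_union_right y.2)
  · refine coset_subset_image h3 hAB ⟨1, 1, by simp [hf]⟩ ?_ ?_
    · intro x y l hl
      refine ⟨⟨x * letter Λ l, mul_mem x.2 (letter_mem_par hl)⟩, ⟨l, hl, rfl⟩, ?_⟩
      rw [hf, hf, mul_assoc, mul_assoc, mul_assoc, mul_assoc,
        (commute_of_mem_par hAB.2.2 (letter_mem_par hl) y.2).eq]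
    · intro x y l hl
      refine ⟨⟨y * letter Λ l, mul_mem y.2 (letter_mem_par hl)⟩, ⟨l, hl, rfl⟩, ?_⟩
      rw [hf, hf, mul_assoc, mul_assoc, mul_assoc]

/-- The cosets of joins are products of two infinite trees. -/
theorem isTreeProduct_coset (h3 : Λ.CliqueFree 3) {A B : Set V} (hAB : IsJoin Λ A B)
    (g : RAAG Λ) : IsTreeProduct (coset Λ g (A ∪ B)) := by
  obtain ⟨f, hf, hK, -⟩ := exists_embedding_cayley h3 hAB g
  exact ⟨_, _, cayley Λ A, cayley Λ B, f, infinite_par hAB.1, infinite_par hAB.2.1,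
    cayley_isTree fun a ha b hb => hAB.not_adj_left h3 ha hb,
    cayley_isTree fun a ha b hb => hAB.not_adj_right h3 ha hb, hf, hK⟩

theorem exists_letter_zpow (c : V) (m n : ℤ) (hmn : (SimpleGraph.hasse ℤ).Adj m n) :
    ∃ l : V × Bool, l.1 ∈ ({c} : Set V) ∧ gen Λ c ^ m * letter Λ l = gen Λ c ^ n := by
  rw [SimpleGraph.hasse_adj, Order.covBy_iff_add_one_eq, Order.covBy_iff_add_one_eq] at hmn
  rcases hmn with rfl | rfl
  · exact ⟨(c, true), rfl, (zpow_add_one (gen Λ c) m).symm⟩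
  · refine ⟨(c, false), rfl, ?_⟩
    rw [zpow_add_one, mul_assoc]
    simp [letter, gen]

/-- Every edge of the defining graph gives a flat through every vertex of the universal cover. -/
theorem exists_isFlat {a b : V} (hab : Λ.Adj a b) (g : RAAG Λ) :
    ∃ F, IsFlat F ∧ F ⊆ coset Λ g {a, b} := by
  have hAB : IsJoin Λ {a} {b} := ⟨⟨a, rfl⟩, ⟨b, rfl⟩, by rintro _ rfl _ rfl; exact hab⟩
  have ha : ∀ n : ℤ, gen Λ a ^ n ∈ par Λ {a} := fun n =>
    zpow_mem (gen_mem_par (Set.mem_singleton a)) n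
  have hb : ∀ n : ℤ, gen Λ b ^ n ∈ par Λ {b} := fun n =>
    zpow_mem (gen_mem_par (Set.mem_singleton b)) n
  obtain ⟨f, hf⟩ := exists_squareMap (S := SimpleGraph.hasse ℤ) (T := SimpleGraph.hasse ℤ) hAB
    (fun m => g * gen Λ a ^ m) (fun n => gen Λ b ^ n)
    (fun m n h => by
      obtain ⟨l, hl, h⟩ := exists_letter_zpow a m n h
      exact ⟨l, hl, by rw [mul_assoc, h]⟩) (exists_letter_zpow b) hb
  have hinj : Function.Injective f.onV := by
    rintro ⟨m, n⟩ ⟨m', n'⟩ h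
    have h' := (hf m n).symm.trans (Eq.trans h (hf m' n'))
    rw [mul_assoc, mul_assoc] at h'
    obtain ⟨h1, h2⟩ := eq_of_mul_eq_mul hAB (ha _) (ha _) (hb _) (hb _) (mul_left_cancel h')
    exact Prod.ext (gen_zpow_injective a h1) (gen_zpow_injective b h2)
  refine ⟨f.image, ⟨f, isEmbedding_of_injective hinj, rfl⟩, image_subset_coset fun m n => ?_⟩
  rw [hf]
  exact ((inCoset_self g _).mul_right (par_mono (by simp) (ha m))).mul_right
    (par_mono (by simp) (hb n))

/-- A flat contains a square. -/
theorem exists_square_of_isFlat {F : Set (salvettiCover Λ).Cell} (hF : IsFlat F) :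
    ∃ a b c d, (salvettiCover Λ).IsSquare a b c d ∧ .square a b c d ∈ F := by
  obtain ⟨f, -, rfl⟩ := hF
  let e : (SimpleGraph.hasse ℤ).Dart := ⟨(0, 1), Or.inl (Order.covBy_succ (0 : ℤ))⟩
  have hsq := OGraph.ProdSquare.hor (P := OGraph.line) (Q := OGraph.line) e e
  exact ⟨_, _, _, _, f.map_square (X := OGraph.line.prod OGraph.line) hsq,
    .square _ _ _ _, hsq, rfl⟩

end Trees

/-! ### Standard product subcomplexes -/

section StandardProducts

variable {V : Type u} {Λ : SimpleGraph V}

variable (Λ) in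
/-- The subcomplex of the Salvetti complex with labels in a given set of vertices. -/
def labelled (S : Set V) : Set (salvetti Λ).Cell :=
  {c | match c with
    | .vert _ => True
    | .edge e => e.1 ∈ S
    | .square a b c d => (salvetti Λ).IsSquare a b c d ∧ a.1 ∈ S ∧ b.1 ∈ S}

section

variable {P Q : OGraph.{u}} (f : SquareMap (P.prod Q) (salvetti Λ))

/-- Parallel horizontal edges of a product have the same image in the Salvetti complex. -/
theorem onE_inl_eq (hQ : Q.Connected) (e : P.E) (y y' : Q.V) :
    f.onE (.inl (e, y)) = f.onE (.inl (e, y')) := by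
  obtain ⟨n, h⟩ := hQ.2 y y'
  induction h with
  | refl => rfl
  | step e' _ ih =>
    have hsq := f.map_square (X := P.prod Q) (OGraph.ProdSquare.hor e e')
    have hrev : f.onE (.inl (P.rev e, Q.tgt e')) =
        (salvetti Λ).rev (f.onE (.inl (e, Q.tgt e'))) := f.map_rev (.inl (e, Q.tgt e'))
    have h2 : f.onE (.inl (P.rev e, Q.tgt e')) =
        (salvetti Λ).rev (f.onE (.inl (e, Q.src e'))) := hsq.2.1
    have h3 := congrArg (salvetti Λ).rev (h2.symm.trans hrev)
    rw [(salvetti Λ).rev_rev, (salvetti Λ).rev_rev] at h3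
    exact ih.trans h3

/-- Parallel vertical edges of a product have the same image in the Salvetti complex. -/
theorem onE_inr_eq (hP : P.Connected) (e : Q.E) (x x' : P.V) :
    f.onE (.inr (x, e)) = f.onE (.inr (x', e)) := by
  obtain ⟨n, h⟩ := hP.2 x x'
  induction h with
  | refl => rfl
  | step e' _ ih =>
    have hsq := f.map_square (X := P.prod Q) (OGraph.ProdSquare.ver e' e)
    have hrev : f.onE (.inr (P.tgt e', Q.rev e)) =
        (salvetti Λ).rev (f.onE (.inr (P.tgt e', e))) := f.map_rev (.inr (P.tgt e', e))
    have h2 : f.onE (.inr (P.tgt e', Q.rev e)) =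
        (salvetti Λ).rev (f.onE (.inr (P.src e', e))) := hsq.2.1
    have h3 := congrArg (salvetti Λ).rev (h2.symm.trans hrev)
    rw [(salvetti Λ).rev_rev, (salvetti Λ).rev_rev] at h3
    exact ih.trans h3

end

/-- The image of a product of graphs in the Salvetti complex consists of the cells whose labels
lie in a join. -/
theorem exists_image_eq_labelled (h3 : Λ.CliqueFree 3) {P Q : OGraph.{u}}
    (f : SquareMap (P.prod Q) (salvetti Λ)) (hP : P.Connected) (hQ : Q.Connected)
    (hPE : Nonempty P.E) (hQE : Nonempty Q.E) :
    ∃ A B, IsJoin Λ A B ∧ f.image = labelled Λ (A ∪ B) := by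
  obtain ⟨x₀⟩ := hP.1
  obtain ⟨y₀⟩ := hQ.1
  obtain ⟨eP⟩ := hPE
  obtain ⟨eQ⟩ := hQE
  have hAB : IsJoin Λ {a | ∃ e : P.E, (f.onE (.inl (e, y₀))).1 = a}
      {b | ∃ e : Q.E, (f.onE (.inr (x₀, e))).1 = b} := by
    refine ⟨⟨_, eP, rfl⟩, ⟨_, eQ, rfl⟩, ?_⟩
    rintro _ ⟨e, rfl⟩ _ ⟨e', rfl⟩
    have hsq := f.map_square (X := P.prod Q) (OGraph.ProdSquare.hor e e')
    rw [onE_inl_eq f hQ e y₀ (Q.src e'), onE_inr_eq f hP e' x₀ (P.tgt e)]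
    exact hsq.1
  refine ⟨_, _, hAB, Set.Subset.antisymm ?_ ?_⟩
  · have hE : ∀ e, (f.onE e).1 ∈ {a | ∃ e : P.E, (f.onE (.inl (e, y₀))).1 = a} ∪
        {b | ∃ e : Q.E, (f.onE (.inr (x₀, e))).1 = b} := by
      rintro (⟨e, y⟩ | ⟨x, e⟩)
      · exact Or.inl ⟨e, by rw [onE_inl_eq f hQ e y₀ y]⟩
      · exact Or.inr ⟨e, by rw [onE_inr_eq f hP e x₀ x]⟩
    rintro _ ⟨⟨x, y⟩ | e | ⟨a, b, c, d⟩, hc, rfl⟩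
    · trivial
    · exact hE e
    · exact ⟨f.map_square hc, hE a, hE b⟩
  · have hA : ∀ l : V × Bool, (∃ e : P.E, (f.onE (.inl (e, y₀))).1 = l.1) →
        ∃ e : P.E, ∀ y, f.onE (.inl (e, y)) = l := by
      rintro ⟨_, s⟩ ⟨e, rfl⟩
      by_cases hs : (f.onE (.inl (e, y₀))).2 = s
      · exact ⟨e, fun y => by rw [onE_inl_eq f hQ e y y₀]; exact Prod.ext rfl hs⟩
      · refine ⟨P.rev e, fun y => ?_⟩
        rw [onE_inl_eq f hQ (P.rev e) y y₀]
        refine (f.map_rev (.inl (e, y₀))).trans (Prod.ext rfl ?_)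
        exact Bool.not_eq.mpr hs
    have hB : ∀ l : V × Bool, (∃ e : Q.E, (f.onE (.inr (x₀, e))).1 = l.1) →
        ∃ e : Q.E, ∀ x, f.onE (.inr (x, e)) = l := by
      rintro ⟨_, s⟩ ⟨e, rfl⟩
      by_cases hs : (f.onE (.inr (x₀, e))).2 = s
      · exact ⟨e, fun x => by rw [onE_inr_eq f hP e x x₀]; exact Prod.ext rfl hs⟩
      · refine ⟨Q.rev e, fun x => ?_⟩
        rw [onE_inr_eq f hP (Q.rev e) x x₀]
        refine (f.map_rev (.inr (x₀, e))).trans (Prod.ext rfl ?_)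
        exact Bool.not_eq.mpr hs
    rintro (x | l | ⟨a, b, c, d⟩) hc
    · exact ⟨.vert (x₀, y₀), trivial, rfl⟩
    · rcases hc with h | h
      · obtain ⟨e, he⟩ := hA l h
        exact ⟨.edge (.inl (e, y₀)), trivial, congrArg _ (he y₀)⟩
      · obtain ⟨e, he⟩ := hB l h
        exact ⟨.edge (.inr (x₀, e)), trivial, congrArg _ (he x₀)⟩
    · obtain ⟨hsq, ha, hb⟩ := hc
      rcases hAB.mem_of_adj h3 ha hb hsq.1 with ⟨ha, hb⟩ | ⟨ha, hb⟩
      · obtain ⟨e, he⟩ := hA a ha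
        obtain ⟨e', he'⟩ := hB b hb
        have h := OGraph.ProdSquare.hor e e'
        have h' := f.map_square (X := P.prod Q) h
        refine ⟨.square _ _ _ _, h, ?_⟩
        exact congr (congr (congr (congrArg SquareComplex.Cell.square (he _)) (he' _))
          (h'.2.1.trans ((congrArg (salvetti Λ).rev (he _)).trans hsq.2.1.symm)))
          (h'.2.2.trans ((congrArg (salvetti Λ).rev (he' _)).trans hsq.2.2.symm))
      · obtain ⟨e, he⟩ := hB a ha
        obtain ⟨e', he'⟩ := hA b hb
        have h := OGraph.ProdSquare.ver e' e
        have h' := f.map_square (X := P.prod Q) h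
        refine ⟨.square _ _ _ _, h, ?_⟩
        exact congr (congr (congr (congrArg SquareComplex.Cell.square (he _)) (he' _))
          (h'.2.1.trans ((congrArg (salvetti Λ).rev (he _)).trans hsq.2.1.symm)))
          (h'.2.2.trans ((congrArg (salvetti Λ).rev (he' _)).trans hsq.2.2.symm))

/-- The graph with one vertex and a loop for every element of `A`. -/
def rose (A : Set V) : OGraph.{u} where
  V := PUnit
  E := A × Bool
  src _ := PUnit.unit
  rev l := (l.1, !l.2)
  rev_rev := by rintro ⟨a, s⟩; simp
  rev_ne := by rintro ⟨a, s⟩; simp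

theorem rose_spec [Finite V] {A : Set V} (hA : A.Nonempty) :
    Finite (rose A).V ∧ Finite (rose A).E ∧ (rose A).Connected ∧ (rose A).Leafless ∧
      (rose A).HasReducedLoop := by
  obtain ⟨a, ha⟩ := hA
  refine ⟨inferInstanceAs (Finite PUnit), inferInstanceAs (Finite (A × Bool)),
    ⟨⟨PUnit.unit⟩, fun _ _ => ⟨0, OGraph.Within.refl _ _⟩⟩,
    fun e => ⟨(rose A).rev e, (rose A).rev_ne e, rfl⟩,
    ((⟨a, ha⟩, true) : A × Bool), [], List.isChain_singleton _, rfl⟩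

/-- The standard product subcomplexes of the Salvetti complex are those labelled by joins. The roses
on the two sides of a join give a local isometry: since both sides are without edges, the link of
the image is a complete bipartite graph. -/
theorem isStandardProduct_iff [Finite V] (h3 : Λ.CliqueFree 3) {L : Set (salvetti Λ).Cell} :
    IsStandardProduct L ↔ ∃ A B, IsJoin Λ A B ∧ L = labelled Λ (A ∪ B) := by
  constructor
  · rintro ⟨P, Q, f, ⟨-, -, hP, -, eP, -⟩, ⟨-, -, hQ, -, eQ, -⟩, -, rfl⟩
    exact exists_image_eq_labelled h3 f hP hQ ⟨eP⟩ ⟨eQ⟩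
  · rintro ⟨A, B, hAB, rfl⟩
    let f : SquareMap ((rose A).prod (rose B)) (salvetti Λ) :=
      { onV := fun _ => PUnit.unit
        onE := fun e => match e with
          | .inl (e, _) => ((e : A × Bool).1.1, (e : A × Bool).2)
          | .inr (_, e) => ((e : B × Bool).1.1, (e : B × Bool).2)
        map_src := fun _ => rfl
        map_rev := by rintro (⟨e, y⟩ | ⟨x, e⟩) <;> rfl
        map_square := by
          rintro a b c d (⟨e, e'⟩ | ⟨e, e'⟩)
          · exact ⟨hAB.2.2 _ e.1.2 _ e'.1.2, rfl, rfl⟩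
          · exact ⟨(hAB.2.2 _ e.1.2 _ e'.1.2).symm, rfl, rfl⟩ }
    refine ⟨rose A, rose B, f, rose_spec hAB.1, rose_spec hAB.2.1, ?_, ?_⟩
    · rintro (⟨⟨⟨a, ha⟩, s⟩, y⟩ | ⟨x, ⟨⟨a, ha⟩, s⟩⟩) (⟨⟨⟨b, hb⟩, t⟩, y'⟩ | ⟨x', ⟨⟨b, hb⟩, t⟩⟩) -
      · refine ⟨fun h => ?_, fun ⟨_, _, h⟩ => ?_⟩
        · have h : (a, s) = (b, t) := h
          obtain ⟨rfl, rfl⟩ := Prod.mk.inj h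
          rfl
        · have h1 := (salvetti Λ).rotate ((salvetti Λ).rotate ((salvetti Λ).rotate h))
          exact absurd h1.1 (hAB.not_adj_left h3 hb ha)
      · refine ⟨fun h => ?_, fun _ => ⟨_, _, OGraph.ProdSquare.hor (P := rose A) (Q := rose B)
          ((⟨a, ha⟩, s) : A × Bool) ((⟨b, hb⟩, t) : B × Bool)⟩⟩
        have h : (a, s) = (b, t) := h
        obtain ⟨rfl, rfl⟩ := Prod.mk.inj h
        exact absurd hb (Set.disjoint_left.mp hAB.disjoint ha)
      · refine ⟨fun h => ?_, fun _ => ⟨_, _, OGraph.ProdSquare.ver (P := rose A) (Q := rose B)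
          ((⟨b, hb⟩, t) : A × Bool) ((⟨a, ha⟩, s) : B × Bool)⟩⟩
        have h : (a, s) = (b, t) := h
        obtain ⟨rfl, rfl⟩ := Prod.mk.inj h
        exact absurd ha (Set.disjoint_left.mp hAB.disjoint hb)
      · refine ⟨fun h => ?_, fun ⟨_, _, h⟩ => ?_⟩
        · have h : (a, s) = (b, t) := h
          obtain ⟨rfl, rfl⟩ := Prod.mk.inj h
          rfl
        · have h1 := (salvetti Λ).rotate ((salvetti Λ).rotate ((salvetti Λ).rotate h))
          exact absurd h1.1 (hAB.not_adj_right h3 hb ha)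
    · apply Set.Subset.antisymm
      · rintro _ ⟨⟨x, y⟩ | (⟨e, y⟩ | ⟨x, e⟩) | ⟨a, b, c, d⟩, hc, rfl⟩
        · trivial
        · exact Or.inl e.1.2
        · exact Or.inr e.1.2
        · refine ⟨f.map_square hc, ?_⟩
          rcases hc with ⟨e, e'⟩ | ⟨e, e'⟩
          · exact ⟨Or.inl e.1.2, Or.inr e'.1.2⟩
          · exact ⟨Or.inr e'.1.2, Or.inl e.1.2⟩
      · rintro (x | ⟨a, s⟩ | ⟨⟨a, s⟩, ⟨b, t⟩, c, d⟩) hc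
        · exact ⟨.vert (PUnit.unit, PUnit.unit), trivial, rfl⟩
        · rcases hc with h | h
          · exact ⟨.edge (.inl (((⟨a, h⟩, s) : A × Bool), PUnit.unit)), trivial, rfl⟩
          · exact ⟨.edge (.inr (PUnit.unit, ((⟨a, h⟩, s) : B × Bool))), trivial, rfl⟩
        · obtain ⟨⟨hab, rfl, rfl⟩, ha, hb⟩ := hc
          rcases hAB.mem_of_adj h3 ha hb hab with ⟨ha, hb⟩ | ⟨ha, hb⟩
          · exact ⟨.square _ _ _ _, OGraph.ProdSquare.hor (P := rose A) (Q := rose B)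
              ((⟨a, ha⟩, s) : A × Bool) ((⟨b, hb⟩, t) : B × Bool), rfl⟩
          · exact ⟨.square _ _ _ _, OGraph.ProdSquare.ver (P := rose A) (Q := rose B)
              ((⟨b, hb⟩, t) : A × Bool) ((⟨a, ha⟩, s) : B × Bool), rfl⟩

end StandardProducts

/-! ### Maximal product subcomplexes and simplices of the intersection complex -/

section Lifts

variable {V : Type u} {Λ : SimpleGraph V} {α β : Type w} {S : SimpleGraph α} {T : SimpleGraph β}

/-- Along a horizontal slice the group elements change by products of its labels. -/
theorem inv_mul_mem_of_labL
    (f : SquareMap ((OGraph.ofSimpleGraph S).prod (OGraph.ofSimpleGraph T)) (salvettiCover Λ))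
    (hS : S.Connected) {A : Set V} {y : β} (hA : ∀ d, (labL f d y).1 ∈ A) (x x' : α) :
    (vtx f x y)⁻¹ * vtx f x' y ∈ par Λ A := by
  obtain ⟨p⟩ := hS.preconnected x x'
  induction p with
  | nil => simp
  | @cons x z _ hadj _ ih =>
    have h := vtx_mul_labL f ⟨(x, z), hadj⟩ y
    have h' : (vtx f x y)⁻¹ * vtx f z y ∈ par Λ A := by
      rw [← h]
      simpa using letter_mem_par (hA ⟨(x, z), hadj⟩)
    simpa [mul_assoc] using mul_mem h' ih

/-- Along a vertical slice the group elements change by products of its labels. -/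
theorem inv_mul_mem_of_labR
    (f : SquareMap ((OGraph.ofSimpleGraph S).prod (OGraph.ofSimpleGraph T)) (salvettiCover Λ))
    (hT : T.Connected) {B : Set V} {x : α} (hB : ∀ d, (labR f x d).1 ∈ B) (y y' : β) :
    (vtx f x y)⁻¹ * vtx f x y' ∈ par Λ B := by
  obtain ⟨p⟩ := hT.preconnected y y'
  induction p with
  | nil => simp
  | @cons y z _ hadj _ ih =>
    have h := vtx_mul_labR f x ⟨(y, z), hadj⟩
    have h' : (vtx f x y)⁻¹ * vtx f x z ∈ par Λ B := by
      rw [← h]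
      simpa using letter_mem_par (hB ⟨(y, z), hadj⟩)
    simpa [mul_assoc] using mul_mem h' ih

theorem coset_subset_preimage (g : RAAG Λ) (L : Set V) :
    coset Λ g L ⊆ (salvettiCovering Λ).preimage (labelled Λ L) := by
  rintro (x | e | ⟨a, b, c, d⟩) hc
  · exact ⟨trivial, trivial⟩
  · exact ⟨trivial, hc.2⟩
  · exact ⟨hc.1, hc.1.1, hc.2.2⟩

/-- A product of trees with labels in `L` lies in a single coset of the parabolic subgroup. -/
theorem exists_subset_coset {K : Set (salvettiCover Λ).Cell} (hK : IsTreeProduct K) {L : Set V}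
    (hL : K ⊆ (salvettiCovering Λ).preimage (labelled Λ L)) : ∃ g, K ⊆ coset Λ g L := by
  obtain ⟨α, β, S, T, f, hα, hβ, hS, hT, -, rfl⟩ := hK
  have hl : ∀ d y, (labL f d y).1 ∈ L := fun d y =>
    (hL ⟨.edge (.inl (d, y)), trivial, rfl⟩).2
  have hr : ∀ x d, (labR f x d).1 ∈ L := fun x d =>
    (hL ⟨.edge (.inr (x, d)), trivial, rfl⟩).2
  obtain ⟨x₀⟩ := hS.connected.nonempty
  obtain ⟨y₀⟩ := hT.connected.nonempty
  refine ⟨vtx f x₀ y₀, image_subset_coset fun x y => ?_⟩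
  have h1 := inv_mul_mem_of_labL f hS.connected (fun d => hl d y₀) x₀ x
  have h2 := inv_mul_mem_of_labR f hT.connected (fun d => hr x d) y₀ y
  have h3 := mul_mem h1 h2
  simp only [mul_assoc, mul_inv_cancel_left] at h3
  exact h3

/-- The standard product subcomplexes of the universal cover are the cosets of joins. -/
theorem isStandardProductLift_iff [Finite V] (h3 : Λ.CliqueFree 3)
    {K : Set (salvettiCover Λ).Cell} :
    IsStandardProductLift (salvettiCovering Λ) K ↔
      ∃ g A B, IsJoin Λ A B ∧ K = coset Λ g (A ∪ B) := by
  constructor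
  · rintro ⟨L, hL, hK⟩
    obtain ⟨A, B, hAB, rfl⟩ := (isStandardProduct_iff h3).mp hL
    obtain ⟨g, hg⟩ := exists_subset_coset hK.1.1 hK.1.2
    exact ⟨g, A, B, hAB, hg.antisymm
      (hK.2 ⟨isTreeProduct_coset h3 hAB g, coset_subset_preimage g _⟩ hg)⟩
  · rintro ⟨g, A, B, hAB, rfl⟩
    refine ⟨_, (isStandardProduct_iff h3).mpr ⟨A, B, hAB, rfl⟩,
      ⟨isTreeProduct_coset h3 hAB g, coset_subset_preimage g _⟩, ?_⟩
    rintro K' ⟨hK', hL⟩ hle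
    obtain ⟨g', hg'⟩ := exists_subset_coset hK' hL
    have h := inCoset_of_coset_subset (Set.Subset.trans hle hg')
    exact hg'.trans (coset_eq_of_inCoset h).subset

/-- A join which is not properly contained in another one. -/
def IsMaximalJoin (Λ : SimpleGraph V) (A B : Set V) : Prop :=
  IsJoin Λ A B ∧ ∀ A' B', IsJoin Λ A' B' → A ∪ B ⊆ A' ∪ B' → A' ∪ B' ⊆ A ∪ B

theorem IsMaximalJoin.symm {A B : Set V} (h : IsMaximalJoin Λ A B) : IsMaximalJoin Λ B A := by
  refine ⟨h.1.symm, fun A' B' h' hle => ?_⟩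
  rw [Set.union_comm B A] at hle ⊢
  exact h.2 A' B' h' hle

/-- The maximal product subcomplexes of the universal cover are the cosets of maximal joins. -/
theorem isMaximalProduct_iff [Finite V] (h3 : Λ.CliqueFree 3) {K : Set (salvettiCover Λ).Cell} :
    IsMaximalProduct (salvettiCovering Λ) K ↔
      ∃ g A B, IsMaximalJoin Λ A B ∧ K = coset Λ g (A ∪ B) := by
  constructor
  · rintro ⟨hK, hmax⟩
    obtain ⟨g, A, B, hAB, rfl⟩ := (isStandardProductLift_iff h3).mp hK
    exact ⟨g, A, B, ⟨hAB, fun A' B' hAB' hle => subset_of_coset_subset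
      (hmax ((isStandardProductLift_iff h3).mpr ⟨g, A', B', hAB', rfl⟩) (coset_mono hle))⟩, rfl⟩
  · rintro ⟨g, A, B, ⟨hAB, hmax⟩, rfl⟩
    refine ⟨(isStandardProductLift_iff h3).mpr ⟨g, A, B, hAB, rfl⟩, fun K' hK' hle => ?_⟩
    obtain ⟨g', A', B', hAB', rfl⟩ := (isStandardProductLift_iff h3).mp hK'
    have hle : coset Λ g (A ∪ B) ⊆ coset Λ g' (A' ∪ B') := hle
    have h := inCoset_of_coset_subset hle
    change coset Λ g' (A' ∪ B') ⊆ coset Λ g (A ∪ B)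
    rw [coset_eq_of_inCoset h]
    exact coset_mono (hmax A' B' hAB' (subset_of_coset_subset hle))

/-- Every join is contained in a maximal one. -/
theorem exists_isMaximalJoin [Finite V] {A B : Set V} (hAB : IsJoin Λ A B) :
    ∃ A' B', IsMaximalJoin Λ A' B' ∧ A ∪ B ⊆ A' ∪ B' := by
  obtain ⟨U, hU, ⟨A', B', hAB', rfl⟩, hmax⟩ := Set.Finite.exists_le_maximal
    (s := {U : Set V | ∃ A' B', IsJoin Λ A' B' ∧ U = A' ∪ B'}) (Set.toFinite _)
    (a := A ∪ B) ⟨A, B, hAB, rfl⟩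
  exact ⟨A', B', ⟨hAB', fun A'' B'' h hle => hmax ⟨A'', B'', h, rfl⟩ hle⟩, hU⟩

/-- A simplex of the intersection complex is a nonempty finite set of maximal product subcomplexes
that share a vertex and two adjacent labels. -/
theorem mem_faces_iff [Finite V] (h3 : Λ.CliqueFree 3)
    {s : Finset (raagIntersectionComplex Λ).V} :
    s ∈ (raagIntersectionComplex Λ).faces ↔
      s.Nonempty ∧ ∃ g a b, Λ.Adj a b ∧ ∀ M ∈ s, coset Λ g {a, b} ⊆ M.1 := by
  refine and_congr_right fun _ => ⟨?_, ?_⟩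
  · rintro ⟨F, hF, h⟩
    obtain ⟨⟨x, l⟩, ⟨x', l'⟩, c, d, hsq, hm⟩ := exists_square_of_isFlat hF
    refine ⟨x, l.1, l'.1, hsq.1.1, fun M hM => ?_⟩
    obtain ⟨g, A, B, -, hM'⟩ := (isMaximalProduct_iff h3).mp M.2
    have h1 := h M hM hm
    rw [hM'] at h1 ⊢
    obtain ⟨-, hx, ha, hb⟩ := h1
    rw [coset_eq_of_inCoset hx]
    refine coset_mono ?_
    rintro _ (rfl | rfl)
    · exact ha
    · exact hb
  · rintro ⟨g, a, b, hab, h⟩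
    obtain ⟨F, hF, hFg⟩ := exists_isFlat hab g
    exact ⟨F, hF, fun M hM => hFg.trans (h M hM)⟩

theorem singleton_mem_faces [Finite V] (h3 : Λ.CliqueFree 3) (M : (raagIntersectionComplex Λ).V) :
    {M} ∈ (raagIntersectionComplex Λ).faces := by
  obtain ⟨g, A, B, ⟨⟨⟨a, ha⟩, ⟨b, hb⟩, hAB⟩, -⟩, hM⟩ := (isMaximalProduct_iff h3).mp M.2
  refine (mem_faces_iff h3).mpr ⟨Finset.singleton_nonempty M, g, a, b, hAB a ha b hb, ?_⟩
  intro M' hM'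
  rw [Finset.mem_singleton.mp hM', hM]
  refine coset_mono ?_
  rintro _ (rfl | rfl)
  · exact Or.inl ha
  · exact Or.inr hb

end Lifts

/-! ### Assigned groups -/

section Assigned

open scoped Pointwise

variable {V : Type u} {Λ : SimpleGraph V}

variable (Λ) in
/-- A conjugate of a parabolic subgroup. -/
def conjPar (g : RAAG Λ) (A : Set V) : Subgroup (RAAG Λ) :=
  (par Λ A).map (MulAut.conj g).toMonoidHom

theorem mem_conjPar {g h : RAAG Λ} {A : Set V} : h ∈ conjPar Λ g A ↔ g⁻¹ * h * g ∈ par Λ A := by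
  constructor
  · rintro ⟨x, hx, rfl⟩
    simpa [mul_assoc] using hx
  · intro hx
    exact ⟨_, hx, by simp [mul_assoc]⟩

/-- The vertices of a coset. -/
def vertSet (g : RAAG Λ) (A : Set V) : Set (salvettiCover Λ).Cell :=
  (fun x : RAAG Λ => SquareComplex.Cell.vert x) '' {x | InCoset Λ g A x}

theorem vert_mem_vertSet {g x : RAAG Λ} {A : Set V} :
    (SquareComplex.Cell.vert x : (salvettiCover Λ).Cell) ∈ vertSet g A ↔ InCoset Λ g A x := by
  constructor
  · rintro ⟨y, hy, h⟩
    cases h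
    exact hy
  · exact fun h => ⟨x, h, rfl⟩

theorem InCoset.smul {g x : RAAG Λ} {S : Set V} (hx : InCoset Λ g S x) (h : RAAG Λ) :
    InCoset Λ (h * g) S (h * x) := by
  unfold InCoset at *
  simpa [mul_assoc] using hx

theorem smul_coset (h g : RAAG Λ) (S : Set V) : h • coset Λ g S = coset Λ (h * g) S := by
  have key : ∀ h g : RAAG Λ, h • coset Λ g S ⊆ coset Λ (h * g) S := by
    rintro h g _ ⟨x | e | ⟨a, b, c, d⟩, hc, rfl⟩
    · exact InCoset.smul hc h
    · exact ⟨InCoset.smul hc.1 h, hc.2⟩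
    · exact ⟨(salvettiDeck Λ h).map_square hc.1, InCoset.smul hc.2.1 h, hc.2.2⟩
  refine (key h g).antisymm ?_
  rw [Set.subset_smul_set_iff]
  simpa using key h⁻¹ (h * g)

theorem smul_vertSet (h g : RAAG Λ) (A : Set V) : h • vertSet g A = vertSet (h * g) A := by
  have key : ∀ h g : RAAG Λ, h • vertSet g A ⊆ vertSet (h * g) A := by
    rintro h g _ ⟨_, ⟨x, hx, rfl⟩, rfl⟩
    exact ⟨h * x, InCoset.smul hx h, rfl⟩
  refine (key h g).antisymm ?_
  rw [Set.subset_smul_set_iff]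
  simpa using key h⁻¹ (h * g)

theorem vertSet_eq_of_inCoset {g x : RAAG Λ} {A : Set V} (h : InCoset Λ g A x) :
    vertSet g A = vertSet x A := by
  unfold vertSet
  congr 1
  ext y
  exact inCoset_iff_of_inCoset h y

/-- A factor of a join is normalized by the parabolic subgroup of the join. -/
theorem conj_mem_par {A B : Set V} (hAB : IsJoin Λ A B) {w x : RAAG Λ} (hw : w ∈ par Λ (A ∪ B))
    (hx : x ∈ par Λ A) : w⁻¹ * x * w ∈ par Λ A := by
  refine par_induction_right (P := fun w => w⁻¹ * x * w ∈ par Λ A) (by simpa using hx) ?_ hw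
  intro w _ l hl ih
  have h : (w * letter Λ l)⁻¹ * x * (w * letter Λ l) =
      (letter Λ l)⁻¹ * (w⁻¹ * x * w) * letter Λ l := by group
  rw [h]
  rcases hl with hl | hl
  · exact mul_mem (mul_mem (inv_mem (letter_mem_par hl)) ih) (letter_mem_par hl)
  · rw [mul_assoc, (commute_of_mem_par hAB.2.2 ih (letter_mem_par hl)).eq, inv_mul_cancel_left]
    exact ih

/-- The elements that stabilize the coset of a join and all cosets of one of its factors. -/
theorem stabilizer_slices {ι : Type*} {g : RAAG Λ} {A B : Set V} (hAB : IsJoin Λ A B)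
    (slice : ι → Set (salvettiCover Λ).Cell)
    (hs : ∀ i, ∃ k, InCoset Λ g (A ∪ B) k ∧ slice i = vertSet k A)
    (hg : ∃ i, slice i = vertSet g A) :
    MulAction.stabilizer (RAAG Λ) (coset Λ g (A ∪ B)) ⊓
      ⨅ i, MulAction.stabilizer (RAAG Λ) (slice i) = conjPar Λ g A := by
  ext h
  rw [Subgroup.mem_inf, Subgroup.mem_iInf, mem_conjPar]
  simp only [MulAction.mem_stabilizer_iff]
  constructor
  · rintro ⟨-, h1⟩
    obtain ⟨i, hi⟩ := hg
    have h2 := h1 i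
    rw [hi, smul_vertSet] at h2
    have h3 : InCoset Λ g A (h * g) := vert_mem_vertSet.mp
      (h2 ▸ vert_mem_vertSet.mpr (inCoset_self _ _))
    unfold InCoset at h3
    rwa [mul_assoc]
  · intro hh
    have hh' : InCoset Λ g A (h * g) := by
      unfold InCoset
      rwa [← mul_assoc]
    refine ⟨?_, fun i => ?_⟩
    · rw [smul_coset]
      exact (coset_eq_of_inCoset (par_mono Set.subset_union_left hh')).symm
    · obtain ⟨k, hk, hi⟩ := hs i
      rw [hi, smul_vertSet]
      refine (vertSet_eq_of_inCoset ?_).symm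
      have h4 := conj_mem_par hAB hk hh
      unfold InCoset
      simpa [mul_assoc] using h4

section Slices

variable {α β : Type w} {S : SimpleGraph α} {T : SimpleGraph β}
  {f : SquareMap ((OGraph.ofSimpleGraph S).prod (OGraph.ofSimpleGraph T)) (salvettiCover Λ)}
  {g : RAAG Λ} {A B : Set V}

theorem inCoset_vtx {L : Set V} (hK : f.image = coset Λ g L) (x : α) (y : β) :
    InCoset Λ g L (vtx f x y) := by
  have : f.onCell (.vert (x, y)) ∈ coset Λ g L := hK ▸ ⟨.vert (x, y), trivial, rfl⟩
  exact this

theorem exists_vtx_eq {L : Set V} (hK : f.image = coset Λ g L) : ∃ x y, vtx f x y = g := by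
  have : .vert (g : RAAG Λ) ∈ f.image := hK ▸ inCoset_self g L
  obtain ⟨⟨x, y⟩ | e | _, -, h⟩ := this
  · exact ⟨x, y, SquareComplex.Cell.vert.inj h⟩
  · cases h
  · cases h

/-- If the horizontal edges of a product structure on the coset of a join are labelled by `A` and
the vertical ones by `B`, then the horizontal slices are the cosets of `par A`. -/
theorem slice_left (hAB : IsJoin Λ A B) (hf : f.IsEmbedding) (hS : S.Connected)
    (hK : f.image = coset Λ g (A ∪ B)) (hA : ∀ d y, (labL f d y).1 ∈ A)
    (hB : ∀ x d, (labR f x d).1 ∈ B) (x₀ : α) (y : β) :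
    (Set.range fun x : α => SquareComplex.Cell.vert (f.onV (x, y))) = vertSet (vtx f x₀ y) A := by
  apply Set.Subset.antisymm
  · rintro _ ⟨x, rfl⟩
    exact ⟨vtx f x y, inv_mul_mem_of_labL f hS (fun d => hA d y) x₀ x, rfl⟩
  · rintro _ ⟨z, hz, rfl⟩
    have key : ∀ w ∈ par Λ A, ∃ x, vtx f x y = vtx f x₀ y * w := fun w hw => by
      refine par_induction_right (P := fun w => ∃ x, vtx f x y = vtx f x₀ y * w)
        ⟨x₀, by simp⟩ ?_ hw
      rintro w - l hl ⟨x, hx⟩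
      have he : .edge ((vtx f x y, l) : RAAG Λ × (V × Bool)) ∈ f.image :=
        hK ▸ ⟨inCoset_vtx hK x y, Or.inl hl⟩
      obtain ⟨_ | (⟨d, y'⟩ | ⟨x', d⟩) | _, -, h⟩ := he
      · cases h
      · have h1 := (onE_inl f d y').symm.trans (SquareComplex.Cell.edge.inj h)
        obtain ⟨h2, h3⟩ := Prod.mk.inj h1
        obtain ⟨-, rfl⟩ := Prod.mk.inj (hf.1 h2 : ((SimpleGraph.Dart.toProd d).1, y') = (x, y))
        refine ⟨(SimpleGraph.Dart.toProd d).2, ?_⟩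
        exact (vtx_mul_labL f d y').symm.trans
          ((congr (congrArg HMul.hMul h2) (congrArg (letter Λ) h3)).trans (by rw [hx, mul_assoc]))
      · have h1 := (onE_inr f x' d).symm.trans (SquareComplex.Cell.edge.inj h)
        have h3 := congrArg Prod.fst (Prod.mk.inj h1).2
        exact absurd (h3 ▸ hB x' d) (Set.disjoint_left.mp hAB.disjoint hl)
      · cases h
    obtain ⟨x, hx⟩ := key _ hz
    exact ⟨x, congrArg _ (hx.trans (mul_inv_cancel_left _ _))⟩

/-- The vertical slices are the cosets of `par B`. -/
theorem slice_right (hAB : IsJoin Λ A B) (hf : f.IsEmbedding) (hT : T.Connected)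
    (hK : f.image = coset Λ g (A ∪ B)) (hA : ∀ d y, (labL f d y).1 ∈ A)
    (hB : ∀ x d, (labR f x d).1 ∈ B) (x : α) (y₀ : β) :
    (Set.range fun y : β => SquareComplex.Cell.vert (f.onV (x, y))) = vertSet (vtx f x y₀) B := by
  apply Set.Subset.antisymm
  · rintro _ ⟨y, rfl⟩
    exact ⟨vtx f x y, inv_mul_mem_of_labR f hT (fun d => hB x d) y₀ y, rfl⟩
  · rintro _ ⟨z, hz, rfl⟩
    have key : ∀ w ∈ par Λ B, ∃ y, vtx f x y = vtx f x y₀ * w := fun w hw => by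
      refine par_induction_right (P := fun w => ∃ y, vtx f x y = vtx f x y₀ * w)
        ⟨y₀, by simp⟩ ?_ hw
      rintro w - l hl ⟨y, hy⟩
      have he : .edge ((vtx f x y, l) : RAAG Λ × (V × Bool)) ∈ f.image :=
        hK ▸ ⟨inCoset_vtx hK x y, Or.inr hl⟩
      obtain ⟨_ | (⟨d, y'⟩ | ⟨x', d⟩) | _, -, h⟩ := he
      · cases h
      · have h1 := (onE_inl f d y').symm.trans (SquareComplex.Cell.edge.inj h)
        have h3 := congrArg Prod.fst (Prod.mk.inj h1).2
        exact absurd hl (Set.disjoint_left.mp hAB.disjoint (h3 ▸ hA d y'))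
      · have h1 := (onE_inr f x' d).symm.trans (SquareComplex.Cell.edge.inj h)
        obtain ⟨h2, h3⟩ := Prod.mk.inj h1
        obtain ⟨rfl, -⟩ := Prod.mk.inj (hf.1 h2 : (x', (SimpleGraph.Dart.toProd d).1) = (x, y))
        refine ⟨(SimpleGraph.Dart.toProd d).2, ?_⟩
        exact (vtx_mul_labR f x' d).symm.trans
          ((congr (congrArg HMul.hMul h2) (congrArg (letter Λ) h3)).trans (by rw [hy, mul_assoc]))
      · cases h
    obtain ⟨y, hy⟩ := key _ hz
    exact ⟨y, congrArg _ (hy.trans (mul_inv_cancel_left _ _))⟩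

theorem stabilizer_left (hAB : IsJoin Λ A B) (hf : f.IsEmbedding) (hS : S.Connected)
    (hK : f.image = coset Λ g (A ∪ B)) (hA : ∀ d y, (labL f d y).1 ∈ A)
    (hB : ∀ x d, (labR f x d).1 ∈ B) :
    MulAction.stabilizer (RAAG Λ) (coset Λ g (A ∪ B)) ⊓ ⨅ y : β, MulAction.stabilizer (RAAG Λ)
      (Set.range fun x : α => SquareComplex.Cell.vert (f.onV (x, y))) = conjPar Λ g A := by
  obtain ⟨x₀, y₀, h₀⟩ := exists_vtx_eq hK
  refine stabilizer_slices hAB _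
    (fun y => ⟨_, inCoset_vtx hK x₀ y, slice_left hAB hf hS hK hA hB x₀ y⟩) ⟨y₀, ?_⟩
  rw [← h₀]
  exact slice_left hAB hf hS hK hA hB x₀ y₀

theorem stabilizer_right (hAB : IsJoin Λ A B) (hf : f.IsEmbedding) (hT : T.Connected)
    (hK : f.image = coset Λ g (A ∪ B)) (hA : ∀ d y, (labL f d y).1 ∈ A)
    (hB : ∀ x d, (labR f x d).1 ∈ B) :
    MulAction.stabilizer (RAAG Λ) (coset Λ g (A ∪ B)) ⊓ ⨅ x : α, MulAction.stabilizer (RAAG Λ)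
      (Set.range fun y : β => SquareComplex.Cell.vert (f.onV (x, y))) = conjPar Λ g B := by
  obtain ⟨x₀, y₀, h₀⟩ := exists_vtx_eq hK
  rw [Set.union_comm]
  refine stabilizer_slices hAB.symm _ (fun x => ⟨_, Set.union_comm A B ▸ inCoset_vtx hK x y₀,
    slice_right hAB hf hT hK hA hB x y₀⟩) ⟨x₀, ?_⟩
  rw [← h₀]
  exact slice_right hAB hf hT hK hA hB x₀ y₀

end Slices

theorem ofSimpleGraph_connected {α : Type u} {S : SimpleGraph α} (hS : S.Connected) :
    (OGraph.ofSimpleGraph S).Connected := by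
  refine ⟨hS.nonempty, fun x y => ?_⟩
  obtain ⟨p⟩ := hS.preconnected y x
  induction p with
  | nil => exact ⟨0, OGraph.Within.refl _ _⟩
  | @cons y z x hadj _ ih =>
    obtain ⟨n, hn⟩ := ih
    exact ⟨n + 1, OGraph.Within.step (P := OGraph.ofSimpleGraph S)
      (⟨(z, y), hadj.symm⟩ : S.Dart) hn⟩

theorem nonempty_dart {α : Type u} {S : SimpleGraph α} (hS : S.Connected) [Infinite α] :
    Nonempty S.Dart := by
  obtain ⟨x⟩ := hS.nonempty
  obtain ⟨y, hy⟩ := exists_ne x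
  obtain ⟨p⟩ := hS.preconnected x y
  cases p with
  | nil => exact absurd rfl hy
  | cons h _ => exact ⟨⟨(_, _), h⟩⟩

/-- The two factors of any product structure on the coset of a join are labelled by the two sides of
the join: all labels of the one factor are adjacent to all labels of the other. -/
theorem labels_dichotomy (h3 : Λ.CliqueFree 3) {α β : Type u} {S : SimpleGraph α}
    {T : SimpleGraph β} [Infinite α] [Infinite β]
    {f : SquareMap ((OGraph.ofSimpleGraph S).prod (OGraph.ofSimpleGraph T)) (salvettiCover Λ)}
    {g : RAAG Λ} {A B : Set V} (hAB : IsJoin Λ A B) (hS : S.Connected) (hT : T.Connected)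
    (hK : f.image = coset Λ g (A ∪ B)) :
    (∀ d y, (labL f d y).1 ∈ A) ∧ (∀ x d, (labR f x d).1 ∈ B) ∨
      (∀ d y, (labL f d y).1 ∈ B) ∧ (∀ x d, (labR f x d).1 ∈ A) := by
  let F : SquareMap ((OGraph.ofSimpleGraph S).prod (OGraph.ofSimpleGraph T)) (salvetti Λ) :=
    { onV := fun _ => PUnit.unit
      onE := fun e => (f.onE e).2
      map_src := fun _ => rfl
      map_rev := fun e => congrArg Prod.snd (f.map_rev e)
      map_square := fun h => (f.map_square h).1 }
  have hL : ∀ d y, (labL f d y).1 ∈ A ∪ B := fun d y =>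
    (show f.onCell (.edge (.inl (d, y))) ∈ coset Λ g (A ∪ B) from
      hK ▸ ⟨.edge (.inl (d, y)), trivial, rfl⟩).2
  have hR : ∀ x d, (labR f x d).1 ∈ A ∪ B := fun x d =>
    (show f.onCell (.edge (.inr (x, d))) ∈ coset Λ g (A ∪ B) from
      hK ▸ ⟨.edge (.inr (x, d)), trivial, rfl⟩).2
  have hadj : ∀ d y x e, Λ.Adj (labL f d y).1 (labR f x e).1 := by
    intro d y x e
    have h1 : labL f d y = labL f d e.fst :=
      onE_inl_eq F (ofSimpleGraph_connected hT) d y e.fst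
    have h2 : labR f x e = labR f d.snd e :=
      onE_inr_eq F (ofSimpleGraph_connected hS) e x d.snd
    rw [h1, h2]
    have hsq := OGraph.ProdSquare.hor (P := OGraph.ofSimpleGraph S)
        (Q := OGraph.ofSimpleGraph T) d e
    exact (F.map_square (X := (OGraph.ofSimpleGraph S).prod (OGraph.ofSimpleGraph T)) hsq).1
  obtain ⟨d₀⟩ := nonempty_dart hS
  obtain ⟨e₀⟩ := nonempty_dart hT
  have hdis := Set.disjoint_left.mp hAB.disjoint
  have hcase := fun d y x e => hAB.mem_of_adj h3 (hL d y) (hR x e) (hadj d y x e)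
  rcases hcase d₀ e₀.fst d₀.fst e₀ with ⟨h1, h2⟩ | ⟨h1, h2⟩
  · exact Or.inl ⟨fun d y => ((hcase d y d₀.fst e₀).resolve_right fun h => hdis h.2 h2).1,
      fun x e => ((hcase d₀ e₀.fst x e).resolve_right fun h => hdis h1 h.1).2⟩
  · exact Or.inr ⟨fun d y => ((hcase d y d₀.fst e₀).resolve_left fun h => hdis h2 h.2).1,
      fun x e => ((hcase d₀ e₀.fst x e).resolve_left fun h => hdis h.1 h1).2⟩

/-- The coordinates of the stabilizer of the coset of a join are, up to interchanging them, the
conjugates of the parabolic subgroups of the two sides of the join. -/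
theorem isProductStabilizer_eq (h3 : Λ.CliqueFree 3) {g : RAAG Λ} {A B : Set V}
    (hAB : IsJoin Λ A B) {H₁ H₂ : Subgroup (RAAG Λ)}
    (h : IsProductStabilizer (coset Λ g (A ∪ B)) H₁ H₂) :
    H₁ = conjPar Λ g A ∧ H₂ = conjPar Λ g B ∨ H₁ = conjPar Λ g B ∧ H₂ = conjPar Λ g A := by
  obtain ⟨α, β, S, T, f, hα, hβ, hS, hT, hf, hK, rfl, rfl⟩ := h
  rcases labels_dichotomy h3 hAB hS.connected hT.connected hK with ⟨hl, hr⟩ | ⟨hl, hr⟩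
  · exact Or.inl ⟨stabilizer_left hAB hf hS.connected hK hl hr,
      stabilizer_right hAB hf hT.connected hK hl hr⟩
  · rw [Set.union_comm] at hK ⊢
    exact Or.inr ⟨stabilizer_left hAB.symm hf hS.connected hK hl hr,
      stabilizer_right hAB.symm hf hT.connected hK hl hr⟩

theorem isProductStabilizer_coset (h3 : Λ.CliqueFree 3) (g : RAAG Λ) {A B : Set V}
    (hAB : IsJoin Λ A B) :
    IsProductStabilizer (coset Λ g (A ∪ B)) (conjPar Λ g A) (conjPar Λ g B) := by
  obtain ⟨f, hf, hK, hv⟩ := exists_embedding_cayley h3 hAB g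
  have hA := cayley_isTree (Λ := Λ) fun a ha b hb => hAB.not_adj_left h3 ha hb
  have hB := cayley_isTree (Λ := Λ) fun a ha b hb => hAB.not_adj_right h3 ha hb
  have hl : ∀ d y, (labL f d y).1 ∈ A := fun d y => by
    have h := vtx_mul_labL f d y
    have hy : ∀ x : par Λ A, g * x * y = g * y * x := fun x => by
      rw [mul_assoc, mul_assoc, (commute_of_mem_par hAB.2.2 x.2 y.2).eq]
    rw [hv, hv, hy, hy, mul_assoc, mul_right_inj, ← eq_inv_mul_iff_mul_eq] at h
    exact letter_mem_par_iff.mp (h ▸ mul_mem (inv_mem d.fst.2) d.snd.2)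
  have hr : ∀ x d, (labR f x d).1 ∈ B := fun x d => by
    have h := vtx_mul_labR f x d
    rw [hv, hv, mul_assoc, mul_right_inj, ← eq_inv_mul_iff_mul_eq] at h
    exact letter_mem_par_iff.mp (h ▸ mul_mem (inv_mem d.fst.2) d.snd.2)
  refine ⟨_, _, cayley Λ A, cayley Λ B, f, infinite_par hAB.1, infinite_par hAB.2.1, hA, hB, hf, hK,
    (stabilizer_left hAB hf hA.connected hK hl hr).symm,
    (stabilizer_right hAB hf hB.connected hK hl hr).symm⟩

/-- Along an edge path of length `n` exponent sums change by at most `n`. -/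
theorem abs_expo_le_of_within (c : V) {n : ℕ} {x y : (salvettiCover Λ).V}
    (h : (salvettiCover Λ).toOGraph.Within n x y) :
    |(expo Λ c y).toAdd - (expo Λ c x).toAdd| ≤ n := by
  induction h with
  | refl => simp
  | @step n x e _ ih =>
    have h1 : |(expo Λ c (letter Λ e.2)).toAdd| ≤ 1 := by
      obtain ⟨g, a, s⟩ := e
      have h2 : |(expo Λ c (gen Λ a)).toAdd| ≤ 1 := by
        by_cases ha : a = c
        · subst ha
          simp [expo_gen_self]
        · simp [expo_gen_of_ne ha]
      cases s
      · have : letter Λ (a, false) = (gen Λ a)⁻¹ := rfl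
        simpa [this] using h2
      · exact h2
    have h2 : (expo Λ c ((salvettiCover Λ).toOGraph.tgt e)).toAdd =
        (expo Λ c ((salvettiCover Λ).src e)).toAdd + (expo Λ c (letter Λ e.2)).toAdd :=
      congrArg Multiplicative.toAdd (map_mul (expo Λ c) e.1 (letter Λ e.2))
    rw [h2, add_sub_right_comm]
    refine (abs_add_le _ _).trans ?_
    push_cast
    exact add_le_add ih h1

theorem expo_eq_of_inCoset {g y : RAAG Λ} {S : Set V} {c : V} (hc : c ∉ S)
    (h : InCoset Λ g S y) : expo Λ c y = expo Λ c g := by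
  have h1 := expo_eq_one hc h
  rw [map_mul, map_inv, inv_mul_eq_one] at h1
  exact h1.symm

/-- If a coset lies in the bounded neighbourhood of another one then its labels are also labels of
the latter: the exponent sums of the other generators are bounded there. -/
theorem subset_of_finiteHausdorff {g g' : RAAG Λ} {S S' : Set V}
    (h : FiniteHausdorff (coset Λ g' S') (coset Λ g S)) : S ⊆ S' := by
  intro c hc
  by_contra hc'
  obtain ⟨n, hn⟩ := h
  set k : ℤ := (expo Λ c g').toAdd - (expo Λ c g).toAdd with hk
  obtain ⟨y, hy, hw⟩ := hn (g * gen Λ c ^ (k + n + 1) : RAAG Λ)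
    ((inCoset_self g S).mul_right (zpow_mem (gen_mem_par hc) _))
  have h2 := abs_expo_le_of_within c hw
  rw [map_mul, expo_gen_zpow, toAdd_mul, toAdd_ofAdd] at h2
  have h3 : (expo Λ c (y : RAAG Λ)).toAdd = (expo Λ c g').toAdd :=
    congrArg _ (expo_eq_of_inCoset hc' hy)
  have h4 := (abs_le.mp h2).2
  have h5 : (expo Λ c g).toAdd + (k + n + 1) - (expo Λ c g').toAdd ≤ n := h3 ▸ h4
  omega

/-- The groups assigned to the vertices of the intersection complex. -/
theorem assigned_singleton [Finite V] (h3 : Λ.CliqueFree 3) {M : (raagIntersectionComplex Λ).V}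
    {g : RAAG Λ} {A B : Set V} (hAB : IsJoin Λ A B) (hM : M.1 = coset Λ g (A ∪ B))
    {H₁ H₂ : Subgroup (RAAG Λ)} (h : (raagIntersectionComplex Λ).assigned {M} H₁ H₂) :
    H₁ = conjPar Λ g A ∧ H₂ = conjPar Λ g B ∨ H₁ = conjPar Λ g B ∧ H₂ = conjPar Λ g A := by
  obtain ⟨K, hK, hKM, hH, hst⟩ := h
  obtain ⟨g', A', B', hAB', rfl⟩ := (isStandardProductLift_iff h3).mp hK
  have hle := hKM M (Finset.mem_singleton_self M)
  rw [hM] at hle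
  have hW : {c | ∀ M' ∈ ({M} : Finset _), c ∈ M'.1} = coset Λ g (A ∪ B) := by
    ext c
    simp [hM]
  have h1 : A ∪ B = A' ∪ B' := (subset_of_finiteHausdorff (hW ▸ hH)).antisymm
    (subset_of_coset_subset hle)
  rw [← h1, ← coset_eq_of_inCoset (inCoset_of_coset_subset hle)] at hst
  exact isProductStabilizer_eq h3 hAB hst

/-- If the intersection of the vertices of a simplex is the coset of a join then the conjugates of
the two parabolic subgroups are the coordinates of the assigned group. -/
theorem assigned_of_inter [Finite V] (h3 : Λ.CliqueFree 3)
    {s : Finset (raagIntersectionComplex Λ).V} {g : RAAG Λ} {A B : Set V} (hAB : IsJoin Λ A B)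
    (h : ∀ c, (∀ M ∈ s, c ∈ M.1) ↔ c ∈ coset Λ g (A ∪ B)) :
    (raagIntersectionComplex Λ).assigned s (conjPar Λ g A) (conjPar Λ g B) :=
  ⟨coset Λ g (A ∪ B), (isStandardProductLift_iff h3).mpr ⟨g, A, B, hAB, rfl⟩,
    fun M hM c hc => (h c).mpr hc M hM,
    ⟨0, fun x hx => ⟨x, (h _).mp hx, OGraph.Within.refl _ _⟩⟩, isProductStabilizer_coset h3 g hAB⟩

end Assigned

/-! ### Trees -/

section Trees

/-- The vertices adjacent to `v` that are farther from the root `r` than `v`. -/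
def children {α : Type*} (G : SimpleGraph α) (r v : α) : Set α :=
  {w | G.Adj v w ∧ G.dist r w = G.dist r v + 1}

/-- In a tree, every vertex is a child of at most one vertex. -/
theorem eq_of_mem_children {α : Type*} {G : SimpleGraph α} (hG : G.IsTree) {r v v' w : α}
    (h : w ∈ children G r v) (h' : w ∈ children G r v') : v = v' := by
  obtain ⟨p, hp, hlen⟩ := hG.connected.exists_path_of_dist r v
  obtain ⟨p', hp', hlen'⟩ := hG.connected.exists_path_of_dist r v'
  have hq : (p.concat h.1).IsPath := SimpleGraph.Walk.isPath_of_length_eq_dist _ (by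
    rw [SimpleGraph.Walk.length_concat, hlen, h.2])
  have hq' : (p'.concat h'.1).IsPath := SimpleGraph.Walk.isPath_of_length_eq_dist _ (by
    rw [SimpleGraph.Walk.length_concat, hlen', h'.2])
  have := congrArg Subtype.val ((hG.isAcyclic.subsingleton_path r w).elim ⟨_, hq⟩ ⟨_, hq'⟩)
  have h1 := congrArg SimpleGraph.Walk.penultimate this
  simpa using h1

theorem exists_mem_children {α : Type*} {G : SimpleGraph α} (hG : G.IsTree) {r w : α}
    (h : w ≠ r) : ∃ v, w ∈ children G r v := by
  obtain ⟨p, hp, hlen⟩ := hG.connected.exists_path_of_dist w r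
  cases p with
  | nil => exact absurd rfl h
  | @cons _ v _ hadj q =>
    refine ⟨v, hadj.symm, ?_⟩
    have h1 : G.dist v r ≤ q.length := SimpleGraph.dist_le q
    rw [SimpleGraph.Walk.length_cons] at hlen
    have h2 := hG.dist_eq_dist_add_one_of_adj r hadj
    rw [SimpleGraph.dist_comm (u := r) (v := w), SimpleGraph.dist_comm (u := r) (v := v)] at *
    omega

/-- The rooted tree whose vertices are the finite sequences of natural numbers. -/
def listTree : SimpleGraph (List ℕ) where
  Adj l l' := (∃ n, l' = n :: l) ∨ ∃ n, l = n :: l'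
  symm := ⟨fun _ _ h => h.symm⟩
  loopless := ⟨by
    rintro l (⟨n, h⟩ | ⟨n, h⟩) <;> simpa using congrArg List.length h⟩

theorem nonempty_iso_listTree {α : Type*} [Countable α] {G : SimpleGraph α} (hG : G.IsTree)
    (hinf : ∀ v, (G.neighborSet v).Infinite) : Nonempty (listTree ≃g G) := by
  obtain ⟨r⟩ := hG.connected.nonempty
  have hc : ∀ v, (children G r v).Infinite := fun v hfin => by
    refine hinf v (Set.Finite.subset (hfin.union (Set.Subsingleton.finite
      (s := {w | v ∈ children G r w}) fun w hw w' hw' => eq_of_mem_children hG hw hw')) ?_)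
    intro w hw
    have hw : G.Adj v w := hw
    rcases hG.dist_eq_dist_add_one_of_adj r hw with h | h
    · exact Or.inr ⟨hw.symm, h⟩
    · exact Or.inl ⟨hw, h⟩
  have he : ∀ v, Nonempty (ℕ ≃ children G r v) := fun v => by
    have := (hc v).to_subtype
    obtain ⟨_⟩ := nonempty_denumerable (children G r v)
    exact ⟨(Denumerable.eqv _).symm⟩
  let e : ∀ v, ℕ ≃ children G r v := fun v => Classical.choice (he v)
  obtain ⟨f, hnil, hcons⟩ : ∃ f : List ℕ → α, f [] = r ∧ ∀ n l, f (n :: l) = e (f l) n :=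
    ⟨fun l => l.rec r fun n _ v => e v n, rfl, fun _ _ => rfl⟩
  have hmem : ∀ n l, f (n :: l) ∈ children G r (f l) := fun n l => hcons n l ▸ (e (f l) n).2
  have hdist : ∀ l, G.dist r (f l) = l.length := fun l => by
    induction l with
    | nil => rw [hnil, SimpleGraph.dist_self, List.length_nil]
    | cons n l ih => rw [(hmem n l).2, ih, List.length_cons]
  have hinj : Function.Injective f := by
    intro l
    induction l with
    | nil =>
      intro l' h
      have := congrArg (G.dist r) h
      rw [hdist, hdist] at this
      exact (List.eq_nil_of_length_eq_zero this.symm).symm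
    | cons n l ih =>
      rintro (_ | ⟨n', l'⟩) h
      · have := congrArg (G.dist r) h
        rw [hdist, hdist] at this
        simp at this
      · have h1 : f l = f l' := eq_of_mem_children hG (hmem n l) (h ▸ hmem n' l')
        obtain rfl := ih h1
        rw [hcons, hcons] at h
        rw [(e (f l)).injective (Subtype.ext h)]
  have hchild : ∀ l w, w ∈ children G r (f l) → ∃ n, f (n :: l) = w := fun l w hw =>
    ⟨(e (f l)).symm ⟨w, hw⟩, by rw [hcons, Equiv.apply_symm_apply]⟩
  have hsurj : Function.Surjective f := by
    suffices h : ∀ n v, G.dist r v = n → ∃ l, f l = v from fun v => h _ v rfl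
    intro n
    induction n with
    | zero => exact fun v hv => ⟨[], hnil.trans (hG.connected.dist_eq_zero_iff.mp hv)⟩
    | succ n ih =>
      intro v hv
      obtain ⟨w, hw⟩ := exists_mem_children hG (r := r) (w := v) (by rintro rfl; simp at hv)
      obtain ⟨l, rfl⟩ := ih w (by have := hw.2; omega)
      obtain ⟨m, hm⟩ := hchild l v hw
      exact ⟨_, hm⟩
  refine ⟨⟨Equiv.ofBijective f ⟨hinj, hsurj⟩, fun {l l'} => ?_⟩⟩
  change G.Adj (f l) (f l') ↔ _
  constructor
  · intro h
    rcases hG.dist_eq_dist_add_one_of_adj r h with hd | hd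
    · obtain ⟨n, hn⟩ := hchild l' (f l) ⟨h.symm, hd⟩
      exact Or.inr ⟨n, (hinj hn).symm⟩
    · obtain ⟨n, hn⟩ := hchild l (f l') ⟨h, hd⟩
      exact Or.inl ⟨n, (hinj hn).symm⟩
  · rintro (⟨n, rfl⟩ | ⟨n, rfl⟩)
    · exact (hmem n l).1
    · exact (hmem n l').1.symm

/-- Any two countable trees all of whose vertices have infinite valency are isomorphic. -/
theorem nonempty_iso_of_isTree {α β : Type*} [Countable α] [Countable β] {G : SimpleGraph α}
    {H : SimpleGraph β} (hG : G.IsTree) (hH : H.IsTree) (hG' : ∀ v, (G.neighborSet v).Infinite)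
    (hH' : ∀ v, (H.neighborSet v).Infinite) : Nonempty (G ≃g H) := by
  obtain ⟨e⟩ := nonempty_iso_listTree hG hG'
  obtain ⟨e'⟩ := nonempty_iso_listTree hH hH'
  exact ⟨e.symm.trans e'⟩

variable {V : Type u}

/-- A tree in which no star contains all vertices. -/
structure IsLongTree (T : SimpleGraph V) : Prop extends T.IsTree where
  exists_adj_adj : ∀ v, ∃ w x, T.Adj v w ∧ T.Adj w x ∧ x ≠ v

theorem isLongTree_of_ediam {T : SimpleGraph V} (hT : T.IsTree) (h : 3 ≤ T.ediam) :
    IsLongTree T := by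
  refine ⟨hT, fun v => ?_⟩
  by_contra! hcon
  have hstar : ∀ x, T.edist v x ≤ 1 := by
    intro x
    rw [SimpleGraph.edist_le_one_iff_adj_or_eq]
    obtain ⟨p⟩ := hT.connected.preconnected x v
    induction p with
    | nil => exact Or.inr rfl
    | cons hadj _ ih =>
      rcases ih hcon with h1 | rfl
      · exact Or.inr (hcon _ _ h1 hadj.symm).symm
      · exact Or.inl hadj.symm
  have hle : T.ediam ≤ 2 := SimpleGraph.ediam_le_of_edist_le fun x y =>
    calc T.edist x y ≤ T.edist x v + T.edist v y := SimpleGraph.edist_triangle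
      _ ≤ 1 + 1 := add_le_add (SimpleGraph.edist_comm ▸ hstar x) (hstar y)
      _ = 2 := one_add_one_eq_two
  exact absurd (h.trans hle) (by decide)

/-- A tree that contains a path with three edges has diameter at least three. -/
theorem three_le_ediam {T : SimpleGraph V} (hT : T.IsTree) {u v w x : V} (huv : T.Adj u v)
    (hvw : T.Adj v w) (hwx : T.Adj w x) (huw : u ≠ w) (hvx : v ≠ x) : 3 ≤ T.ediam := by
  have hux : u ≠ x := by
    rintro rfl
    exact not_adj_of_adj (hT.isAcyclic.cliqueFree le_rfl) huv hvw hwx.symm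
  have hp : (SimpleGraph.Walk.cons huv (.cons hvw (.cons hwx .nil))).IsPath := by
    simp [SimpleGraph.Walk.cons_isPath_iff, huv.ne, huw, hux, hvw.ne, hvx, hwx.ne]
  obtain ⟨q, hq, hlen⟩ := hT.connected.exists_path_of_dist u x
  have h1 := congrArg (fun p => p.1.length)
    ((hT.isAcyclic.subsingleton_path u x).elim ⟨_, hp⟩ ⟨_, hq⟩)
  have h2 : T.dist u x = 3 := by
    rw [← hlen]
    simpa using h1.symm
  have h3 := (hT.connected.preconnected u x).coe_dist_eq_edist
  rw [h2] at h3
  exact le_of_eq_of_le h3 SimpleGraph.edist_le_ediam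

/-- In a tree one side of every join is a single vertex. -/
theorem subsingleton_of_isJoin {T : SimpleGraph V} (hT : T.IsTree) {A B : Set V}
    (hAB : IsJoin T A B) : A.Subsingleton ∨ B.Subsingleton := by
  by_contra! hcon
  obtain ⟨a, ha, a', ha', hne⟩ := hcon.1
  obtain ⟨b, hb, b', hb', hne'⟩ := hcon.2
  have hp : ∀ c ∈ B, ∃ p : T.Path a a', p.1.snd = c := fun c hc => by
    have h1 := hAB.2.2 a ha c hc
    have h2 := (hAB.2.2 a' ha' c hc).symm
    exact ⟨⟨.cons h1 (.cons h2 .nil), by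
      simp [SimpleGraph.Walk.cons_isPath_iff, h1.ne, hne, h2.ne]⟩, by simp⟩
  obtain ⟨p, hp1⟩ := hp b hb
  obtain ⟨p', hp2⟩ := hp b' hb'
  rw [(hT.isAcyclic.subsingleton_path a a').elim p p', hp2] at hp1
  exact hne' hp1.symm

end Trees

/-! ### Stars as maximal joins -/

section Stars

variable {V : Type u} {Λ : SimpleGraph V}

variable (Λ) in
/-- The vertex `v` together with its neighbours. -/
def star (v : V) : Set V := {v} ∪ Λ.neighborSet v

/-- The vertex has at least two neighbours. -/
def IsInterior (Λ : SimpleGraph V) (v : V) : Prop := (Λ.neighborSet v).Nontrivial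

theorem mem_star_self (v : V) : v ∈ star Λ v := Or.inl rfl

theorem mem_star_of_adj {v w : V} (h : Λ.Adj v w) : w ∈ star Λ v := Or.inr h

theorem IsInterior.of_adj {v a b : V} (ha : Λ.Adj v a) (hb : Λ.Adj v b) (hne : a ≠ b) :
    IsInterior Λ v :=
  ⟨a, ha, b, hb, hne⟩

theorem IsInterior.isJoin {v : V} (hv : IsInterior Λ v) : IsJoin Λ {v} (Λ.neighborSet v) :=
  ⟨⟨v, rfl⟩, hv.nonempty, by rintro _ rfl b hb; exact hb⟩

theorem star_injective (h3 : Λ.CliqueFree 3) {v w : V} (hv : IsInterior Λ v)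
    (h : star Λ v = star Λ w) : v = w := by
  by_contra hne
  have hwv : Λ.Adj w v := ((h ▸ mem_star_self v : v ∈ star Λ w)).resolve_left hne
  obtain ⟨a, ha, haw⟩ := hv.exists_ne w
  have hwa : Λ.Adj w a := (h ▸ mem_star_of_adj ha : a ∈ star Λ w).resolve_left haw
  exact not_adj_of_adj h3 hwv ha hwa

/-- Two adjacent vertices of a star include its centre. -/
theorem eq_or_eq_of_mem_star (h3 : Λ.CliqueFree 3) {v a b : V} (hab : Λ.Adj a b)
    (ha : a ∈ star Λ v) (hb : b ∈ star Λ v) : v = a ∨ v = b := by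
  rcases ha with rfl | ha
  · exact Or.inl rfl
  rcases hb with rfl | hb
  · exact Or.inr rfl
  exact absurd hb (not_adj_of_adj h3 ha hab)

theorem star_inter_star (h3 : Λ.CliqueFree 3) {v w : V} (h : Λ.Adj v w) :
    star Λ v ∩ star Λ w = {v} ∪ {w} := by
  ext a
  constructor
  · rintro ⟨rfl | ha, rfl | ha'⟩
    · exact Or.inl rfl
    · exact Or.inl rfl
    · exact Or.inr rfl
    · exact absurd ha (not_adj_of_adj h3 h ha')
  · rintro (rfl | rfl)
    · exact ⟨mem_star_self _, mem_star_of_adj h.symm⟩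
    · exact ⟨mem_star_of_adj h, mem_star_self _⟩

/-- If every join has a side with only one vertex then stars are maximal joins. -/
theorem IsInterior.isMaximalJoin (h3 : Λ.CliqueFree 3)
    (hsub : ∀ A B, IsJoin Λ A B → A.Subsingleton ∨ B.Subsingleton) {v : V}
    (hv : IsInterior Λ v) : IsMaximalJoin Λ {v} (Λ.neighborSet v) := by
  refine ⟨hv.isJoin, ?_⟩
  have key : ∀ A B, IsJoin Λ A B → star Λ v ⊆ A ∪ B → v ∈ A → A ∪ B ⊆ star Λ v := by
    intro A B hAB hle hvA
    have hN : Λ.neighborSet v ⊆ B := fun a ha =>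
      (hle (mem_star_of_adj ha)).resolve_left fun h => hAB.not_adj_left h3 hvA h ha
    have hA : A.Subsingleton := (hsub A B hAB).resolve_right fun h =>
      Set.not_subsingleton_iff.mpr (hv.mono hN) h
    rintro a (ha | ha)
    · exact Or.inl (hA ha hvA)
    · exact Or.inr (hAB.2.2 v hvA a ha)
  intro A B hAB hle
  rcases hle (mem_star_self v) with h | h
  · exact key A B hAB hle h
  · rw [Set.union_comm]
    exact key B A hAB.symm (by rwa [Set.union_comm]) h

end Stars

/-! ### The graph of the intersection complex -/

section Graph

open Classical in
/-- The 1-skeleton of a complex. -/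
def skeleton {G : Type u} [Group G] (X : GroupedComplex G) : SimpleGraph X.V where
  Adj M M' := M ≠ M' ∧ {M, M'} ∈ X.faces
  symm := ⟨fun M M' h => ⟨h.1.symm, Finset.pair_comm M M' ▸ h.2⟩⟩
  loopless := ⟨fun _ h => h.1 rfl⟩

variable {V : Type u} {T : SimpleGraph V}

namespace IsLongTree

theorem cliqueFree (hT : IsLongTree T) : T.CliqueFree 3 := hT.isAcyclic.cliqueFree le_rfl

/-- Every vertex is adjacent to an interior vertex. -/
theorem exists_isInterior (hT : IsLongTree T) (v : V) : ∃ w, T.Adj v w ∧ IsInterior T w := by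
  obtain ⟨w, x, hvw, hwx, hne⟩ := hT.exists_adj_adj v
  exact ⟨w, hvw, .of_adj hvw.symm hwx hne.symm⟩

theorem isMaximalJoin (hT : IsLongTree T) {v : V} (hv : IsInterior T v) :
    IsMaximalJoin T {v} (T.neighborSet v) :=
  hv.isMaximalJoin hT.cliqueFree fun _ _ => subsingleton_of_isJoin hT.toIsTree

/-- In a tree of diameter at least three the maximal joins are the stars of interior vertices. -/
theorem exists_eq_star (hT : IsLongTree T) {A B : Set V} (hAB : IsMaximalJoin T A B) :
    ∃ v, IsInterior T v ∧ A ∪ B = star T v := by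
  have key : ∀ A B, IsMaximalJoin T A B → A.Subsingleton →
      ∃ v, IsInterior T v ∧ A ∪ B = star T v := by
    rintro A B ⟨hAB, hmax⟩ hA
    obtain ⟨v, hv⟩ := hAB.1
    obtain ⟨b, hb⟩ := hAB.2.1
    have hle : A ∪ B ⊆ star T v := by
      rintro a (ha | ha)
      · exact Or.inl (hA ha hv)
      · exact Or.inr (hAB.2.2 v hv a ha)
    have heq : A ∪ B = star T v := hle.antisymm (hmax {v} (T.neighborSet v)
      ⟨⟨v, rfl⟩, ⟨b, hAB.2.2 v hv b hb⟩, by rintro _ rfl c hc; exact hc⟩ hle)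
    refine ⟨v, ?_, heq⟩
    -- If `v` is a leaf then its star is contained in the star of its neighbour.
    by_contra hv'
    have hN : (T.neighborSet v).Subsingleton := Set.not_nontrivial_iff.mp hv'
    obtain ⟨w, x, hvw, hwx, hne⟩ := hT.exists_adj_adj v
    have hx := hmax {w} (T.neighborSet w)
      ⟨⟨w, rfl⟩, ⟨x, hwx⟩, by rintro _ rfl c hc; exact hc⟩ (heq ▸ ?_) (mem_star_of_adj hwx)
    · rw [heq] at hx
      have hvx : T.Adj v x := hx.resolve_left hne
      exact not_adj_of_adj hT.cliqueFree hvw hwx hvx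
    · rintro a (rfl | ha)
      · exact mem_star_of_adj hvw.symm
      · exact Or.inl (hN ha hvw)
  rcases subsingleton_of_isJoin hT.toIsTree hAB.1 with h | h
  · exact key A B hAB h
  · rw [Set.union_comm]
    exact key B A hAB.symm h

variable [Finite V]

/-- The maximal product subcomplex that is spanned by a coset of the star of an interior vertex. -/
def vertex (hT : IsLongTree T) (g : RAAG T) {v : V} (hv : IsInterior T v) :
    (raagIntersectionComplex T).V :=
  ⟨coset T g (star T v), (isMaximalProduct_iff hT.cliqueFree).mpr
    ⟨g, _, _, hT.isMaximalJoin hv, rfl⟩⟩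

theorem exists_eq_vertex (hT : IsLongTree T) (M : (raagIntersectionComplex T).V) :
    ∃ g v, ∃ hv : IsInterior T v, M = hT.vertex g hv := by
  obtain ⟨g, A, B, hAB, hM⟩ := (isMaximalProduct_iff hT.cliqueFree).mp M.2
  obtain ⟨v, hv, h⟩ := hT.exists_eq_star hAB
  exact ⟨g, v, hv, Subtype.ext (hM.trans (by rw [h]; rfl))⟩

theorem vertex_eq_of_inCoset (hT : IsLongTree T) {g x : RAAG T} {v : V} (hv : IsInterior T v)
    (h : InCoset T g (star T v) x) : hT.vertex g hv = hT.vertex x hv :=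
  Subtype.ext (coset_eq_of_inCoset h)

theorem vertex_eq_iff (hT : IsLongTree T) {g g' : RAAG T} {v v' : V} {hv : IsInterior T v}
    {hv' : IsInterior T v'} :
    hT.vertex g hv = hT.vertex g' hv' ↔ v = v' ∧ InCoset T g (star T v) g' := by
  constructor
  · intro h
    have h1 : coset T g (star T v) = coset T g' (star T v') := congrArg Subtype.val h
    exact ⟨star_injective hT.cliqueFree hv (eq_of_coset_eq h1), inCoset_of_coset_subset h1.superset⟩
  · rintro ⟨rfl, h⟩
    exact hT.vertex_eq_of_inCoset hv h

/-- A maximal product subcomplex that contains the flats of an edge is the coset of the star of one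
of the two ends of this edge. -/
theorem eq_vertex_of_coset_subset (hT : IsLongTree T) {g : RAAG T} {a b : V} (hab : T.Adj a b)
    {M : (raagIntersectionComplex T).V} (h : coset T g {a, b} ⊆ M.1) :
    ∃ v, ∃ hv : IsInterior T v, M = hT.vertex g hv ∧ (v = a ∨ v = b) := by
  obtain ⟨g', v, hv, rfl⟩ := hT.exists_eq_vertex M
  have hs := subset_of_coset_subset h
  exact ⟨v, hv, hT.vertex_eq_of_inCoset hv (inCoset_of_coset_subset h),
    eq_or_eq_of_mem_star hT.cliqueFree hab (hs (Or.inl rfl)) (hs (Or.inr rfl))⟩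

/-- Edges of the intersection complex come from edges between interior vertices of the tree. -/
theorem adj_iff (hT : IsLongTree T) {M M' : (raagIntersectionComplex T).V} :
    (skeleton (raagIntersectionComplex T)).Adj M M' ↔ ∃ g v w, ∃ hv : IsInterior T v,
      ∃ hw : IsInterior T w, T.Adj v w ∧ M = hT.vertex g hv ∧ M' = hT.vertex g hw := by
  classical
  constructor
  · rintro ⟨hne, h⟩
    obtain ⟨-, g, a, b, hab, h⟩ := (mem_faces_iff hT.cliqueFree).mp h
    obtain ⟨v, hv, rfl, hva⟩ := hT.eq_vertex_of_coset_subset hab (h M (by simp))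
    obtain ⟨w, hw, rfl, hwa⟩ := hT.eq_vertex_of_coset_subset hab (h M' (by simp))
    refine ⟨g, v, w, hv, hw, ?_, rfl, rfl⟩
    rcases hva with rfl | rfl <;> rcases hwa with rfl | rfl
    · exact absurd rfl hne
    · exact hab
    · exact hab.symm
    · exact absurd rfl hne
  · rintro ⟨g, v, w, hv, hw, hvw, rfl, rfl⟩
    refine ⟨fun h => hvw.ne (hT.vertex_eq_iff.mp h).1, (mem_faces_iff hT.cliqueFree).mpr
      ⟨by simp, g, v, w, hvw, ?_⟩⟩
    intro M hM
    rw [Finset.mem_insert, Finset.mem_singleton] at hM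
    rcases hM with rfl | rfl
    · refine coset_mono ?_
      rintro _ (rfl | rfl)
      · exact mem_star_self _
      · exact mem_star_of_adj hvw
    · refine coset_mono ?_
      rintro _ (rfl | rfl)
      · exact mem_star_of_adj hvw.symm
      · exact mem_star_self _

open Classical in
/-- The intersection complex of a tree is a graph. -/
theorem mem_faces_iff (hT : IsLongTree T) {s : Finset (raagIntersectionComplex T).V} :
    s ∈ (raagIntersectionComplex T).faces ↔
      ∃ M M', s = {M, M'} ∧ (M = M' ∨ (skeleton (raagIntersectionComplex T)).Adj M M') := by
  constructor
  · intro hs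
    obtain ⟨⟨M, hM⟩, g, a, b, hab, h⟩ := (RAAG.mem_faces_iff hT.cliqueFree).mp hs
    by_cases hall : ∀ M' ∈ s, M' = M
    · refine ⟨M, M, ?_, Or.inl rfl⟩
      ext M'
      simp only [Finset.mem_insert, Finset.mem_singleton, or_self]
      exact ⟨hall M', fun h => h ▸ hM⟩
    · push Not at hall
      obtain ⟨M', hM', hne⟩ := hall
      refine ⟨M, M', ?_, Or.inr ⟨hne.symm, (raagIntersectionComplex T).down_closed s hs _ ?_
        (by simp)⟩⟩
      · ext N
        simp only [Finset.mem_insert, Finset.mem_singleton]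
        refine ⟨fun hN => ?_, by rintro (rfl | rfl) <;> assumption⟩
        obtain ⟨v, hv, rfl, hva⟩ := hT.eq_vertex_of_coset_subset hab (h M hM)
        obtain ⟨v', hv', rfl, hva'⟩ := hT.eq_vertex_of_coset_subset hab (h M' hM')
        obtain ⟨w, hw, rfl, hwa⟩ := hT.eq_vertex_of_coset_subset hab (h N hN)
        rcases hva with rfl | rfl <;> rcases hva' with rfl | rfl <;> rcases hwa with rfl | rfl <;>
          first
          | exact Or.inl rfl
          | exact Or.inr rfl
          | exact absurd rfl hne
      · intro N hN
        rw [Finset.mem_insert, Finset.mem_singleton] at hN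
        rcases hN with rfl | rfl <;> assumption
  · rintro ⟨M, M', rfl, rfl | h⟩
    · simpa using singleton_mem_faces hT.cliqueFree M
    · exact h.2

theorem skeleton_connected (hT : IsLongTree T) :
    (skeleton (raagIntersectionComplex T)).Connected := by
  -- Fixing the group element, interior vertices are connected since the tree is.
  have hA : ∀ (g : RAAG T) {u u' : V} (hu : IsInterior T u) (hu' : IsInterior T u'),
      (skeleton (raagIntersectionComplex T)).Reachable (hT.vertex g hu) (hT.vertex g hu') := by
    intro g u u' hu hu'
    have hstep : ∀ {y z : V} (hy : IsInterior T y) (hz : IsInterior T z), T.Adj y z →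
        (skeleton (raagIntersectionComplex T)).Reachable (hT.vertex g hy) (hT.vertex g hz) :=
      fun hy hz h => (hT.adj_iff.mpr ⟨g, _, _, hy, hz, h, rfl, rfl⟩).reachable
    have key : ∀ x : V, T.Reachable x u → ∀ {y : V} (hy : IsInterior T y), y = x ∨ T.Adj x y →
        (skeleton (raagIntersectionComplex T)).Reachable (hT.vertex g hu) (hT.vertex g hy) := by
      rintro x ⟨p⟩
      induction p with
      | nil =>
        rintro y hy (rfl | h)
        · rfl
        · exact hstep hu hy h
      | @cons x' x _ hadj _ ih =>
        rintro y hy (rfl | h)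
        · exact ih hu hy (Or.inr hadj.symm)
        · by_cases hx' : IsInterior T x'
          · exact (ih hu hx' (Or.inr hadj.symm)).trans (hstep hx' hy h)
          · exact ih hu hy (Or.inl (Set.not_nontrivial_iff.mp hx' h hadj))
    exact key u' (hT.connected.preconnected u' u) hu' (Or.inl rfl)
  obtain ⟨v₀⟩ := hT.connected.nonempty
  obtain ⟨u₀, -, hu₀⟩ := hT.exists_isInterior v₀
  have hB : ∀ (g : RAAG T) {u : V} (hu : IsInterior T u),
      (skeleton (raagIntersectionComplex T)).Reachable (hT.vertex 1 hu₀) (hT.vertex g hu) := by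
    intro g
    have hg : g ∈ par T Set.univ := by simp [par_univ]
    intro u hu
    refine par_induction_right (P := fun g => ∀ {u : V} (hu : IsInterior T u),
      (skeleton (raagIntersectionComplex T)).Reachable (hT.vertex 1 hu₀) (hT.vertex g hu))
      (fun hu => hA 1 hu₀ hu) ?_ hg hu
    intro g _ l _ ih _ hu
    obtain ⟨w, haw, hw⟩ := hT.exists_isInterior l.1
    have h1 : hT.vertex g hw = hT.vertex (g * letter T l) hw := hT.vertex_eq_of_inCoset hw
      ((inCoset_self g _).mul_right (letter_mem_par (mem_star_of_adj haw.symm)))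
    exact (ih hw).trans (h1 ▸ hA _ hw hu)
  have : Nonempty (raagIntersectionComplex T).V := ⟨hT.vertex 1 hu₀⟩
  refine ⟨fun M M' => ?_⟩
  obtain ⟨g, u, hu, rfl⟩ := hT.exists_eq_vertex M
  obtain ⟨g', u', hu', rfl⟩ := hT.exists_eq_vertex M'
  exact (hB g hu).symm.trans (hB g' hu')

theorem countable (hT : IsLongTree T) : Countable (raagIntersectionComplex T).V := by
  choose g v hv h using hT.exists_eq_vertex
  refine Function.Injective.countable (f := fun M => (g M, v M)) fun M M' hMM => ?_
  obtain ⟨h1, h2⟩ := Prod.mk.inj hMM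
  rw [h M, h M', hT.vertex_eq_iff]
  exact ⟨h2, h1 ▸ inCoset_self _ _⟩

theorem infinite_neighborSet (hT : IsLongTree T) (M : (raagIntersectionComplex T).V) :
    ((skeleton (raagIntersectionComplex T)).neighborSet M).Infinite := by
  obtain ⟨g, v, hv, rfl⟩ := hT.exists_eq_vertex M
  obtain ⟨w, hvw, hw⟩ := hT.exists_isInterior v
  obtain ⟨w', hvw', hne⟩ := hv.exists_ne w
  have hvw' : T.Adj v w' := hvw'
  refine Set.infinite_of_injective_forall_mem
    (f := fun n : ℤ => hT.vertex (g * gen T w' ^ n) hw) ?_ fun n => ?_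
  · intro m n h
    have h1 := (hT.vertex_eq_iff.mp h).2
    have h2 : gen T w' ^ (-m + n) ∈ par T (star T w) := by
      have h3 : (g * gen T w' ^ m)⁻¹ * (g * gen T w' ^ n) ∈ par T (star T w) := h1
      rw [zpow_add, zpow_neg]
      simpa [mul_assoc] using h3
    by_contra hmn
    rcases gen_zpow_mem_par h2 (by omega) with h3 | h3
    · exact hne h3
    · exact not_adj_of_adj hT.cliqueFree hvw h3 hvw'
  · refine hT.adj_iff.mpr ⟨g * gen T w' ^ n, v, w, hv, hw, hvw, ?_, rfl⟩
    exact hT.vertex_eq_of_inCoset hv ((inCoset_self g _).mul_right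
      (zpow_mem (gen_mem_par (mem_star_of_adj hvw')) n))

end IsLongTree

end Graph

/-! ### Edges of the intersection complex of a tree are bridges -/

section Bridges

variable {V : Type u} {T : SimpleGraph V}

/-- In a tree, the only edge between the two sides of an edge is this edge itself. -/
theorem eq_of_reachable_deleteEdges {v₀ w₀ u u' : V}
    (hbr : ¬ (T.deleteEdges {s(v₀, w₀)}).Reachable v₀ w₀)
    (hadj : T.Adj u u') (hu : (T.deleteEdges {s(v₀, w₀)}).Reachable v₀ u)
    (hu' : ¬ (T.deleteEdges {s(v₀, w₀)}).Reachable v₀ u') : u = v₀ ∧ u' = w₀ := by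
  have h : s(u, u') = s(v₀, w₀) := by
    by_contra hne
    refine hu' (hu.trans (SimpleGraph.Adj.reachable ?_))
    rw [SimpleGraph.deleteEdges_adj]
    exact ⟨hadj, hne⟩
  rw [Sym2.eq_iff] at h
  rcases h with h | ⟨rfl, rfl⟩
  · exact h
  · exact absurd hu hbr

/-- For every edge `v₀ w₀` of a tree there is a function on pairs of a group element and a vertex
which is constant on the cosets of stars, and which differs for the two ends of an edge if and only
if the edge is `v₀ w₀` and the group element lies in a given coset of `par {v₀, w₀}`. On the side of
`v₀` it is the potential `χ` of the cochain that is, on the edges labelled by the other side, the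
coboundary of the indicator function of the coset; on the side of `w₀` it is `χ` plus this
indicator function. -/
theorem exists_separating_function (hT : T.IsTree) {v₀ w₀ : V} (h₀ : T.Adj v₀ w₀) (g₀ : RAAG T) :
    ∃ Φ : RAAG T → V → ZMod 2,
      (∀ x u y, y ∈ par T (star T u) → Φ (x * y) u = Φ x u) ∧
      (∀ x u u', T.Adj u u' → Φ x u ≠ Φ x u' → s(u, u') = s(v₀, w₀) ∧ InCoset T g₀ {v₀, w₀} x) ∧
      Φ g₀ v₀ ≠ Φ g₀ w₀ := by
  classical
  have hbr : ¬ (T.deleteEdges {s(v₀, w₀)}).Reachable v₀ w₀ :=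
    SimpleGraph.isBridge_iff.mp (SimpleGraph.isAcyclic_iff_forall_adj_isBridge.mp hT.isAcyclic h₀)
  let side : V → Prop := fun u => (T.deleteEdges {s(v₀, w₀)}).Reachable v₀ u
  have hv₀ : side v₀ := SimpleGraph.Reachable.rfl
  have hcross : ∀ {u u'}, T.Adj u u' → side u → ¬ side u' → u = v₀ ∧ u' = w₀ :=
    eq_of_reachable_deleteEdges hbr
  let C : RAAG T → ZMod 2 := fun x => if InCoset T g₀ {v₀, w₀} x then 1 else 0
  have hC : ∀ x a, a ∈ ({v₀, w₀} : Set V) → C (x * gen T a) = C x := fun x a ha => by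
    have : InCoset T g₀ {v₀, w₀} (x * gen T a) ↔ InCoset T g₀ {v₀, w₀} x :=
      ⟨fun h => by simpa using h.mul_right (inv_mem (gen_mem_par ha)),
        fun h => h.mul_right (gen_mem_par ha)⟩
    simp only [C, this]
  have h2 : ∀ a : ZMod 2, a + a = 0 := CharTwo.add_self_eq_zero
  have h4 : ∀ p q r t : ZMod 2, p + q + (q + t) = p + r + (r + t) := by decide
  have h3 : ∀ p q r : ZMod 2, p + (q + r) + r = p + q := by decide
  let d : V → RAAG T → ZMod 2 := fun a x => if side a then 0 else C x + C (x * gen T a)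
  have hdw : ∀ x, d w₀ x = 0 := fun x => by
    simp only [d, hC x w₀ (by simp), h2, ite_self]
  have hd0 : ∀ {a}, side a → ∀ x, d a x = 0 := fun ha x => if_pos ha
  have hd1 : ∀ {a}, ¬ side a → ∀ x, d a x = C x + C (x * gen T a) := fun ha x => if_neg ha
  obtain ⟨χ, hχ⟩ := exists_potential d (by
    intro a b hab x
    by_cases ha : side a <;> by_cases hb : side b
    · simp only [hd0 ha, hd0 hb]
    · obtain ⟨rfl, rfl⟩ := hcross hab ha hb
      simp only [hd0 ha, hdw]
    · obtain ⟨rfl, rfl⟩ := hcross hab.symm hb ha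
      simp only [hd0 hb, hdw]
    · rw [hd1 ha, hd1 hb, hd1 ha, hd1 hb, mul_assoc, mul_assoc, (gen_commute hab).eq]
      exact h4 _ _ _ _)
  have hin : ∀ {u}, side u → ∀ a ∈ star T u, ∀ x, χ (x * gen T a) = χ x := by
    rintro u hu a ha x
    rw [hχ, add_eq_left]
    by_cases hsa : side a
    · exact hd0 hsa x
    · rcases ha with rfl | ha
      · exact absurd hu hsa
      · obtain ⟨rfl, rfl⟩ := hcross ha hu hsa
        exact hdw x
  have hout : ∀ {u}, ¬ side u → ∀ a ∈ star T u, ∀ x,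
      χ (x * gen T a) + C (x * gen T a) = χ x + C x := by
    rintro u hu a ha x
    by_cases hsa : side a
    · rcases ha with rfl | ha
      · exact absurd hsa hu
      · obtain ⟨rfl, rfl⟩ := hcross ha.symm hsa hu
        rw [hχ, hd0 hsa, add_zero, hC x a (by simp)]
    · rw [hχ, hd1 hsa]
      exact h3 _ _ _
  refine ⟨fun x u => if side u then χ x else χ x + C x, ?_, ?_, ?_⟩
  · intro x u y hy
    by_cases hu : side u
    · simp only [if_pos hu]
      exact eq_of_forall_gen (hin hu) x hy
    · simp only [if_neg hu]
      exact eq_of_forall_gen (χ := fun x => χ x + C x) (hout hu) x hy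
  · intro x u u' hadj hne
    by_cases hu : side u <;> by_cases hu' : side u'
    · simp [hu, hu'] at hne
    · obtain ⟨rfl, rfl⟩ := hcross hadj hu hu'
      refine ⟨rfl, ?_⟩
      by_contra hx
      simp [hu, hu', C, hx] at hne
    · obtain ⟨rfl, rfl⟩ := hcross hadj.symm hu' hu
      refine ⟨Sym2.eq_swap, ?_⟩
      by_contra hx
      simp [hu, hu', C, hx] at hne
    · simp [hu, hu'] at hne
  · have hw₀ : ¬ side w₀ := hbr
    simp [hv₀, hw₀, C, inCoset_self]

/-- The intersection complex is a tree: evaluating the separating function of an edge of the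
intersection complex at the cosets of stars shows that this edge is a bridge. -/
theorem IsLongTree.skeleton_isTree [Finite V] (hT : IsLongTree T) :
    (skeleton (raagIntersectionComplex T)).IsTree := by
  refine ⟨hT.skeleton_connected, SimpleGraph.isAcyclic_iff_forall_adj_isBridge.mpr ?_⟩
  intro M₁ M₂ h
  obtain ⟨g₀, v₀, w₀, hv₀, hw₀, h₀, rfl, rfl⟩ := hT.adj_iff.mp h
  obtain ⟨Φ, h1, h2, h3⟩ := exists_separating_function hT.toIsTree h₀ g₀
  choose g v hv hM using hT.exists_eq_vertex
  have hΦ : ∀ (x : RAAG T) {u : V} (hu : IsInterior T u),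
      Φ (g (hT.vertex x hu)) (v (hT.vertex x hu)) = Φ x u := fun x u hu => by
    obtain ⟨h4, h5⟩ := hT.vertex_eq_iff.mp (hM (hT.vertex x hu))
    rw [← h4]
    have := h1 x u _ h5
    rwa [mul_inv_cancel_left] at this
  refine isBridge_of_function (fun M => Φ (g M) (v M)) ?_ (by rwa [hΦ, hΦ])
  intro M M' hadj hne
  obtain ⟨x, u, u', hu, hu', huu, rfl, rfl⟩ := hT.adj_iff.mp hadj
  rw [hΦ, hΦ]
  by_contra hcon
  obtain ⟨h4, h5⟩ := h2 x u u' huu hcon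
  have hstar : ∀ {z : V} (hz : IsInterior T z), (z = v₀ ∨ z = w₀) →
      hT.vertex x hz = hT.vertex g₀ hz := by
    intro z hz hz0
    refine (hT.vertex_eq_of_inCoset hz (par_mono ?_ h5)).symm
    rcases hz0 with rfl | rfl
    · rintro _ (rfl | rfl)
      · exact mem_star_self _
      · exact mem_star_of_adj h₀
    · rintro _ (rfl | rfl)
      · exact mem_star_of_adj h₀.symm
      · exact mem_star_self _
  rcases Sym2.eq_iff.mp h4 with ⟨rfl, rfl⟩ | ⟨rfl, rfl⟩
  · exact hne (by rw [hstar hu (Or.inl rfl), hstar hu' (Or.inr rfl)])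
  · exact hne (by rw [hstar hu (Or.inr rfl), hstar hu' (Or.inl rfl), Sym2.eq_swap])

end Bridges

/-! ### Coordinates of the assigned groups -/

section Coordinates

variable {V : Type u} {Λ : SimpleGraph V}

theorem isCyclic_conjPar (g : RAAG Λ) (a : V) : IsCyclic (conjPar Λ g {a}) := by
  rw [conjPar, par_singleton, MonoidHom.map_zpowers]
  infer_instance

/-- Two generators without an edge between them do not commute. -/
theorem not_isCyclic_conjPar (g : RAAG Λ) {A : Set V} (hA : A.Nontrivial)
    (hadj : ∀ a ∈ A, ∀ b ∈ A, ¬ Λ.Adj a b) : ¬ IsCyclic (conjPar Λ g A) := by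
  intro h
  obtain ⟨a, ha, b, hb, hne⟩ := hA
  have hmem : ∀ c ∈ A, g * gen Λ c * g⁻¹ ∈ conjPar Λ g A := fun c hc =>
    ⟨_, gen_mem_par hc, rfl⟩
  have hcomm := IsCyclic.isMulCommutative (α := conjPar Λ g A)
  have h1 := congrArg Subtype.val (hcomm.is_comm.comm ⟨_, hmem a ha⟩ ⟨_, hmem b hb⟩)
  refine not_commute_gen hne (hadj a ha b hb) ?_
  have h2 : g * gen Λ a * g⁻¹ * (g * gen Λ b * g⁻¹) = g * gen Λ b * g⁻¹ * (g * gen Λ a * g⁻¹) := h1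
  refine mul_right_cancel (b := g⁻¹) ?_
  simpa [mul_assoc] using h2

theorem conjPar_injective (g : RAAG Λ) {S S' : Set V} (h : conjPar Λ g S = conjPar Λ g S') :
    S = S' := by
  have h1 : par Λ S = par Λ S' := Subgroup.map_injective (MulAut.conj g).injective h
  exact (par_le_iff.mp h1.le).antisymm (par_le_iff.mp h1.ge)

/-- For a set of vertices without edges the parabolic subgroup of a subset is a free factor: mapping
the generators back to the free product inverts the homomorphism from the free product. -/
theorem isFreeFactor_conjPar (g : RAAG Λ) {S S' : Set V} (hS : ∀ a ∈ S, ∀ b ∈ S, ¬ Λ.Adj a b)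
    (hle : S' ⊆ S) : IsFreeFactor (conjPar Λ g S') (conjPar Λ g S) := by
  classical
  refine ⟨conjPar Λ g (S \ S'), ?_, ?_⟩
  · rw [conjPar, conjPar, ← Subgroup.map_sup, par, par, ← Subgroup.closure_union,
      ← Set.image_union, Set.union_sdiff_cancel hle]
    rfl
  · let i₁ : conjPar Λ g S' →* Monoid.Coprod (conjPar Λ g S') (conjPar Λ g (S \ S')) :=
      Monoid.Coprod.inl
    let i₂ : conjPar Λ g (S \ S') →* Monoid.Coprod (conjPar Λ g S') (conjPar Λ g (S \ S')) :=
      Monoid.Coprod.inr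
    let θ : RAAG Λ →* Monoid.Coprod (conjPar Λ g S') (conjPar Λ g (S \ S')) :=
      liftOn S (fun a => if h : a ∈ S' then i₁ ⟨MulAut.conj g (gen Λ a), _, gen_mem_par h, rfl⟩
        else if h' : a ∈ S \ S' then i₂ ⟨MulAut.conj g (gen Λ a), _, gen_mem_par h', rfl⟩ else 1)
        fun a ha b hb hab => absurd hab (hS a ha b hb)
    have hθ₁ : ∀ x (hx : x ∈ par Λ S'), θ x = i₁ ⟨MulAut.conj g x, x, hx, rfl⟩ := fun x hx => by
      induction hx using Subgroup.closure_induction with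
      | mem x hx =>
        obtain ⟨a, ha, rfl⟩ := hx
        simp [θ, liftOn_gen_of_mem (hle ha), ha]
      | one =>
        rw [map_one, ← map_one i₁]
        congr 1
        exact Subtype.ext (by simp)
      | mul x y hx hy ihx ihy =>
        rw [map_mul, ihx, ihy, ← map_mul]
        congr 1
        exact Subtype.ext (by simp)
      | inv x hx ih =>
        rw [map_inv, ih, ← map_inv]
        congr 1
        exact Subtype.ext (by simp [mul_assoc])
    have hθ₂ : ∀ x (hx : x ∈ par Λ (S \ S')), θ x = i₂ ⟨MulAut.conj g x, x, hx, rfl⟩ :=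
      fun x hx => by
      induction hx using Subgroup.closure_induction with
      | mem x hx =>
        obtain ⟨a, ha, rfl⟩ := hx
        have ha' := ha.2
        simp [θ, liftOn_gen_of_mem ha.1, ha.1, ha.2]
      | one =>
        rw [map_one, ← map_one i₂]
        congr 1
        exact Subtype.ext (by simp)
      | mul x y hx hy ihx ihy =>
        rw [map_mul, ihx, ihy, ← map_mul]
        congr 1
        exact Subtype.ext (by simp)
      | inv x hx ih =>
        rw [map_inv, ih, ← map_inv]
        congr 1
        exact Subtype.ext (by simp [mul_assoc])
    have hinv : (θ.comp (MulAut.conj g⁻¹).toMonoidHom).comp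
        (Monoid.Coprod.lift (conjPar Λ g S').subtype (conjPar Λ g (S \ S')).subtype) =
          MonoidHom.id _ := by
      apply Monoid.Coprod.hom_ext
      · ext ⟨_, x, hx, rfl⟩
        change θ (MulAut.conj g⁻¹ (MulAut.conj g x)) = i₁ ⟨MulAut.conj g x, x, hx, rfl⟩
        rw [← hθ₁ x hx]
        simp [mul_assoc]
      · ext ⟨_, x, hx, rfl⟩
        change θ (MulAut.conj g⁻¹ (MulAut.conj g x)) = i₂ ⟨MulAut.conj g x, x, hx, rfl⟩
        rw [← hθ₂ x hx]
        simp [mul_assoc]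
    exact Function.LeftInverse.injective (g := θ.comp (MulAut.conj g⁻¹).toMonoidHom)
      fun z => DFunLike.congr_fun hinv z

end Coordinates

/-! ### Semi-isomorphisms between intersection complexes of trees -/

section SemiIso

open Classical in
/-- The group assigned to the coset of the star of `v` is the product of the cyclic group of `v` and
the free group on the neighbours of `v`. -/
theorem IsLongTree.exists_assigned_singleton {V : Type u} [Finite V] {T : SimpleGraph V}
    (hT : IsLongTree T) (M : (raagIntersectionComplex T).V) :
    ∃ A B, (raagIntersectionComplex T).assigned {M} A B ∧ IsCyclic A ∧ ¬ IsCyclic B := by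
  obtain ⟨g, v, hv, rfl⟩ := hT.exists_eq_vertex M
  refine ⟨_, _, assigned_of_inter hT.cliqueFree (g := g) hv.isJoin fun c => ?_,
    isCyclic_conjPar g v, not_isCyclic_conjPar g hv fun a ha b hb =>
      hv.isJoin.not_adj_right hT.cliqueFree ha hb⟩
  simp only [Finset.mem_singleton, forall_eq]
  rfl

open Classical in
/-- For an edge of the intersection complex of a tree, the coordinates can be chosen such that the
first one is the same for the edge and for its end, while the second one is properly smaller for the
edge. -/
theorem IsLongTree.exists_assigned_pair {V : Type u} [Finite V] {T : SimpleGraph V}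
    (hT : IsLongTree T) {M M' : (raagIntersectionComplex T).V}
    (h : (skeleton (raagIntersectionComplex T)).Adj M M') :
    ∃ A B₀ B₁, (raagIntersectionComplex T).assigned {M} A B₀ ∧
      (raagIntersectionComplex T).assigned {M, M'} A B₁ ∧ IsFreeFactor A A ∧
      IsFreeFactor B₁ B₀ ∧ B₁ ≠ B₀ ∧ IsCyclic A ∧ IsCyclic B₁ := by
  obtain ⟨g, v, w, hv, hw, hvw, rfl, rfl⟩ := hT.adj_iff.mp h
  have hN : ∀ a ∈ T.neighborSet v, ∀ b ∈ T.neighborSet v, ¬ T.Adj a b := fun a ha b hb =>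
    hv.isJoin.not_adj_right hT.cliqueFree ha hb
  refine ⟨conjPar T g {v}, conjPar T g (T.neighborSet v), conjPar T g {w},
    assigned_of_inter hT.cliqueFree hv.isJoin fun c => ?_,
    assigned_of_inter hT.cliqueFree (A := {v}) (B := {w})
      ⟨⟨v, rfl⟩, ⟨w, rfl⟩, by rintro _ rfl _ rfl; exact hvw⟩ fun c => ?_,
    isFreeFactor_conjPar g (by rintro _ rfl _ rfl; exact T.loopless.irrefl _) le_rfl,
    isFreeFactor_conjPar g hN (Set.singleton_subset_iff.mpr hvw), fun heq => ?_,
    isCyclic_conjPar g v, isCyclic_conjPar g w⟩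
  · simp only [Finset.mem_singleton, forall_eq]
    rfl
  · rw [← star_inter_star hT.cliqueFree hvw, mem_coset_inter]
    simp only [Finset.mem_insert, Finset.mem_singleton, forall_eq_or_imp, forall_eq]
    rfl
  · exact Set.not_nontrivial_singleton (conjPar_injective g heq ▸ hv : ({w} : Set V).Nontrivial)

variable {V : Type u} {W : Type v} [Finite V] [Finite W] {T : SimpleGraph V} {Λ : SimpleGraph W}

/-- Every isomorphism is a semi-morphism: chains consist of a vertex or of an edge and one of its
ends, and the coordinates can be chosen such that the first one is constant and the second one
drops. -/
theorem IsLongTree.isSemiMorphism (hΛ : IsLongTree Λ) (hT : IsLongTree T)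
    (φ : skeleton (raagIntersectionComplex Λ) ≃g skeleton (raagIntersectionComplex T)) :
    GroupedComplex.IsSemiMorphism (raagIntersectionComplex Λ) (raagIntersectionComplex T) φ := by
  classical
  refine ⟨?_, fun s _ => φ.injective.injOn, ?_⟩
  · intro s hs
    obtain ⟨M, M', rfl, h⟩ := hΛ.mem_faces_iff.mp hs
    refine hT.mem_faces_iff.mpr ⟨φ M, φ M', by ext; simp, ?_⟩
    exact h.imp (congrArg φ) φ.map_adj_iff.mpr
  · rintro (_ | _ | n) c ⟨hmono, hc⟩
    · obtain ⟨M, hM⟩ := Finset.card_eq_one.mp (hc 0).2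
      obtain ⟨A, B, h, -⟩ := hΛ.exists_assigned_singleton M
      obtain ⟨A', B', h', -⟩ := hT.exists_assigned_singleton (φ M)
      refine ⟨fun _ => A, fun _ => B, fun _ => A', fun _ => B', ⟨fun i => ?_, fun i => i.elim0⟩,
        ⟨fun i => ?_, fun i => i.elim0⟩, fun i => i.elim0⟩
      · rw [Fin.fin_one_eq_zero i, hM]
        exact h
      · rw [Fin.fin_one_eq_zero i]
        change (raagIntersectionComplex T).assigned ((c 0).image φ) A' B'
        rw [hM, Finset.image_singleton]
        exact h'
    · obtain ⟨M, hM⟩ := Finset.card_eq_one.mp (hc 0).2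
      have hM1 : M ∈ c 1 := hmono (Fin.zero_le 1) (hM ▸ Finset.mem_singleton_self M)
      obtain ⟨M', hM'⟩ : ∃ M', c 1 = {M, M'} := by
        obtain ⟨x, y, -, hxy⟩ := Finset.card_eq_two.mp (hc 1).2
        rw [hxy, Finset.mem_insert, Finset.mem_singleton] at hM1
        rcases hM1 with rfl | rfl
        · exact ⟨y, hxy⟩
        · exact ⟨x, by rw [hxy, Finset.pair_comm]⟩
      have hadj : (skeleton (raagIntersectionComplex Λ)).Adj M M' := by
        refine ⟨?_, hM' ▸ (hc 1).1⟩
        rintro rfl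
        have := (hc 1).2
        rw [hM'] at this
        simp at this
      obtain ⟨A, B₀, B₁, h₁, h₂, h₃, h₄, -⟩ := hΛ.exists_assigned_pair hadj
      obtain ⟨A', B₀', B₁', h₁', h₂', h₃', h₄', hne, -⟩ :=
        hT.exists_assigned_pair (φ.map_adj_iff.mpr hadj)
      refine ⟨fun _ => A, ![B₀, B₁], fun _ => A', ![B₀', B₁'], ⟨?_, ?_⟩, ⟨?_, ?_⟩, ?_⟩
      · rw [Fin.forall_fin_two]
        exact ⟨hM ▸ h₁, hM' ▸ h₂⟩
      · rw [Fin.forall_fin_one]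
        exact ⟨h₃, h₄⟩
      · rw [Fin.forall_fin_two]
        refine ⟨?_, ?_⟩
        · change (raagIntersectionComplex T).assigned ((c 0).image φ) A' B₀'
          rw [hM, Finset.image_singleton]
          exact h₁'
        · change (raagIntersectionComplex T).assigned ((c 1).image φ) A' B₁'
          rw [hM', Finset.image_insert, Finset.image_singleton]
          exact h₂'
      · rw [Fin.forall_fin_one]
        exact ⟨h₃', h₄'⟩
      · rw [Fin.forall_fin_one]
        exact ⟨fun _ => rfl, fun h => absurd h hne⟩
    · obtain ⟨M, M', h, -⟩ := hΛ.mem_faces_iff.mp (hc 2).1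
      have h1 : (c 2).card ≤ 2 := h ▸ Finset.card_le_two
      have h2 : (c 2).card = ((2 : Fin (n + 3)) : ℕ) + 1 := (hc 2).2
      rw [Fin.val_two] at h2
      omega

theorem IsLongTree.preservesType (hΛ : IsLongTree Λ) (hT : IsLongTree T)
    (φ : skeleton (raagIntersectionComplex Λ) ≃g skeleton (raagIntersectionComplex T)) :
    GroupedComplex.PreservesType (raagIntersectionComplex Λ) (raagIntersectionComplex T) φ := by
  classical
  intro s hs
  obtain ⟨M, M', rfl, rfl | h⟩ := hΛ.mem_faces_iff.mp hs
  · obtain ⟨A, B, h, hA, hB⟩ := hΛ.exists_assigned_singleton M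
    obtain ⟨A', B', h', hA', hB'⟩ := hT.exists_assigned_singleton (φ M)
    refine ⟨A, B, A', B', by simpa using h, ?_, iff_of_true hA hA', iff_of_false hB hB'⟩
    simpa using h'
  · obtain ⟨A, -, B, -, h1, -, -, -, hA, hB⟩ := hΛ.exists_assigned_pair h
    obtain ⟨A', -, B', -, h1', -, -, -, hA', hB'⟩ :=
      hT.exists_assigned_pair (φ.map_adj_iff.mpr h)
    refine ⟨A, B, A', B', h1, ?_, iff_of_true hA hA', iff_of_true hB hB'⟩
    simpa [Finset.image_insert] using h1'

/-- The intersection complexes of any two trees of diameter at least three are semi-isomorphic: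
both are trees all of whose vertices have countably infinite valency. -/
theorem IsLongTree.semiIsomorphic (hΛ : IsLongTree Λ) (hT : IsLongTree T) :
    GroupedComplex.SemiIsomorphic (raagIntersectionComplex Λ) (raagIntersectionComplex T) := by
  have := hΛ.countable
  have := hT.countable
  obtain ⟨φ⟩ := nonempty_iso_of_isTree hΛ.skeleton_isTree hT.skeleton_isTree
    hΛ.infinite_neighborSet hT.infinite_neighborSet
  exact ⟨φ.toEquiv, hΛ.isSemiMorphism hT φ, hT.isSemiMorphism hΛ φ.symm, hΛ.preservesType hT φ⟩

end SemiIso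

/-! ### Graphs whose intersection complex is that of a tree -/

section Converse

variable {W : Type v} {Λ : SimpleGraph W}

theorem cliqueFree_of_salvettiDim [Finite W] (h : salvettiDim Λ = 2) : Λ.CliqueFree 3 := by
  intro s hs
  have h1 : s.card ≤ Λ.cliqueNum := SimpleGraph.IsClique.card_le_cliqueNum (tc := hs.1)
  rw [hs.2] at h1
  have h2 : Λ.cliqueNum = 2 := h
  omega

/-- An inclusion of joins is an inclusion of their sides. -/
theorem IsJoin.subset_cases (h3 : Λ.CliqueFree 3) {A B A' B' : Set W} (h : IsJoin Λ A B)
    (h' : IsJoin Λ A' B') (hle : A ∪ B ⊆ A' ∪ B') :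
    A ⊆ A' ∧ B ⊆ B' ∨ A ⊆ B' ∧ B ⊆ A' := by
  obtain ⟨a, ha⟩ := h.1
  obtain ⟨b, hb⟩ := h.2.1
  have hd := Set.disjoint_left.mp h'.disjoint
  have hcase := fun x (hx : x ∈ A) y (hy : y ∈ B) =>
    h'.mem_of_adj h3 (hle (Or.inl hx)) (hle (Or.inr hy)) (h.2.2 x hx y hy)
  rcases hcase a ha b hb with ⟨h1, h2⟩ | ⟨h1, h2⟩
  · exact Or.inl ⟨fun x hx => ((hcase x hx b hb).resolve_right fun h => hd h.2 h2).1,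
      fun y hy => ((hcase a ha y hy).resolve_right fun h => hd h1 h.1).2⟩
  · exact Or.inr ⟨fun x hx => ((hcase x hx b hb).resolve_left fun h => hd h2 h.2).1,
      fun y hy => ((hcase a ha y hy).resolve_left fun h => hd h.1 h1).2⟩

open Classical in
/-- If every vertex of the intersection complex has an assigned group with a cyclic coordinate then
every join has a side with only one vertex. -/
theorem subsingleton_of_assigned [Finite W] (h3 : Λ.CliqueFree 3)
    (h : ∀ M, ∃ H₁ H₂, (raagIntersectionComplex Λ).assigned {M} H₁ H₂ ∧
      (IsCyclic H₁ ∨ IsCyclic H₂)) {A B : Set W} (hAB : IsJoin Λ A B) :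
    A.Subsingleton ∨ B.Subsingleton := by
  obtain ⟨A', B', hAB', hle⟩ := exists_isMaximalJoin hAB
  have hjoin := hAB'.1
  have hsub : A'.Subsingleton ∨ B'.Subsingleton := by
    by_contra! hcon
    obtain ⟨H₁, H₂, hass, hcyc⟩ := h ⟨coset Λ 1 (A' ∪ B'), (isMaximalProduct_iff h3).mpr
      ⟨1, A', B', hAB', rfl⟩⟩
    have hA := not_isCyclic_conjPar (Λ := Λ) 1 hcon.1
      fun a ha b hb => hjoin.not_adj_left h3 ha hb
    have hB := not_isCyclic_conjPar (Λ := Λ) 1 hcon.2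
      fun a ha b hb => hjoin.not_adj_right h3 ha hb
    rcases assigned_singleton h3 hjoin rfl hass with ⟨rfl, rfl⟩ | ⟨rfl, rfl⟩
    · exact hcyc.elim hA hB
    · exact hcyc.elim hB hA
  rcases IsJoin.subset_cases h3 hAB hjoin hle with ⟨hA, hB⟩ | ⟨hA, hB⟩
  · exact hsub.imp (·.anti hA) (·.anti hB)
  · exact hsub.symm.imp (·.anti hA) (·.anti hB)

/-- If the intersection complex is connected then so is the defining graph: along the edges of the
intersection complex the cosets stay inside one coset of the parabolic subgroup of a connected
component. -/
theorem connected_of_skeleton_connected [Finite W] (h3 : Λ.CliqueFree 3)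
    (hconn : (skeleton (raagIntersectionComplex Λ)).Connected) : Λ.Connected := by
  classical
  obtain ⟨M₀⟩ := hconn.nonempty
  obtain ⟨g₀, A₀, B₀, hAB₀, hM₀⟩ := (isMaximalProduct_iff h3).mp M₀.2
  obtain ⟨a₀, ha₀⟩ := hAB₀.1.1
  let C : Set W := {w | Λ.Reachable a₀ w}
  have hjoin : ∀ A B, IsJoin Λ A B → ∀ a ∈ A ∪ B, a ∈ C → A ∪ B ⊆ C := by
    have key : ∀ A B, IsJoin Λ A B → ∀ a ∈ A, a ∈ C → A ∪ B ⊆ C := by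
      intro A B hAB a ha haC
      obtain ⟨b, hb⟩ := hAB.2.1
      have hB : B ⊆ C := fun b hb =>
        SimpleGraph.Reachable.trans haC (hAB.2.2 a ha b hb).reachable
      rintro x (hx | hx)
      · exact SimpleGraph.Reachable.trans (hB hb) (hAB.2.2 x hx b hb).symm.reachable
      · exact hB hx
    rintro A B hAB a (ha | ha) haC
    · exact key A B hAB a ha haC
    · rw [Set.union_comm]
      exact key B A hAB.symm a ha haC
  have key : ∀ M, (skeleton (raagIntersectionComplex Λ)).Reachable M M₀ →
      ∃ g S, M.1 = coset Λ g S ∧ S ⊆ C ∧ InCoset Λ g₀ C g := by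
    rintro M ⟨p⟩
    induction p with
    | nil => exact ⟨g₀, A₀ ∪ B₀, hM₀, hjoin A₀ B₀ hAB₀.1 a₀ (Or.inl ha₀)
        SimpleGraph.Reachable.rfl, inCoset_self _ _⟩
    | @cons M' M _ hadj _ ih =>
      obtain ⟨g, S, hM, hS, hg⟩ := ih hM₀
      obtain ⟨-, h, a, b, -, hle⟩ := (mem_faces_iff h3).mp hadj.2
      have hM1 := hle M (by simp)
      have hM1' := hle M' (by simp)
      obtain ⟨g', A', B', hAB', hM'⟩ := (isMaximalProduct_iff h3).mp M'.2
      rw [hM] at hM1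
      rw [hM'] at hM1'
      refine ⟨h, A' ∪ B', hM'.trans (coset_eq_of_inCoset (inCoset_of_coset_subset hM1')),
        hjoin A' B' hAB'.1 a (subset_of_coset_subset hM1' (Or.inl rfl))
          (hS (subset_of_coset_subset hM1 (Or.inl rfl))), ?_⟩
      have := hg.mul_right (par_mono hS (inCoset_of_coset_subset hM1))
      rwa [mul_inv_cancel_left] at this
  -- The coset through `g₀ * w` is reached, hence `gen w` lies in `par C`.
  have hall : ∀ w, Λ.Reachable a₀ w := by
    intro w
    let M : (raagIntersectionComplex Λ).V := ⟨coset Λ (g₀ * gen Λ w) (A₀ ∪ B₀),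
      (isMaximalProduct_iff h3).mpr ⟨_, A₀, B₀, hAB₀, rfl⟩⟩
    obtain ⟨g, S, hM, hS, hg⟩ := key M (hconn.preconnected M M₀)
    have h1 := inCoset_of_coset_subset hM.subset
    have h2 := hg.mul_right (par_mono hS h1)
    rw [mul_inv_cancel_left] at h2
    unfold InCoset at h2
    rw [inv_mul_cancel_left] at h2
    have hw : w ∈ C := gen_mem_par_iff.mp h2
    exact hw
  have : Nonempty W := ⟨a₀⟩
  exact ⟨fun v w => (hall v).symm.trans (hall w)⟩

/-- If the intersection complex has no cycles then the defining graph has none: the cosets of the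
stars of the vertices of a cycle would form a cycle. -/
theorem isAcyclic_of_skeleton_isAcyclic [Finite W] (h3 : Λ.CliqueFree 3)
    (hsub : ∀ A B, IsJoin Λ A B → A.Subsingleton ∨ B.Subsingleton)
    (hacyc : (skeleton (raagIntersectionComplex Λ)).IsAcyclic) : Λ.IsAcyclic := by
  classical
  let m : ∀ v, IsInterior Λ v → (raagIntersectionComplex Λ).V := fun v hv =>
    ⟨coset Λ 1 (star Λ v), (isMaximalProduct_iff h3).mpr
      ⟨1, _, _, IsInterior.isMaximalJoin h3 hsub hv, rfl⟩⟩
  let f : Λ.induce {v | IsInterior Λ v} →g skeleton (raagIntersectionComplex Λ) :=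
    { toFun := fun v => m v.1 v.2
      map_rel' := by
        rintro ⟨v, hv⟩ ⟨w, hw⟩ hvw
        have hvw : Λ.Adj v w := hvw
        refine ⟨fun h => hvw.ne (star_injective h3 hv (eq_of_coset_eq (congrArg Subtype.val h))),
          (mem_faces_iff h3).mpr ⟨Finset.insert_nonempty _ _, 1, v, w, hvw, fun M hM => ?_⟩⟩
        rcases Finset.mem_insert.mp hM with rfl | hM
        · refine coset_mono ?_
          rintro _ (rfl | rfl)
          · exact mem_star_self _
          · exact mem_star_of_adj hvw
        · rw [Finset.mem_singleton.mp hM]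
          refine coset_mono ?_
          rintro _ (rfl | rfl)
          · exact mem_star_of_adj hvw.symm
          · exact mem_star_self _ }
  have hf : Function.Injective f := fun v w h =>
    Subtype.ext (star_injective h3 v.2 (eq_of_coset_eq (congrArg Subtype.val h)))
  have hind := hacyc.comap f hf
  intro v c hc
  -- The vertices of a cycle have at least two neighbours.
  have hint : ∀ x ∈ c.support, x ∈ {v | IsInterior Λ v} := fun x hx => by
    obtain ⟨y, z, hyz, h⟩ := Set.ncard_eq_two.mp (hc.ncard_neighborSet_toSubgraph_eq_two hx)
    have hle := c.toSubgraph.neighborSet_subset x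
    rw [h] at hle
    exact ⟨y, hle (Or.inl rfl), z, hle (Or.inr rfl), hyz⟩
  refine hind (c.induce _ hint) (SimpleGraph.Walk.IsCycle.of_map
    (f := (SimpleGraph.Embedding.induce _).toHom) ?_)
  rwa [SimpleGraph.Walk.map_induce]

/-- Two maximal joins that share an edge give a path with three edges. -/
theorem three_le_ediam_of_skeleton_adj [Finite W] (hΛ : Λ.IsTree)
    {M M' : (raagIntersectionComplex Λ).V}
    (h : (skeleton (raagIntersectionComplex Λ)).Adj M M') : 3 ≤ Λ.ediam := by
  classical
  have h3 : Λ.CliqueFree 3 := hΛ.isAcyclic.cliqueFree le_rfl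
  obtain ⟨hne, hf⟩ := h
  obtain ⟨-, g, a, b, hab, hle⟩ := (mem_faces_iff h3).mp hf
  have hrep : ∀ M : (raagIntersectionComplex Λ).V, coset Λ g {a, b} ⊆ M.1 →
      ∃ A B, IsMaximalJoin Λ A B ∧ M.1 = coset Λ g (A ∪ B) ∧ a ∈ A ∧ b ∈ B := by
    intro M hM
    obtain ⟨g', A, B, hAB, hM'⟩ := (isMaximalProduct_iff h3).mp M.2
    rw [hM'] at hM
    have h1 := coset_eq_of_inCoset (inCoset_of_coset_subset hM)
    have hs := subset_of_coset_subset hM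
    rcases hAB.1.mem_of_adj h3 (hs (Or.inl rfl)) (hs (Or.inr rfl)) hab with ⟨ha, hb⟩ | ⟨ha, hb⟩
    · exact ⟨A, B, hAB, hM'.trans h1, ha, hb⟩
    · exact ⟨B, A, hAB.symm, by rw [Set.union_comm, ← h1, hM'], ha, hb⟩
  obtain ⟨A, B, hAB, hM, ha, hb⟩ := hrep M (hle M (by simp))
  obtain ⟨A', B', hAB', hM', ha', hb'⟩ := hrep M' (hle M' (by simp))
  have hneq : A ∪ B ≠ A' ∪ B' := fun h => hne (Subtype.ext (by rw [hM, hM', h]))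
  obtain ⟨c, hc, hc'⟩ := Set.not_subset.mp fun h => hneq (h.antisymm (hAB.2 _ _ hAB'.1 h))
  obtain ⟨e, he, he'⟩ := Set.not_subset.mp fun h => hneq ((hAB'.2 _ _ hAB.1 h).antisymm h)
  have hca : a ≠ c := by rintro rfl; exact hc' (Or.inl ha')
  have hcb : b ≠ c := by rintro rfl; exact hc' (Or.inr hb')
  have hea : a ≠ e := by rintro rfl; exact he' (Or.inl ha)
  have heb : b ≠ e := by rintro rfl; exact he' (Or.inr hb)
  -- If `A` and `A'` have a second element then both joins are contained in the star of `b`, so that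
  -- the two maximal joins coincide.
  have key : ∀ {A B A' B' : Set W} {a b c e : W}, IsMaximalJoin Λ A B → IsMaximalJoin Λ A' B' →
      a ∈ A → b ∈ B → a ∈ A' → b ∈ B' → a ≠ c → a ≠ e → c ∈ A → e ∈ A' → e ∈ A ∪ B := by
    intro A B A' B' a b c e hAB hAB' ha hb ha' hb' hca hea hc he
    have hB : B.Subsingleton := (subsingleton_of_isJoin hΛ hAB.1).resolve_left
      fun h => hca (h ha hc)
    have hB' : B'.Subsingleton := (subsingleton_of_isJoin hΛ hAB'.1).resolve_left
      fun h => hea (h ha' he)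
    refine hAB.2 (A ∪ A') {b} ⟨⟨a, Or.inl ha⟩, ⟨b, rfl⟩, ?_⟩ ?_ (Or.inl (Or.inr he))
    · rintro x (hx | hx) y hy
      · exact hAB.1.2.2 x hx y (Set.mem_singleton_iff.mp hy ▸ hb)
      · exact hAB'.1.2.2 x hx y (Set.mem_singleton_iff.mp hy ▸ hb')
    · rintro x (hx | hx)
      · exact Or.inl (Or.inl hx)
      · exact Or.inr (hB hx hb)
  rcases hc with hc | hc <;> rcases he with he | he
  · exact absurd (key hAB hAB' ha hb ha' hb' hca hea hc he) he'
  · exact three_le_ediam hΛ (hAB.1.2.2 c hc b hb) hab.symm (hAB'.1.2.2 a ha' e he) hca.symm heb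
  · exact three_le_ediam hΛ (hAB.1.2.2 a ha c hc).symm hab (hAB'.1.2.2 e he b hb').symm
      hcb.symm hea
  · refine absurd (key hAB.symm hAB'.symm hb ha hb' ha' hcb heb hc he) ?_
    rwa [Set.union_comm]

end Converse

end RAAG

theorem mainTheorem7 {V : Type u} [Finite V] (T : SimpleGraph V) (hT : T.IsTree)
    (hdiam : 3 ≤ T.ediam) {W : Type v} [Finite W] (Λ : SimpleGraph W)
    (hΛ : salvettiDim Λ = 2) :
    GroupedComplex.SemiIsomorphic (raagIntersectionComplex Λ) (raagIntersectionComplex T) ↔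
      (Λ.IsTree ∧ 3 ≤ Λ.ediam) := by
  classical
  have hT' := RAAG.isLongTree_of_ediam hT hdiam
  refine ⟨?_, fun ⟨h, h'⟩ => (RAAG.isLongTree_of_ediam h h').semiIsomorphic hT'⟩
  rintro ⟨φ, hφ, hφ', htype⟩
  have h3 := RAAG.cliqueFree_of_salvettiDim hΛ
  let ψ : RAAG.skeleton (raagIntersectionComplex Λ) ≃g RAAG.skeleton (raagIntersectionComplex T) :=
    { toEquiv := φ
      map_rel_iff' := by
        intro M M'
        refine and_congr φ.injective.ne_iff ⟨fun h => ?_, fun h => ?_⟩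
        · simpa using hφ'.map_face _ h
        · simpa using hφ.map_face _ h }
  have htree := (SimpleGraph.Iso.isTree_iff ψ).mpr hT'.skeleton_isTree
  have hsub : ∀ A B, RAAG.IsJoin Λ A B → A.Subsingleton ∨ B.Subsingleton := by
    refine fun A B => RAAG.subsingleton_of_assigned h3 fun M => ?_
    obtain ⟨H₁, H₂, H₁', H₂', h, h', h₁, h₂⟩ := htype {M} (RAAG.singleton_mem_faces h3 M)
    rw [Finset.image_singleton] at h'
    refine ⟨H₁, H₂, h, ?_⟩
    rw [h₁, h₂]
    obtain ⟨g, v, hv, hM⟩ := hT'.exists_eq_vertex (φ M)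
    rcases RAAG.assigned_singleton hT'.cliqueFree hv.isJoin (congrArg Subtype.val hM) h' with
      ⟨rfl, -⟩ | ⟨-, rfl⟩
    · exact Or.inl (RAAG.isCyclic_conjPar g v)
    · exact Or.inr (RAAG.isCyclic_conjPar g v)
  have hΛtree : Λ.IsTree := ⟨RAAG.connected_of_skeleton_connected h3 htree.connected,
    RAAG.isAcyclic_of_skeleton_isAcyclic h3 hsub htree.isAcyclic⟩
  refine ⟨hΛtree, ?_⟩
  obtain ⟨M⟩ := htree.connected.nonempty
  obtain ⟨N, hN⟩ := (hT'.infinite_neighborSet (ψ M)).nonempty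
  refine RAAG.three_le_ediam_of_skeleton_adj hΛtree (M := M) (M' := ψ.symm N) ?_
  rw [← ψ.map_adj_iff, RelIso.apply_symm_apply]
  exact hN
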